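/- **Setting.** Let $d\ge 1$, $\mathbb T^d=\mathbb R^d/\mathbb Z^d$ with normalized Lebesgue measure, and $\lambda\ge 0$. Let $a:\mathbb R^d\to\mathbb R^d$ be one-to-one and $C^\infty$, with $|a(v)|\le C(1+|v|)$, with $\|\partial_v^\alpha a\|_{L^\infty}\le C_\alpha$ for all $|\alpha|\ne 0$, and whose inverse $a^{-1}$, defined on $a(\mathbb R^d)$, is smooth there and satisfies $|\partial^\alpha a^{-1}(w)|\le C_\alpha(1+|a^{-1}(w)|)^{1+\lambda|\alpha|}$ for all $w\in a(\mathbb R^d)$ and all $\alpha$. For $k\in\mathbb N$, $r\in\mathbb R$ put $$\|f\|_{\mathcal H^k_r}=\Big(\sum_{|\alpha|+|\beta|\le k}\int_{\mathbb T^d}\int_{\mathbb R^d}(1+|v|^2)^r|\partial_x^\alpha\partial_v^\beta f|^2\,dv\,dx\Big)^{1/2},$$ the sum being over $\alpha\in\{1,\dots,d\}^m$, $\beta\in\{1,\dots,d\}^n$, $m+n\le k$, with $\partial_x^\alpha=\partial_{x_{\alpha_1}}\cdots\partial_{x_{\alpha_m}}$ and $\partial_v^\beta=\partial_{v_{\beta_1}}\cdots\partial_{v_{\beta_n}}$.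 **Averaging operator.** For $U(t,s,x,v)$ and $i\in\{1,\dots,d\}$, $$K^{(i)}_U(H)(t,x)=\int_0^t\int_{\mathbb R^d}(\partial_{x_i}H)(s,x-(t-s)a(v))\,U(t,s,x,v)\,dv\,ds .$$ For a general $H\in L^2(0,T;L^2(\mathbb T^d))$, $\partial_{x_i}H$ is a distribution and $K^{(i)}_U(H)$ is understood weakly: $g\in L^2(0,T;L^2_x)$ equals $K^{(i)}_U(H)$ if, for all $\varphi\in C_c^\infty((0,T)\times\mathbb T^d)$, $$\int_0^T\!\!\int_{\mathbb T^d} g\varphi\,dx\,dt=-\int_0^T\!\!\int_{\mathbb T^d}\int_0^t\!\!\int_{\mathbb R^d}H(s,x-(t-s)a(v))\,\partial_{x_i}\big(U(t,s,x,v)\varphi(t,x)\big)\,dv\,ds\,dx\,dt,$$ the right-hand side being absolutely convergent. **Proposition.** Let $k>1+d$ be an integer, $\sigma>d/2$ and $r_k=\sigma+(1+\lambda)(d+k)$. There is a constant $C$, depending only on $d,k,\sigma,\lambda,a$, such that the following holds for every $T>0$, every $i\in\{1,\dots,d\}$, every measurable real-valued $U$ such that $U(t,s,\cdot,\cdot)$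 is of class $C^k$ on $\mathbb T^d\times\mathbb R^d$ for all $0\le s,t\le T$ (in particular every smooth $U$) and $\sup_{0\le s,t\le T}\|U(t,s,\cdot)\|_{\mathcal H^k_{r_k}}<\infty$, and every real-valued $H\in L^2(0,T;L^2_x)$. There is a $g=K^{(i)}_U(H)\in L^2(0,T;L^2_x)$ in the weak sense above, it is unique up to equality almost everywhere, and $$\|K^{(i)}_U(H)\|_{L^2(0,T;L^2_x)}\le C\,\sup_{0\le s,t\le T}\|U(t,s,\cdot)\|_{\mathcal H^k_{r_k}}\,\|H\|_{L^2(0,T;L^2_x)} .$$ If moreover $H(s,\cdot)$ is $C^1$ for every $s\in(0,T)$ and $\partial_{x_i}H\in L^2(0,T;L^2_x)$, then for almost every $(t,x)$ the integral defining $K^{(i)}_U(H)(t,x)$ converges absolutely and its value is $g(t,x)$. -/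

import Mathlib

open MeasureTheory
open scoped ENNReal NNReal ContDiff

noncomputable section

namespace VlasovAveraging

/-- The velocity space `ℝ^d`, with its Euclidean norm. -/
abbrev Vel (d : ℕ) : Type := EuclideanSpace ℝ (Fin d)

/-- The flat torus `𝕋^d = ℝ^d / ℤ^d`; its `volume` is the Lebesgue measure of total mass one. -/
abbrev Torus (d : ℕ) : Type := UnitAddTorus (Fin d)

/-- The projection `ℝ^d → 𝕋^d`. -/
def toTorus {d : ℕ} (x : Vel d) : Torus d := fun j => (x j : UnitAddCircle)

/-- Admissible advection fields with inverse-growth exponent `lam`: `a` is one to one and smooth,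
grows at most linearly, has bounded derivatives of all orders at least one, and its inverse, defined
on `a(ℝ^d)`, is smooth there with `|∂^α a⁻¹(w)| ≤ C_α (1 + |a⁻¹(w)|)^(1 + lam |α|)`. -/
structure IsAdvectionField {d : ℕ} (a : Vel d → Vel d) (lam : ℝ) : Prop where
  injective : Function.Injective a
  smooth : ContDiff ℝ ∞ a
  growth : ∃ C : ℝ, ∀ v, ‖a v‖ ≤ C * (1 + ‖v‖)
  deriv_bounded : ∀ n : ℕ, n ≠ 0 → ∃ C : ℝ, ∀ v, ‖iteratedFDeriv ℝ n a v‖ ≤ C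
  inv_smooth : ContDiffOn ℝ ∞ (Function.invFun a) (Set.range a)
  inv_growth : ∀ n : ℕ, ∃ C : ℝ, ∀ w ∈ Set.range a,
    ‖iteratedFDerivWithin ℝ n (Function.invFun a) (Set.range a) w‖
      ≤ C * (1 + ‖Function.invFun a w‖) ^ (1 + lam * (n : ℝ))

/-- The partial derivative `∂_{x_i}` of a function on the torus. -/
def torusDeriv {d : ℕ} (i : Fin d) (f : Torus d → ℝ) (x : Torus d) : ℝ :=
  deriv (fun h : ℝ => f (x + Pi.single i (h : UnitAddCircle))) 0

/-- The operator `∂_{x_i}` on functions of `(x, v)`. -/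
def dx {d : ℕ} (i : Fin d) (f : Torus d → Vel d → ℝ) : Torus d → Vel d → ℝ :=
  fun x v => torusDeriv i (fun y => f y v) x

/-- The operator `∂_{v_i}` on functions of `(x, v)`. -/
def dv {d : ℕ} (i : Fin d) (f : Torus d → Vel d → ℝ) : Torus d → Vel d → ℝ :=
  fun x v => lineDeriv ℝ (f x) v (EuclideanSpace.single i 1)

/-- `∂_x^α ∂_v^β f = ∂_{x_{α_1}} ⋯ ∂_{x_{α_m}} ∂_{v_{β_1}} ⋯ ∂_{v_{β_n}} f` for
`α ∈ {1, …, d}^m` and `β ∈ {1, …, d}^n`. -/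
def mixedDeriv {d m n : ℕ} (α : Fin m → Fin d) (β : Fin n → Fin d)
    (f : Torus d → Vel d → ℝ) : Torus d → Vel d → ℝ :=
  (List.ofFn α).foldr dx ((List.ofFn β).foldr dv f)

/-- The weighted Sobolev norm
`‖f‖_{H^k_r} = (∑_{|α| + |β| ≤ k} ∫∫ (1 + |v|²)^r |∂_x^α ∂_v^β f|² dv dx)^{1/2}`,
with values in `[0, ∞]`. -/
def weightedSobolevNorm {d : ℕ} (k : ℕ) (r : ℝ) (f : Torus d → Vel d → ℝ) : ℝ≥0∞ :=
  (∑ p ∈ (Finset.range (k + 1) ×ˢ Finset.range (k + 1)).filter (fun p => p.1 + p.2 ≤ k),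
    ∑ α : Fin p.1 → Fin d, ∑ β : Fin p.2 → Fin d,
      ∫⁻ x : Torus d, ∫⁻ v : Vel d,
        ENNReal.ofReal ((1 + ‖v‖ ^ 2) ^ r * |mixedDeriv α β f x v| ^ 2)) ^ (1 / 2 : ℝ)

/-- `sup_{0 ≤ s, t ≤ T} ‖U(t, s, ·)‖_{H^k_r}`. -/
def supSobolevNorm {d : ℕ} (k : ℕ) (r T : ℝ) (U : ℝ → ℝ → Torus d → Vel d → ℝ) : ℝ≥0∞ :=
  ⨆ s ∈ Set.Icc (0 : ℝ) T, ⨆ t ∈ Set.Icc (0 : ℝ) T, weightedSobolevNorm k r (U t s)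

/-- Lebesgue measure on `(0, T) × 𝕋^d`. -/
def spaceTime (d : ℕ) (T : ℝ) : Measure (ℝ × Torus d) :=
  (volume.restrict (Set.Ioo (0 : ℝ) T)).prod volume

/-- `H ∈ L²(0, T; L²_x)`. -/
def MemL2 {d : ℕ} (T : ℝ) (H : ℝ → Torus d → ℝ) : Prop :=
  MemLp (Function.uncurry H) 2 (spaceTime d T)

/-- The norm of `L²(0, T; L²_x)`, with values in `[0, ∞]`. -/
def normL2 {d : ℕ} (T : ℝ) (H : ℝ → Torus d → ℝ) : ℝ≥0∞ :=
  eLpNorm (Function.uncurry H) 2 (spaceTime d T)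

/-- The free-transport foot `x - (t - s) a(v)` in the torus. -/
def foot {d : ℕ} (a : Vel d → Vel d) (t s : ℝ) (x : Torus d) (v : Vel d) : Torus d :=
  x - toTorus ((t - s) • a v)

/-- The integrand `(∂_{x_i} H)(s, x - (t - s) a(v)) U(t, s, x, v)`. -/
def averagingIntegrand {d : ℕ} (a : Vel d → Vel d) (U : ℝ → ℝ → Torus d → Vel d → ℝ) (i : Fin d)
    (H : ℝ → Torus d → ℝ) (t : ℝ) (x : Torus d) (s : ℝ) (v : Vel d) : ℝ :=
  torusDeriv i (H s) (foot a t s x v) * U t s x v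

/-- The averaging operator
`K_U^{(i)}(H)(t, x) = ∫_0^t ∫ (∂_{x_i} H)(s, x - (t - s) a(v)) U(t, s, x, v) dv ds`
given by its formula, for functions `H` that are differentiable in `x`. -/
def averagingOp {d : ℕ} (a : Vel d → Vel d) (U : ℝ → ℝ → Torus d → Vel d → ℝ) (i : Fin d)
    (H : ℝ → Torus d → ℝ) (t : ℝ) (x : Torus d) : ℝ :=
  ∫ s in (0 : ℝ)..t, ∫ v : Vel d, averagingIntegrand a U i H t x s v

/-- Test functions on `(0, T) × 𝕋^d`: smooth, and vanishing for `t` near and beyond the ends of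
`(0, T)`. -/
structure IsTest {d : ℕ} (T : ℝ) (φ : ℝ → Torus d → ℝ) : Prop where
  smooth : ContDiff ℝ ∞ (fun p : ℝ × Vel d => φ p.1 (toTorus p.2))
  support : ∃ ε > 0, ∀ t x, (t < ε ∨ T - ε < t) → φ t x = 0

/-- The set `0 < s < t < T` of points `((t, x), (s, v))`. -/
def triangle (d : ℕ) (T : ℝ) : Set ((ℝ × Torus d) × (ℝ × Vel d)) :=
  {p | 0 < p.2.1 ∧ p.2.1 < p.1.1 ∧ p.1.1 < T}

/-- The integrand `H(s, x - (t - s) a(v)) ∂_{x_i}(U(t, s, x, v) φ(t, x))` at `((t, x), (s, v))`. -/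
def weakIntegrand {d : ℕ} (a : Vel d → Vel d) (U : ℝ → ℝ → Torus d → Vel d → ℝ) (i : Fin d)
    (H φ : ℝ → Torus d → ℝ) (p : (ℝ × Torus d) × (ℝ × Vel d)) : ℝ :=
  H p.2.1 (foot a p.1.1 p.2.1 p.1.2 p.2.2) *
    torusDeriv i (fun y => U p.1.1 p.2.1 y p.2.2 * φ p.1.1 y) p.1.2

/-- `g ∈ L²(0, T; L²_x)` is `K_U^{(i)}(H)` for a merely square integrable `H`, whose derivative
`∂_{x_i} H` is a distribution: as `(∂_{x_i} H)(s, x - (t - s) a(v))` is the `x_i`-derivative of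
`H(s, x - (t - s) a(v))`, this means
`∫∫ g φ dx dt = - ∫∫∫∫_{0 < s < t < T} H(s, x - (t - s) a(v)) ∂_{x_i}(U φ) dv ds dx dt`
for all test functions `φ`, with an absolutely convergent right-hand side. -/
structure IsAveraging {d : ℕ} (T : ℝ) (a : Vel d → Vel d) (U : ℝ → ℝ → Torus d → Vel d → ℝ)
    (i : Fin d) (H g : ℝ → Torus d → ℝ) : Prop where
  memL2 : MemL2 T g
  integrable : ∀ φ, IsTest T φ → IntegrableOn (weakIntegrand a U i H φ) (triangle d T)
  weak_eq : ∀ φ, IsTest T φ →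
    ∫ p, g p.1 p.2 * φ p.1 p.2 ∂(spaceTime d T)
      = - ∫ p in triangle d T, weakIntegrand a U i H φ p

end VlasovAveraging

end

noncomputable section

namespace VlasovAveraging

/-! ### Calculus on the torus -/

section Torus

variable {d : ℕ}

/-! The proof is by duality. For fixed times `0 < s < t < T`, put `τ = t - s` and pair `H(s, x - τ
a(v))` with `∂_{x_i}(U φ)`. Expand `H(s)` and `φ(t)` in Fourier series on the torus. Transport
multiplies the character of frequency `l` by `exp(-2πi τ l · a(v))`, and moving `∂_{x_i}` onto it
costs a factor `2π|l_i|`. The pairing is thus at most the sum over `l, m` of `|Ĥ(s,l)| |φ̂(t,m)|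
2π|l| |osc(m + l, τ l)|`, up to signs of frequencies, where `osc(n, ξ)` is the Fourier coefficient
of `U` at `n` in position, integrated in velocity against `exp(2πi ξ · a(v))`
(`enorm_integral_transport_le`).

The loss `|l|` is recovered from the oscillation in velocity. The vector field `(Da)⁻¹ e_m`
differentiates `ξ · a(v)` to the constant `ξ_m`, so integration by parts along it gains a power of
`ξ_m` with no nondegeneracy assumption beyond the growth of `a⁻¹`. It costs powers of `(1 +
|v|²)^{(1+λ)/2}`, because `∂(Da)⁻¹ = -(Da)⁻¹ (∂Da) (Da)⁻¹`, and these are paid by the weight `r_k`.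
Interpolating between `d` derivatives in `x` with two in `v`, and `d + 1` in `x` with one in `v`,
gives `|osc(n, ξ)| ≲ max(1,|n|)^{-(d+1/2)} max(1,|ξ|)^{-3/2}` (`exists_osc_decay`). Both cases use
`d + 2 ≤ k` derivatives.

The first factor is summable over `n = m + l`. The second satisfies `∫_0^∞ |l| max(1, τ|l|)^{-3/2}
dτ ≤ 8` uniformly in `l`: the lost derivative is the Jacobian of `τ ↦ τ|l|`. A Schur test
(`lintegral_schur_le`) then bounds the form by `C N (‖H‖² + ‖φ‖²)`, with `N` the supremum of the
norms of `U` and `C` independent of `T` (`exists_form_bound`). Scaling `φ` turns the sum into a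
product, and the Riesz theorem produces `g` (`exists_isAveraging`).

Uniqueness holds because integrable functions are determined by test functions
(`ae_eq_zero_of_isTest`). For differentiable `H`, Fubini and integration by parts on the torus show
that the explicit integral satisfies the same weak equation, and uniqueness among integrable
functions identifies it with `g`. -/

theorem volume_torus (d : ℕ) :
    (volume : Measure (Torus d)) = Measure.pi (fun _ => AddCircle.haarAddCircle) := by
  change Measure.pi (fun _ => volume) = _
  congr 1
  ext1 i
  -- The circle has length one, so the scalar relating the two measures is one.
  rw [AddCircle.volume_eq_smul_haarAddCircle]
  simp

instance : IsProbabilityMeasure (volume : Measure (Torus d)) := by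
  rw [volume_torus]
  infer_instance

/-- Functions on the torus are studied through their periodic lifts: the quotient property brings
continuity down, and openness lets it survive products with further variables. -/
theorem isOpenQuotientMap_toTorus : IsOpenQuotientMap (toTorus : Vel d → Torus d) := by
  have h : IsOpenQuotientMap (Pi.map (fun (_ : Fin d) (t : ℝ) => (t : UnitAddCircle))) :=
    IsOpenQuotientMap.piMap fun _ => QuotientAddGroup.isOpenQuotientMap_mk
  exact h.comp (EuclideanSpace.equiv (Fin d) ℝ).toHomeomorph.isOpenQuotientMap

@[fun_prop]
theorem continuous_toTorus : Continuous (toTorus : Vel d → Torus d) :=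
  isOpenQuotientMap_toTorus.continuous

theorem surjective_toTorus : Function.Surjective (toTorus : Vel d → Torus d) :=
  isOpenQuotientMap_toTorus.surjective

theorem toTorus_add (x y : Vel d) : toTorus (x + y) = toTorus x + toTorus y := by
  ext j; simp [toTorus]

theorem toTorus_add_smul_single (y : Vel d) (i : Fin d) (h : ℝ) :
    toTorus (y + h • EuclideanSpace.single i 1)
      = toTorus y + Pi.single i (h : UnitAddCircle) := by
  funext j
  by_cases hj : j = i
  · subst hj; simp [toTorus]
  · simp [toTorus, hj]

/-- A shift by `h` in the `i`-th circle lifts to a shift by `h e_i` in `ℝ^d`, so the derivative on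
the torus is a line derivative of the lift. -/
theorem hasDerivAt_torus {E : Type*} [NormedAddCommGroup E] [NormedSpace ℝ E]
    {f : Torus d → E} {y : Vel d} {L : Vel d →L[ℝ] E}
    (hf : HasFDerivAt (fun z => f (toTorus z)) L y) (i : Fin d) :
    HasDerivAt (fun h : ℝ => f (toTorus y + Pi.single i (h : UnitAddCircle)))
      (L (EuclideanSpace.single i 1)) 0 := by
  have h1 := hf.hasLineDerivAt (EuclideanSpace.single i (1 : ℝ))
  simpa only [HasLineDerivAt, toTorus_add_smul_single] using h1

theorem torusDeriv_toTorus {f : Torus d → ℝ} {y : Vel d}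
    (hf : DifferentiableAt ℝ (fun z => f (toTorus z)) y) (i : Fin d) :
    torusDeriv i f (toTorus y)
      = fderiv ℝ (fun z => f (toTorus z)) y (EuclideanSpace.single i 1) :=
  (hasDerivAt_torus hf.hasFDerivAt i).deriv

theorem hasDerivAt_torusDeriv {f : Torus d → ℝ}
    (hf : Differentiable ℝ (fun z => f (toTorus z))) (i : Fin d) (x : Torus d) :
    HasDerivAt (fun h : ℝ => f (x + Pi.single i (h : UnitAddCircle))) (torusDeriv i f x) 0 := by
  obtain ⟨y, rfl⟩ := surjective_toTorus x
  rw [torusDeriv_toTorus (hf y)]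
  exact hasDerivAt_torus (hf y).hasFDerivAt i

theorem contDiff_torusDeriv {f : Torus d → ℝ} {m n : WithTop ℕ∞} (hmn : m + 1 ≤ n)
    (hf : ContDiff ℝ n (fun z => f (toTorus z))) (i : Fin d) :
    ContDiff ℝ m (fun z => torusDeriv i f (toTorus z)) := by
  have h1 : ContDiff ℝ 1 (fun z => f (toTorus z)) := hf.of_le (le_trans (by simp) hmn)
  have : (fun z => torusDeriv i f (toTorus z))
      = fun z => fderiv ℝ (fun z => f (toTorus z)) z (EuclideanSpace.single i 1) :=
    funext fun z => torusDeriv_toTorus (h1.differentiable one_ne_zero z) i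
  rw [this]
  exact (hf.fderiv_right hmn).clm_apply contDiff_const

theorem continuous_of_toTorus {E : Type*} [TopologicalSpace E] {f : Torus d → E}
    (hf : Continuous (fun z => f (toTorus z))) : Continuous f :=
  isOpenQuotientMap_toTorus.isQuotientMap.continuous_iff.2 hf

/-- The integral over the torus of a partial derivative vanishes. -/
theorem integral_torus_deriv_eq_zero {E : Type*} [NormedAddCommGroup E] [NormedSpace ℝ E]
    {f f' : Torus d → E} (hf : Continuous f) (hf' : Continuous f') (i : Fin d)
    (h : ∀ x, HasDerivAt (fun h : ℝ => f (x + Pi.single i (h : UnitAddCircle))) (f' x) 0) :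
    ∫ x, f' x = 0 := by
  by_cases hE : CompleteSpace E
  swap
  · simp [integral, hE]
  obtain ⟨B, hB⟩ := isCompact_univ.exists_bound_of_continuousOn hf'.continuousOn
  have hderiv : ∀ (x : Torus d) (r : ℝ),
      HasDerivAt (fun h : ℝ => f (x + Pi.single i (h : UnitAddCircle)))
        (f' (x + (Pi.single i (r : UnitAddCircle) : Torus d))) r := by
    intro x r
    have h0 := h (x + (Pi.single i (r : UnitAddCircle) : Torus d))
    rw [← sub_self r] at h0
    have h1 := h0.comp_sub_const r r
    refine h1.congr_of_eventuallyEq (Filter.Eventually.of_forall fun s => ?_)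
    simp only [add_assoc, ← Pi.single_add, ← AddCircle.coe_add]
    congr 3
    simp
  -- Differentiate `r ↦ ∫ f(x + r e_i) dx` under the integral sign. By translation invariance this
  -- function is constant.
  have key := (hasDerivAt_integral_of_dominated_loc_of_deriv_le (μ := (volume : Measure (Torus d)))
    (F := fun (r : ℝ) x => f (x + (Pi.single i (r : UnitAddCircle) : Torus d)))
    (F' := fun (r : ℝ) x => f' (x + (Pi.single i (r : UnitAddCircle) : Torus d)))
    (x₀ := 0) (bound := fun _ => B) (s := Set.univ) Filter.univ_mem
    (Filter.Eventually.of_forall fun r => Continuous.aestronglyMeasurable (by fun_prop))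
    (Continuous.integrable_of_hasCompactSupport (by fun_prop)
      (HasCompactSupport.of_compactSpace _))
    (Continuous.aestronglyMeasurable (by fun_prop))
    (Filter.Eventually.of_forall fun x r _ => hB _ (Set.mem_univ _))
    (integrable_const _)
    (Filter.Eventually.of_forall fun x r _ => hderiv x r)).2
  have hconst : (fun r : ℝ => ∫ x : Torus d, f (x + (Pi.single i (r : UnitAddCircle) : Torus d)))
      = fun _ => ∫ x, f x := by
    funext r
    exact integral_add_right_eq_self f _
  rw [hconst] at key
  have := key.unique (hasDerivAt_const (0 : ℝ) (∫ x, f x))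
  simpa using this

theorem mFourier_toTorus (n : Fin d → ℤ) (y : Vel d) :
    UnitAddTorus.mFourier n (toTorus y)
      = Complex.exp (2 * Real.pi * Complex.I * ((∑ j, (n j : ℝ) * y j : ℝ) : ℂ)) := by
  simp only [UnitAddTorus.mFourier, ContinuousMap.coe_mk, toTorus]
  push_cast
  rw [Finset.mul_sum, Complex.exp_sum]
  refine Finset.prod_congr rfl fun j _ => ?_
  rw [fourier_coe_apply]
  congr 1
  push_cast
  ring

theorem mFourier_add_apply (n : Fin d → ℤ) (x y : Torus d) :
    UnitAddTorus.mFourier n (x + y) = UnitAddTorus.mFourier n x * UnitAddTorus.mFourier n y := by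
  obtain ⟨x, rfl⟩ := surjective_toTorus x
  obtain ⟨y, rfl⟩ := surjective_toTorus y
  rw [← toTorus_add, mFourier_toTorus, mFourier_toTorus, mFourier_toTorus, ← Complex.exp_add]
  congr 1
  simp only [PiLp.add_apply, mul_add, Finset.sum_add_distrib]
  push_cast
  ring

theorem norm_mFourier_apply (n : Fin d → ℤ) (x : Torus d) : ‖UnitAddTorus.mFourier n x‖ = 1 := by
  obtain ⟨x, rfl⟩ := surjective_toTorus x
  rw [mFourier_toTorus, mul_comm, mul_comm (2 * _ : ℂ), ← mul_assoc]
  have := Complex.norm_exp_ofReal_mul_I ((∑ j, (n j : ℝ) * x j) * (2 * Real.pi))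
  rw [← this]
  congr 2
  push_cast
  ring

theorem hasDerivAt_mFourier (n : Fin d → ℤ) (i : Fin d) (x : Torus d) :
    HasDerivAt (fun h : ℝ => UnitAddTorus.mFourier n (x + Pi.single i (h : UnitAddCircle)))
      (2 * Real.pi * Complex.I * n i * UnitAddTorus.mFourier n x) 0 := by
  have h1 : ∀ h : ℝ, UnitAddTorus.mFourier n (x + Pi.single i (h : UnitAddCircle))
      = UnitAddTorus.mFourier n x * Complex.exp ((2 * Real.pi * Complex.I * n i) * (h : ℂ)) := by
    intro h
    have h2 := toTorus_add_smul_single (0 : Vel d) i h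
    have h3 : toTorus (0 : Vel d) = 0 := by ext j; simp [toTorus]
    rw [h3, zero_add, zero_add] at h2
    rw [mFourier_add_apply, ← h2, mFourier_toTorus]
    congr 2
    rw [Finset.sum_eq_single i]
    · simp
      ring
    · intro j _ hj
      simp [hj]
    · simp
  simp only [h1]
  have h2 : HasDerivAt (fun h : ℝ => (2 * Real.pi * Complex.I * n i) * (h : ℂ))
      ((2 * Real.pi * Complex.I * n i) * 1) 0 :=
    (HasDerivAt.ofReal_comp (hasDerivAt_id (0 : ℝ))).const_mul _
  have h3 := (h2.cexp).const_mul (UnitAddTorus.mFourier n x)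
  refine h3.congr_deriv ?_
  simp
  ring

/-- Integration by parts against a monomial. -/
theorem integral_mFourier_mul_torusDeriv (n : Fin d → ℤ) (i : Fin d) {f : Torus d → ℝ}
    (hf : ContDiff ℝ 1 (fun z => f (toTorus z))) :
    ∫ x, UnitAddTorus.mFourier n x * (torusDeriv i f x : ℂ)
      = -(2 * Real.pi * Complex.I * n i) * ∫ x, UnitAddTorus.mFourier n x * (f x : ℂ) := by
  have cf : Continuous f := continuous_of_toTorus hf.continuous
  have cf' : Continuous (torusDeriv i f) :=
    continuous_of_toTorus (contDiff_torusDeriv (m := 0) (by simp) hf i).continuous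
  have ce : Continuous (UnitAddTorus.mFourier n) := ContinuousMap.continuous _
  have h0 := integral_torus_deriv_eq_zero
    (f := fun x => UnitAddTorus.mFourier n x * (f x : ℂ))
    (f' := fun x => 2 * Real.pi * Complex.I * n i * UnitAddTorus.mFourier n x * (f x : ℂ)
      + UnitAddTorus.mFourier n x * (torusDeriv i f x : ℂ))
    (by fun_prop) (by fun_prop) i (fun x => by
      have := (hasDerivAt_mFourier n i x).fun_mul
        (hasDerivAt_torusDeriv (hf.differentiable one_ne_zero) i x).ofReal_comp
      refine this.congr_deriv ?_
      simp)
  have i1 : Integrable (fun x : Torus d =>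
      2 * Real.pi * Complex.I * n i * UnitAddTorus.mFourier n x * (f x : ℂ)) :=
    Continuous.integrable_of_hasCompactSupport (by fun_prop) (HasCompactSupport.of_compactSpace _)
  have i2 : Integrable (fun x : Torus d =>
      UnitAddTorus.mFourier n x * (torusDeriv i f x : ℂ)) :=
    Continuous.integrable_of_hasCompactSupport (by fun_prop) (HasCompactSupport.of_compactSpace _)
  rw [integral_add i1 i2] at h0
  simp only [mul_assoc, integral_const_mul] at h0 ⊢
  linear_combination h0

/-- Integration by parts on the torus. -/
theorem integral_torusDeriv_mul (i : Fin d) {f g : Torus d → ℝ}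
    (hf : ContDiff ℝ 1 (fun z => f (toTorus z))) (hg : ContDiff ℝ 1 (fun z => g (toTorus z))) :
    ∫ x, torusDeriv i f x * g x = -∫ x, f x * torusDeriv i g x := by
  have cf : Continuous f := continuous_of_toTorus hf.continuous
  have cg : Continuous g := continuous_of_toTorus hg.continuous
  have cf' : Continuous (torusDeriv i f) :=
    continuous_of_toTorus (contDiff_torusDeriv (m := 0) (by simp) hf i).continuous
  have cg' : Continuous (torusDeriv i g) :=
    continuous_of_toTorus (contDiff_torusDeriv (m := 0) (by simp) hg i).continuous
  have h0 := integral_torus_deriv_eq_zero (f := fun x => f x * g x)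
    (f' := fun x => torusDeriv i f x * g x + f x * torusDeriv i g x)
    (by fun_prop) (by fun_prop) i (fun x => by
      have := (hasDerivAt_torusDeriv (hf.differentiable one_ne_zero) i x).fun_mul
        (hasDerivAt_torusDeriv (hg.differentiable one_ne_zero) i x)
      refine this.congr_deriv ?_
      simp)
  rw [integral_add
    (Continuous.integrable_of_hasCompactSupport (by fun_prop) (HasCompactSupport.of_compactSpace _))
    (Continuous.integrable_of_hasCompactSupport (by fun_prop)
      (HasCompactSupport.of_compactSpace _))] at h0
  linarith

end Torus

/-! ### Functions of position and velocity -/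

section PhaseSpace

variable {d : ℕ}

/-- `F` is of class `C^n` on `𝕋^d × ℝ^d`. -/
def PhaseDiff (n : ℕ) (F : Torus d → Vel d → ℝ) : Prop :=
  ContDiff ℝ n (fun p : Vel d × Vel d => F (toTorus p.1) p.2)

theorem continuous_phase {E : Type*} [TopologicalSpace E] {F : Torus d → Vel d → E}
    (hF : Continuous (fun p : Vel d × Vel d => F (toTorus p.1) p.2)) :
    Continuous (fun p : Torus d × Vel d => F p.1 p.2) :=
  (isOpenQuotientMap_toTorus.prodMap IsOpenQuotientMap.id).isQuotientMap.continuous_iff.2 hF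

theorem PhaseDiff.continuous {n : ℕ} {F : Torus d → Vel d → ℝ} (hF : PhaseDiff n F) :
    Continuous (fun p : Torus d × Vel d => F p.1 p.2) :=
  continuous_phase (ContDiff.continuous hF)

theorem PhaseDiff.mono {m n : ℕ} {F : Torus d → Vel d → ℝ} (hF : PhaseDiff n F) (h : m ≤ n) :
    PhaseDiff m F :=
  ContDiff.of_le hF (by exact_mod_cast h)

theorem PhaseDiff.slice_left {n : ℕ} {F : Torus d → Vel d → ℝ} (hF : PhaseDiff n F) (v : Vel d) :
    ContDiff ℝ n (fun z => F (toTorus z) v) :=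
  ContDiff.comp (g := fun p : Vel d × Vel d => F (toTorus p.1) p.2) hF
    (contDiff_id.prodMk contDiff_const)

theorem PhaseDiff.slice_right {n : ℕ} {F : Torus d → Vel d → ℝ} (hF : PhaseDiff n F)
    (x : Torus d) : ContDiff ℝ n (F x) := by
  obtain ⟨y, rfl⟩ := surjective_toTorus x
  exact ContDiff.comp (g := fun p : Vel d × Vel d => F (toTorus p.1) p.2) hF
    (contDiff_const.prodMk contDiff_id)

theorem PhaseDiff.dx {n : ℕ} {F : Torus d → Vel d → ℝ} (hF : PhaseDiff (n + 1) F) (i : Fin d) :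
    PhaseDiff n (dx i F) := by
  have hd : Differentiable ℝ (fun p : Vel d × Vel d => F (toTorus p.1) p.2) :=
    ContDiff.differentiable hF (by norm_cast)
  have : (fun p : Vel d × Vel d => VlasovAveraging.dx i F (toTorus p.1) p.2)
      = fun p => fderiv ℝ (fun p : Vel d × Vel d => F (toTorus p.1) p.2) p
        (EuclideanSpace.single i 1, 0) := by
    funext p
    have h1 : HasFDerivAt (fun z => F (toTorus z) p.2)
        ((fderiv ℝ (fun p : Vel d × Vel d => F (toTorus p.1) p.2) p).comp
          (ContinuousLinearMap.inl ℝ (Vel d) (Vel d))) p.1 :=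
      HasFDerivAt.comp (g := fun p : Vel d × Vel d => F (toTorus p.1) p.2)
        (f := fun z => (z, p.2)) p.1
        (hd p).hasFDerivAt (hasFDerivAt_prodMk_left p.1 p.2)
    exact (hasDerivAt_torus (f := fun y => F y p.2) h1 i).deriv
  unfold PhaseDiff
  rw [this]
  exact (ContDiff.fderiv_right hF (by norm_cast)).clm_apply contDiff_const

theorem dv_apply {n : ℕ} {F : Torus d → Vel d → ℝ} (hF : PhaseDiff (n + 1) F) (j : Fin d)
    (x : Torus d) (v : Vel d) :
    dv j F x v = fderiv ℝ (F x) v (EuclideanSpace.single j 1) :=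
  ((hF.slice_right x).differentiable (by norm_cast) v).lineDeriv_eq_fderiv

theorem PhaseDiff.dv {n : ℕ} {F : Torus d → Vel d → ℝ} (hF : PhaseDiff (n + 1) F) (j : Fin d) :
    PhaseDiff n (dv j F) := by
  have hd : Differentiable ℝ (fun p : Vel d × Vel d => F (toTorus p.1) p.2) :=
    ContDiff.differentiable hF (by norm_cast)
  have : (fun p : Vel d × Vel d => VlasovAveraging.dv j F (toTorus p.1) p.2)
      = fun p => fderiv ℝ (fun p : Vel d × Vel d => F (toTorus p.1) p.2) p
        (0, EuclideanSpace.single j 1) := by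
    funext p
    have h1 : HasFDerivAt (fun z => F (toTorus p.1) z)
        ((fderiv ℝ (fun p : Vel d × Vel d => F (toTorus p.1) p.2) p).comp
          (ContinuousLinearMap.inr ℝ (Vel d) (Vel d))) p.2 :=
      HasFDerivAt.comp (g := fun p : Vel d × Vel d => F (toTorus p.1) p.2)
        (f := fun z => (p.1, z)) p.2
        (hd p).hasFDerivAt (hasFDerivAt_prodMk_right p.1 p.2)
    rw [dv_apply hF, h1.fderiv]
    rfl
  unfold PhaseDiff
  rw [this]
  exact (ContDiff.fderiv_right hF (by norm_cast)).clm_apply contDiff_const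

theorem PhaseDiff.foldr_dx {n : ℕ} {F : Torus d → Vel d → ℝ} (α : List (Fin d))
    (hF : PhaseDiff (n + α.length) F) : PhaseDiff n (α.foldr VlasovAveraging.dx F) := by
  induction α generalizing n with
  | nil => exact hF
  | cons i α ih =>
    rw [List.foldr_cons]
    refine PhaseDiff.dx (ih ?_) i
    simpa [add_assoc, add_comm 1] using hF

end PhaseSpace

/-! ### Coefficients of polynomial growth -/

section Growth

variable {d : ℕ} {lam : ℝ}

/-- The weight `(1 + |v|²)^((1 + lam) / 2)`. -/
def weight (lam : ℝ) (v : Vel d) : ℝ := (1 + ‖v‖ ^ 2) ^ ((1 + lam) / 2)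

theorem one_le_weight (hlam : 0 ≤ lam) (v : Vel d) : 1 ≤ weight lam v :=
  Real.one_le_rpow (by nlinarith [sq_nonneg ‖v‖]) (by linarith)

theorem weight_pos (lam : ℝ) (v : Vel d) : 0 < weight lam v :=
  Real.rpow_pos_of_pos (by positivity) _

/-- `c` is smooth with `|c| ≤ C weight^n`, and each of the first `p` derivatives costs at most one
more factor of `weight`. -/
def Growth (lam : ℝ) : ℕ → ℕ → (Vel d → ℝ) → Prop
  | 0, n, c => ContDiff ℝ ∞ c ∧ ∃ C, ∀ v, |c v| ≤ C * weight lam v ^ n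
  | p + 1, n, c => (ContDiff ℝ ∞ c ∧ ∃ C, ∀ v, |c v| ≤ C * weight lam v ^ n) ∧
      ∀ j : Fin d, Growth lam p (n + 1) (fun v => fderiv ℝ c v (EuclideanSpace.single j 1))

variable {p m n : ℕ} {b c : Vel d → ℝ}

theorem Growth.base (h : Growth lam p n c) :
    ContDiff ℝ ∞ c ∧ ∃ C, ∀ v, |c v| ≤ C * weight lam v ^ n := by
  cases p with
  | zero => exact h
  | succ p => exact h.1

theorem Growth.contDiff (h : Growth lam p n c) : ContDiff ℝ ∞ c := h.base.1

theorem Growth.differentiable (h : Growth lam p n c) : Differentiable ℝ c :=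
  h.contDiff.differentiable (by simp)

theorem Growth.pred (h : Growth lam (p + 1) n c) : Growth lam p n c := by
  induction p generalizing n c with
  | zero => exact h.1
  | succ p ih => exact ⟨h.1, fun j => ih (h.2 j)⟩

theorem Growth.add (hb : Growth lam p n b) (hc : Growth lam p n c) :
    Growth lam p n (fun v => b v + c v) := by
  have key : ∀ {n : ℕ} {b c : Vel d → ℝ},
      (ContDiff ℝ ∞ b ∧ ∃ C, ∀ v, |b v| ≤ C * weight lam v ^ n) →
      (ContDiff ℝ ∞ c ∧ ∃ C, ∀ v, |c v| ≤ C * weight lam v ^ n) →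
      (ContDiff ℝ ∞ (fun v => b v + c v) ∧ ∃ C, ∀ v, |b v + c v| ≤ C * weight lam v ^ n) := by
    rintro n b c ⟨h1, B, hB⟩ ⟨h2, C, hC⟩
    refine ⟨h1.add h2, B + C, fun v => (abs_add_le _ _).trans ?_⟩
    rw [add_mul]
    exact add_le_add (hB v) (hC v)
  induction p generalizing n b c with
  | zero => exact key hb hc
  | succ p ih =>
    refine ⟨key hb.1 hc.1, fun j => ?_⟩
    have : (fun v => fderiv ℝ (fun v => b v + c v) v (EuclideanSpace.single j 1))
        = fun v => fderiv ℝ b v (EuclideanSpace.single j 1)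
          + fderiv ℝ c v (EuclideanSpace.single j 1) := by
      funext v
      rw [fderiv_fun_add (hb.differentiable v) (hc.differentiable v)]
      rfl
    rw [this]
    exact ih (hb.2 j) (hc.2 j)

/-- Leibniz rule: whichever factor is differentiated, its degree goes up by one and so does the
degree of the product. -/
theorem Growth.mul (hb : Growth lam p m b) (hc : Growth lam p n c) :
    Growth lam p (m + n) (fun v => b v * c v) := by
  have key : ∀ {m n : ℕ} {b c : Vel d → ℝ},
      (ContDiff ℝ ∞ b ∧ ∃ C, ∀ v, |b v| ≤ C * weight lam v ^ m) →
      (ContDiff ℝ ∞ c ∧ ∃ C, ∀ v, |c v| ≤ C * weight lam v ^ n) →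
      (ContDiff ℝ ∞ (fun v => b v * c v) ∧
        ∃ C, ∀ v, |b v * c v| ≤ C * weight lam v ^ (m + n)) := by
    rintro m n b c ⟨h1, B, hB⟩ ⟨h2, C, hC⟩
    refine ⟨h1.mul h2, B * C, fun v => ?_⟩
    rw [abs_mul, pow_add]
    calc |b v| * |c v| ≤ (B * weight lam v ^ m) * (C * weight lam v ^ n) :=
          mul_le_mul (hB v) (hC v) (abs_nonneg _) ((abs_nonneg _).trans (hB v))
      _ = _ := by ring
  induction p generalizing m n b c with
  | zero => exact key hb hc
  | succ p ih =>
    refine ⟨key hb.1 hc.1, fun j => ?_⟩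
    have : (fun v => fderiv ℝ (fun v => b v * c v) v (EuclideanSpace.single j 1))
        = fun v => b v * fderiv ℝ c v (EuclideanSpace.single j 1)
          + fderiv ℝ b v (EuclideanSpace.single j 1) * c v := by
      funext v
      rw [fderiv_fun_mul (hb.differentiable v) (hc.differentiable v)]
      simp [mul_comm]
    rw [this]
    have h1 := ih hb.pred (hc.2 j)
    refine Growth.add h1 ?_
    have := ih (hb.2 j) hc.pred
    rwa [add_right_comm] at this

theorem growth_const (hlam : 0 ≤ lam) (r : ℝ) : Growth lam p n (fun _ : Vel d => r) := by
  have key : ∀ (n : ℕ) (r : ℝ), (ContDiff ℝ ∞ (fun _ : Vel d => r) ∧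
      ∃ C, ∀ v : Vel d, |r| ≤ C * weight lam v ^ n) := fun n r =>
    ⟨contDiff_const, |r|, fun v => le_mul_of_one_le_right (abs_nonneg _)
      (one_le_pow₀ (one_le_weight hlam v))⟩
  induction p generalizing n r with
  | zero => exact key n r
  | succ p ih => exact ⟨key n r, fun j => by simpa using ih 0⟩

theorem Growth.neg (hlam : 0 ≤ lam) (hc : Growth lam p n c) :
    Growth lam p n (fun v => -c v) := by
  have := (growth_const (p := p) (n := 0) (d := d) hlam (-1)).mul hc
  simpa using this

theorem Growth.sum (hlam : 0 ≤ lam) {ι : Type*} (s : Finset ι) {c : ι → Vel d → ℝ}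
    (hc : ∀ i ∈ s, Growth lam p n (c i)) : Growth lam p n (fun v => ∑ i ∈ s, c i v) := by
  classical
  induction s using Finset.induction_on with
  | empty => simpa using growth_const hlam 0
  | insert i s hi ih =>
    simp only [Finset.sum_insert hi]
    exact (hc i (by simp)).add (ih fun j hj => hc j (by simp [hj]))

/-- Smooth functions all of whose derivatives are bounded. -/
def BoundedDerivs {E : Type*} [NormedAddCommGroup E] [NormedSpace ℝ E] (f : Vel d → E) : Prop :=
  ContDiff ℝ ∞ f ∧ ∀ n : ℕ, ∃ C, ∀ v, ‖iteratedFDeriv ℝ n f v‖ ≤ C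

theorem BoundedDerivs.clm_comp {E F : Type*} [NormedAddCommGroup E] [NormedSpace ℝ E]
    [NormedAddCommGroup F] [NormedSpace ℝ F] {f : Vel d → E} (hf : BoundedDerivs f)
    (L : E →L[ℝ] F) : BoundedDerivs (fun v => L (f v)) := by
  refine ⟨L.contDiff.comp hf.1, fun n => ?_⟩
  obtain ⟨C, hC⟩ := hf.2 n
  refine ⟨‖L‖ * C, fun v => ?_⟩
  exact (L.norm_iteratedFDeriv_comp_left (hf.1.contDiffAt) (by exact_mod_cast le_top)).trans
    (mul_le_mul_of_nonneg_left (hC v) (norm_nonneg _))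

theorem BoundedDerivs.fderiv {E : Type*} [NormedAddCommGroup E] [NormedSpace ℝ E] {f : Vel d → E}
    (hf : BoundedDerivs f) : BoundedDerivs (fderiv ℝ f) := by
  refine ⟨hf.1.fderiv_right (by simp), fun n => ?_⟩
  obtain ⟨C, hC⟩ := hf.2 (n + 1)
  exact ⟨C, fun v => by rw [norm_iteratedFDeriv_fderiv]; exact hC v⟩

theorem BoundedDerivs.growth (hlam : 0 ≤ lam) (hc : BoundedDerivs c) : Growth lam p n c := by
  have key : ∀ (n : ℕ) (c : Vel d → ℝ), BoundedDerivs c → (ContDiff ℝ ∞ c ∧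
      ∃ C, ∀ v : Vel d, |c v| ≤ C * weight lam v ^ n) := by
    rintro n c ⟨h1, h2⟩
    obtain ⟨C, hC⟩ := h2 0
    simp only [norm_iteratedFDeriv_zero, Real.norm_eq_abs] at hC
    exact ⟨h1, C, fun v => (hC v).trans (le_mul_of_one_le_right ((abs_nonneg _).trans (hC v))
      (one_le_pow₀ (one_le_weight hlam v)))⟩
  induction p generalizing n c with
  | zero => exact key n c hc
  | succ p ih =>
    exact ⟨key n c hc, fun j =>
      ih (hc.fderiv.clm_comp (ContinuousLinearMap.apply ℝ ℝ (EuclideanSpace.single j 1)))⟩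

end Growth

/-! ### The inverse of the differential of an advection field -/

section Inverse

variable {d : ℕ} {a : Vel d → Vel d} {lam : ℝ}

/-- Chain rule for `a⁻¹ ∘ a = id`. The range of `a` is not yet known to be open, but derivatives
within it suffice, since the composition is differentiated on the whole space. -/
theorem IsAdvectionField.inverse_comp (ha : IsAdvectionField a lam) (v : Vel d) :
    (fderivWithin ℝ (Function.invFun a) (Set.range a) (a v)).comp (fderiv ℝ a v)
      = ContinuousLinearMap.id ℝ (Vel d) := by
  have h1 : HasFDerivWithinAt (Function.invFun a)
      (fderivWithin ℝ (Function.invFun a) (Set.range a) (a v)) (Set.range a) (a v) :=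
    (ha.inv_smooth.differentiableOn (by simp) (a v) ⟨v, rfl⟩).hasFDerivWithinAt
  have h2 : HasFDerivAt a (fderiv ℝ a v) v :=
    (ha.smooth.differentiable (by simp) v).hasFDerivAt
  have h3 := h1.comp_hasFDerivAt v h2 (Filter.Eventually.of_forall fun u => ⟨u, rfl⟩)
  have h4 : Function.invFun a ∘ a = id := Function.invFun_comp ha.injective
  rw [h4] at h3
  exact h3.unique (hasFDerivAt_id v)

/-- The differential of `a` as a unit of the ring of endomorphisms. -/
def diffUnit (ha : IsAdvectionField a lam) (v : Vel d) : (Vel d →L[ℝ] Vel d)ˣ where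
  val := fderiv ℝ a v
  inv := fderivWithin ℝ (Function.invFun a) (Set.range a) (a v)
  val_inv := by
    have h := ha.inverse_comp v
    have h' : LinearMap.comp
        (fderivWithin ℝ (Function.invFun a) (Set.range a) (a v) : Vel d →ₗ[ℝ] Vel d)
        (fderiv ℝ a v : Vel d →ₗ[ℝ] Vel d) = LinearMap.id :=
      LinearMap.ext fun u => DFunLike.congr_fun h u
    -- In finite dimension a left inverse is also a right inverse.
    have h2 := (LinearMap.comp_eq_id_comm _ _).1 h'
    ext1 u
    exact LinearMap.congr_fun h2 u
  inv_val := ha.inverse_comp v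

/-- Inverse function theorem, `Da` being invertible everywhere. Openness gives unique
differentiability on the range, so that the hypothesis on first-order derivatives of `a⁻¹` can be
read as a bound on `(Da)⁻¹`. -/
theorem IsAdvectionField.isOpen_range (ha : IsAdvectionField a lam) : IsOpen (Set.range a) := by
  refine IsOpenMap.isOpen_range ?_
  refine isOpenMap_of_hasStrictFDerivAt_equiv
    (f' := fun v => ContinuousLinearEquiv.unitsEquiv ℝ (Vel d) (diffUnit ha v)) fun v => ?_
  exact (ha.smooth.contDiffAt.hasStrictFDerivAt (by simp))

/-- The inverse of the differential of `a`. -/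
def invDiff (a : Vel d → Vel d) (v : Vel d) : Vel d →L[ℝ] Vel d := Ring.inverse (fderiv ℝ a v)

theorem IsAdvectionField.invDiff_eq (ha : IsAdvectionField a lam) (v : Vel d) :
    invDiff a v = fderivWithin ℝ (Function.invFun a) (Set.range a) (a v) :=
  Ring.inverse_unit (diffUnit ha v)

theorem IsAdvectionField.fderiv_invDiff_apply (ha : IsAdvectionField a lam) (v u : Vel d) :
    fderiv ℝ a v (invDiff a v u) = u := by
  rw [ha.invDiff_eq]
  exact DFunLike.congr_fun (diffUnit ha v).val_inv u

/-- This is `(1 + |v|)² ≤ 2 (1 + |v|²)` raised to the power `(1 + lam) / 2`. -/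
theorem one_add_le_weight (hlam : 0 ≤ lam) (v : Vel d) :
    (1 + ‖v‖) ^ (1 + lam) ≤ 2 ^ ((1 + lam) / 2) * weight lam v := by
  rw [weight, ← Real.mul_rpow (by norm_num) (by positivity)]
  have h1 : (1 + ‖v‖) ^ (1 + lam) = ((1 + ‖v‖) ^ 2) ^ ((1 + lam) / 2) := by
    rw [← Real.rpow_natCast, ← Real.rpow_mul (by positivity)]
    congr 1
    push_cast
    ring
  rw [h1]
  exact Real.rpow_le_rpow (by positivity) (by nlinarith [sq_nonneg (1 - ‖v‖)]) (by linarith)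

/-- The growth hypothesis of order one on `a⁻¹`, taken at the point `w = a(v)`, where `a⁻¹(w) = v`.
-/
theorem IsAdvectionField.norm_invDiff_le (ha : IsAdvectionField a lam) (hlam : 0 ≤ lam) :
    ∃ C, ∀ v, ‖invDiff a v‖ ≤ C * weight lam v := by
  obtain ⟨C, hC⟩ := ha.inv_growth 1
  refine ⟨|C| * 2 ^ ((1 + lam) / 2), fun v => ?_⟩
  have h := hC (a v) ⟨v, rfl⟩
  rw [norm_iteratedFDerivWithin_one _ (ha.isOpen_range.uniqueDiffWithinAt ⟨v, rfl⟩),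
    ← ha.invDiff_eq, Function.leftInverse_invFun ha.injective v] at h
  simp only [Nat.cast_one, mul_one] at h
  calc ‖invDiff a v‖ ≤ C * (1 + ‖v‖) ^ (1 + lam) := h
    _ ≤ |C| * (1 + ‖v‖) ^ (1 + lam) :=
      mul_le_mul_of_nonneg_right (le_abs_self C) (by positivity)
    _ ≤ |C| * (2 ^ ((1 + lam) / 2) * weight lam v) :=
      mul_le_mul_of_nonneg_left (one_add_le_weight hlam v) (abs_nonneg C)
    _ = _ := by ring

/-- Inversion in a Banach algebra is smooth at units, and `Da` is smooth. This is why the inverse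
differential is written with `Ring.inverse`. -/
theorem IsAdvectionField.contDiff_invDiff (ha : IsAdvectionField a lam) :
    ContDiff ℝ ∞ (invDiff a) := by
  rw [contDiff_iff_contDiffAt]
  intro v
  have h1 : ContDiffAt ℝ ∞ (fderiv ℝ a) v :=
    (ha.smooth.fderiv_right (m := ∞) (by simp)).contDiffAt
  exact ContDiffAt.comp (g := Ring.inverse) (f := fderiv ℝ a) v
    (contDiffAt_ringInverse ℝ (diffUnit ha v)) h1

/-- The matrix entries of the inverse of the differential of `a`. -/
def invEntry (a : Vel d → Vel d) (j m : Fin d) (v : Vel d) : ℝ :=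
  invDiff a v (EuclideanSpace.single m 1) j

theorem IsAdvectionField.invDiff_fderiv_apply (ha : IsAdvectionField a lam) (v u : Vel d) :
    invDiff a v (fderiv ℝ a v u) = u := by
  rw [ha.invDiff_eq]
  exact DFunLike.congr_fun (ha.inverse_comp v) u

/-- Differentiate `Da(v) ((Da(v))⁻¹ e) = e` and solve for the derivative of the second factor. -/
theorem IsAdvectionField.hasFDerivAt_invDiff_apply (ha : IsAdvectionField a lam) (v e : Vel d) :
    HasFDerivAt (fun v => invDiff a v e)
      (-(invDiff a v).comp ((fderiv ℝ (fderiv ℝ a) v).flip (invDiff a v e))) v := by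
  have h1 : HasFDerivAt (fderiv ℝ a) (fderiv ℝ (fderiv ℝ a) v) v :=
    ((ha.smooth.fderiv_right (m := ∞) (by simp)).differentiable (by simp) v).hasFDerivAt
  have h2 : HasFDerivAt (fun v => invDiff a v e) (fderiv ℝ (fun v => invDiff a v e) v) v :=
    ((ha.contDiff_invDiff.clm_apply contDiff_const).differentiable (by simp) v).hasFDerivAt
  have h3 := h1.clm_apply h2
  simp only [ha.fderiv_invDiff_apply] at h3
  have h4 := h3.unique (hasFDerivAt_const e v)
  convert! h2 using 1
  ext1 u
  have h5 := DFunLike.congr_fun h4 u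
  simp only [add_apply, ContinuousLinearMap.comp_apply,
    zero_apply] at h5
  have h6 := congrArg (invDiff a v) h5
  rw [map_add, ha.invDiff_fderiv_apply, map_zero] at h6
  exact (eq_neg_of_add_eq_zero_left h6).symm

/-- Coordinates of `∂(Da)⁻¹ = -(Da)⁻¹ (∂Da) (Da)⁻¹`: each term has two entries of the inverse and
one bounded factor. -/
theorem fderiv_invEntry (ha : IsAdvectionField a lam) (i j m : Fin d) (v : Vel d) :
    fderiv ℝ (invEntry a j m) v (EuclideanSpace.single i 1)
      = -∑ q, ∑ p, invEntry a q m v * fderiv ℝ (fderiv ℝ a) v (EuclideanSpace.single i 1)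
          (EuclideanSpace.single q 1) p * invEntry a j p v := by
  have h1 : HasFDerivAt (invEntry a j m) _ v :=
    (EuclideanSpace.proj j : Vel d →L[ℝ] ℝ).hasFDerivAt.comp v
      (ha.hasFDerivAt_invDiff_apply v (EuclideanSpace.single m 1))
  rw [h1.fderiv]
  have expand : ∀ u : Vel d, u = ∑ q, u q • EuclideanSpace.single q (1 : ℝ) := by
    intro u
    ext p
    simp [Finset.sum_apply, Pi.single_apply]
  set D := fderiv ℝ (fderiv ℝ a) v (EuclideanSpace.single i 1)
  have h2 : (invDiff a v (D (invDiff a v (EuclideanSpace.single m 1)))) j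
      = ∑ q, ∑ p, invEntry a q m v * D (EuclideanSpace.single q 1) p * invEntry a j p v := by
    rw [expand (invDiff a v (EuclideanSpace.single m 1))]
    simp only [map_sum, map_smul, WithLp.ofLp_sum, Finset.sum_apply, WithLp.ofLp_smul,
      Pi.smul_apply, smul_eq_mul]
    refine Finset.sum_congr rfl fun q _ => ?_
    simp only [mul_assoc, ← Finset.mul_sum]
    congr 1
    conv_lhs => rw [expand (D (EuclideanSpace.single q 1))]
    simp only [map_sum, map_smul, WithLp.ofLp_sum, Finset.sum_apply, WithLp.ofLp_smul,
      Pi.smul_apply, smul_eq_mul]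
    rfl
  rw [← h2]
  simp [D]

theorem IsAdvectionField.boundedDerivs_fderiv (ha : IsAdvectionField a lam) :
    BoundedDerivs (fderiv ℝ a) := by
  refine ⟨ha.smooth.fderiv_right (by simp), fun n => ?_⟩
  obtain ⟨C, hC⟩ := ha.deriv_bounded (n + 1) (by simp)
  exact ⟨C, fun v => by rw [norm_iteratedFDeriv_fderiv]; exact hC v⟩

/-- Induction on the number of derivatives. By `fderiv_invEntry` a derivative of an entry has degree
`1 + 0 + 1 = 2`, one more than the entry, which is exactly what `Growth` allows. The size of an
entry comes from the first-order bound on `a⁻¹`, its derivatives from the bounded derivatives of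
`Da`. -/
theorem IsAdvectionField.growth_invEntry (ha : IsAdvectionField a lam) (hlam : 0 ≤ lam)
    (p : ℕ) (j m : Fin d) : Growth lam p 1 (invEntry a j m) := by
  have base : ∀ j m, ContDiff ℝ ∞ (invEntry a j m) ∧
      ∃ C, ∀ v, |invEntry a j m v| ≤ C * weight lam v ^ 1 := by
    intro j m
    refine ⟨(EuclideanSpace.proj j : Vel d →L[ℝ] ℝ).contDiff.comp
      (ha.contDiff_invDiff.clm_apply contDiff_const), ?_⟩
    obtain ⟨C, hC⟩ := ha.norm_invDiff_le hlam
    refine ⟨C, fun v => ?_⟩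
    rw [pow_one]
    refine le_trans ?_ (hC v)
    have h1 := (invDiff a v).le_opNorm (EuclideanSpace.single m 1)
    have h2 := PiLp.norm_apply_le (invDiff a v (EuclideanSpace.single m 1)) j
    simp only [PiLp.norm_single, norm_one, mul_one] at h1
    exact h2.trans h1
  induction p generalizing j m with
  | zero => exact base j m
  | succ p ih =>
    refine ⟨base j m, fun i => ?_⟩
    simp only [fderiv_invEntry ha]
    refine Growth.neg hlam (Growth.sum hlam _ fun q _ => Growth.sum hlam _ fun r _ => ?_)
    have h1 : Growth lam p 0 (fun v => fderiv ℝ (fderiv ℝ a) v (EuclideanSpace.single i 1)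
        (EuclideanSpace.single q 1) r) :=
      BoundedDerivs.growth hlam (ha.boundedDerivs_fderiv.fderiv.clm_comp
        ((EuclideanSpace.proj r : Vel d →L[ℝ] ℝ).comp
          ((ContinuousLinearMap.apply ℝ (Vel d) (EuclideanSpace.single q 1)).comp
            (ContinuousLinearMap.apply ℝ _ (EuclideanSpace.single i 1)))))
    exact ((ih q m).mul h1).mul (ih j r)

end Inverse

/-! ### Weighted integrability -/

section Weighted

variable {d : ℕ}

/-- The squared weighted `L²` norm `∫∫ (1 + |v|²)^r |F|² dv dx`. -/
def weightedSq (r : ℝ) (F : Torus d → Vel d → ℝ) : ℝ≥0∞ :=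
  ∫⁻ x : Torus d, ∫⁻ v : Vel d, ENNReal.ofReal ((1 + ‖v‖ ^ 2) ^ r * |F x v| ^ 2)

/-- `∫ (1 + |v|²)^(-σ) dv`. -/
def tailMass (d : ℕ) (σ : ℝ) : ℝ≥0∞ := ∫⁻ v : Vel d, ENNReal.ofReal ((1 + ‖v‖ ^ 2) ^ (-σ))

theorem tailMass_lt_top {σ : ℝ} (hσ : (d : ℝ) / 2 < σ) : tailMass d σ < ⊤ := by
  have h : Integrable (fun v : Vel d => (1 + ‖v‖ ^ 2) ^ (-(2 * σ) / 2)) :=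
    integrable_rpow_neg_one_add_norm_sq (by simp; linarith)
  have h2 := h.lintegral_lt_top
  rwa [show -(2 * σ) / 2 = -σ by ring] at h2

theorem measurable_bracket_rpow (r : ℝ) :
    Measurable (fun v : Vel d => ENNReal.ofReal ((1 + ‖v‖ ^ 2) ^ r)) := by
  fun_prop

theorem bracket_rpow_pos (r : ℝ) (v : Vel d) : 0 < (1 + ‖v‖ ^ 2) ^ r :=
  Real.rpow_pos_of_pos (by positivity) _

theorem weightedSq_eq {r : ℝ} {F : Torus d → Vel d → ℝ}
    (hF : Measurable fun p : Torus d × Vel d => F p.1 p.2) :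
    weightedSq r F
      = ∫⁻ p : Torus d × Vel d, ENNReal.ofReal ((1 + ‖p.2‖ ^ 2) ^ r) * ‖F p.1 p.2‖ₑ ^ 2 := by
  have h : ∀ p : Torus d × Vel d, ENNReal.ofReal ((1 + ‖p.2‖ ^ 2) ^ r) * ‖F p.1 p.2‖ₑ ^ 2
      = ENNReal.ofReal ((1 + ‖p.2‖ ^ 2) ^ r * |F p.1 p.2| ^ 2) := by
    intro p
    rw [ENNReal.ofReal_mul (bracket_rpow_pos r p.2).le, ENNReal.ofReal_pow (abs_nonneg _),
      ← Real.norm_eq_abs, ofReal_norm]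
  simp only [h]
  rw [Measure.volume_eq_prod, lintegral_prod _ (by fun_prop)]
  rfl

/-- The Cauchy–Schwarz inequality with weights. -/
theorem lintegral_mul_le_weighted {α : Type*} [MeasurableSpace α] {μ : Measure α} (r : ℝ)
    (V : α → Vel d) (hV : Measurable V) {f g : α → ℝ≥0∞} (hf : AEMeasurable f μ)
    (hg : AEMeasurable g μ) :
    ∫⁻ p, f p * g p ∂μ
      ≤ (∫⁻ p, ENNReal.ofReal ((1 + ‖V p‖ ^ 2) ^ (-r)) * f p ^ 2 ∂μ) ^ (1 / 2 : ℝ)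
        * (∫⁻ p, ENNReal.ofReal ((1 + ‖V p‖ ^ 2) ^ r) * g p ^ 2 ∂μ) ^ (1 / 2 : ℝ) := by
  have hm : ∀ s : ℝ, AEMeasurable (fun p => ENNReal.ofReal ((1 + ‖V p‖ ^ 2) ^ s)) μ :=
    fun s => ((measurable_bracket_rpow s).comp hV).aemeasurable
  -- Hölder with exponents two and two, after the weight has been split as `(1 + |V|²)^{-r/2} (1 +
  -- |V|²)^{r/2} = 1`.
  have h := ENNReal.lintegral_mul_le_Lp_mul_Lq μ Real.HolderConjugate.two_two
    (f := fun p => ENNReal.ofReal ((1 + ‖V p‖ ^ 2) ^ (-r / 2)) * f p)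
    (g := fun p => ENNReal.ofReal ((1 + ‖V p‖ ^ 2) ^ (r / 2)) * g p)
    ((hm _).mul hf) ((hm _).mul hg)
  have hsq : ∀ (s : ℝ) (x : ℝ≥0∞) (v : Vel d),
      (ENNReal.ofReal ((1 + ‖v‖ ^ 2) ^ (s / 2)) * x) ^ (2 : ℝ)
        = ENNReal.ofReal ((1 + ‖v‖ ^ 2) ^ s) * x ^ 2 := by
    intro s x v
    rw [ENNReal.mul_rpow_of_nonneg _ _ (by norm_num), ENNReal.rpow_two, ENNReal.rpow_two,
      ← ENNReal.ofReal_pow (bracket_rpow_pos _ v).le, ← Real.rpow_natCast,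
      ← Real.rpow_mul (by positivity)]
    norm_num
  simp only [hsq] at h
  refine le_trans (le_of_eq ?_) h
  refine lintegral_congr fun p => ?_
  have h1 : ENNReal.ofReal ((1 + ‖V p‖ ^ 2) ^ (-r / 2))
      * ENNReal.ofReal ((1 + ‖V p‖ ^ 2) ^ (r / 2)) = 1 := by
    rw [← ENNReal.ofReal_mul (bracket_rpow_pos _ _).le, ← Real.rpow_add (by positivity)]
    simp [neg_div]
  simp only [Pi.mul_apply]
  rw [mul_mul_mul_comm, h1, one_mul]

/-- `F` is of class `C^k` and its derivatives of order at most `k` have weighted norm at most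
`N`. -/
structure WeightedBound (r : ℝ) (k : ℕ) (N : ℝ≥0∞) (F : Torus d → Vel d → ℝ) : Prop where
  phaseDiff : PhaseDiff k F
  bound : ∀ α β : List (Fin d), α.length + β.length ≤ k →
    weightedSq r (α.foldr dx (β.foldr dv F)) ≤ N ^ 2

variable {r σ lam : ℝ} {k p n : ℕ} {N : ℝ≥0∞} {F : Torus d → Vel d → ℝ} {c : Vel d → ℝ}

theorem WeightedBound.mono {m : ℕ} (hF : WeightedBound r k N F) (h : m ≤ k) :
    WeightedBound r m N F :=
  ⟨hF.phaseDiff.mono h, fun α β hab => hF.bound α β (hab.trans h)⟩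

theorem WeightedBound.dv (hF : WeightedBound r (k + 1) N F) (j : Fin d) :
    WeightedBound r k N (dv j F) := by
  refine ⟨hF.phaseDiff.dv j, fun α β hab => ?_⟩
  -- The new velocity derivative acts first, hence stands last in the list.
  have := hF.bound α (β ++ [j]) (by simp; omega)
  simpa using this

/-- Order zero is all that is needed once the position derivatives have been taken. A higher order
would require commuting `∂_x` with `∂_v`. -/
theorem WeightedBound.foldr_dx (hF : WeightedBound r k N F) (α : List (Fin d))
    (h : α.length ≤ k) : WeightedBound r 0 N (α.foldr VlasovAveraging.dx F) := by
  refine ⟨PhaseDiff.foldr_dx α (by simpa using hF.phaseDiff.mono h), fun α' β hab => ?_⟩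
  have h1 : α' = [] := List.eq_nil_of_length_eq_zero (by omega)
  have h2 : β = [] := List.eq_nil_of_length_eq_zero (by omega)
  subst h1 h2
  exact hF.bound α [] (by simpa using h)

/-- How the weight is spent: a coefficient of degree `n` uses up `n (1 + lam)` of the exponent `r`,
and at least `σ` remains to make the velocity integral converge. -/
theorem weight_pow_sq_mul_le (hn : (n : ℝ) * (1 + lam) ≤ r - σ) (v : Vel d) :
    (1 + ‖v‖ ^ 2) ^ (-r) * (weight lam v ^ n) ^ 2 ≤ (1 + ‖v‖ ^ 2) ^ (-σ) := by
  have h1 : (weight lam v ^ n) ^ 2 = (1 + ‖v‖ ^ 2) ^ ((n : ℝ) * (1 + lam)) := by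
    rw [weight, ← Real.rpow_natCast, ← Real.rpow_natCast, ← Real.rpow_mul (by positivity),
      ← Real.rpow_mul (by positivity)]
    congr 1
    push_cast
    ring
  rw [h1, ← Real.rpow_add (by positivity)]
  exact Real.rpow_le_rpow_of_exponent_le (by nlinarith [sq_nonneg ‖v‖]) (by linarith)

/-- Products of a coefficient of controlled growth with a function of finite weighted norm. -/
theorem lintegral_coef_mul_le (hn : (n : ℝ) * (1 + lam) ≤ r - σ)
    {C : ℝ} (hcm : Measurable c) (hc : ∀ v, |c v| ≤ C * weight lam v ^ n)
    (hF : WeightedBound r k N F) :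
    ∫⁻ q : Torus d × Vel d, ‖c q.2 * F q.1 q.2‖ₑ
      ≤ ENNReal.ofReal C * tailMass d σ ^ (1 / 2 : ℝ) * N := by
  have hm := hF.phaseDiff.continuous.measurable
  have hC0 : 0 ≤ C := by
    have h0 := (abs_nonneg _).trans (hc 0)
    have hw := pow_pos (weight_pos lam (0 : Vel d)) n
    by_contra hneg
    push Not at hneg
    nlinarith
  have h1 := lintegral_mul_le_weighted (μ := (volume : Measure (Torus d × Vel d))) r
    (fun q => q.2) measurable_snd
    (f := fun q => ‖c q.2‖ₑ) (g := fun q => ‖F q.1 q.2‖ₑ) (by fun_prop) (by fun_prop)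
  rw [← weightedSq_eq hm] at h1
  simp only [enorm_mul]
  refine h1.trans (mul_le_mul' ?_ ?_)
  · have h2 : ∀ q : Torus d × Vel d,
        ENNReal.ofReal ((1 + ‖q.2‖ ^ 2) ^ (-r)) * ‖c q.2‖ₑ ^ 2
          ≤ ENNReal.ofReal (C ^ 2) * ENNReal.ofReal ((1 + ‖q.2‖ ^ 2) ^ (-σ)) := by
      intro q
      rw [← ofReal_norm, ← ENNReal.ofReal_pow (norm_nonneg _),
        ← ENNReal.ofReal_mul (bracket_rpow_pos _ _).le, ← ENNReal.ofReal_mul (sq_nonneg C)]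
      refine ENNReal.ofReal_le_ofReal ?_
      have h3 : ‖c q.2‖ ^ 2 ≤ (C * weight lam q.2 ^ n) ^ 2 :=
        pow_le_pow_left₀ (norm_nonneg _) (hc q.2) 2
      calc _ ≤ (1 + ‖q.2‖ ^ 2) ^ (-r) * (C * weight lam q.2 ^ n) ^ 2 :=
            mul_le_mul_of_nonneg_left h3 (bracket_rpow_pos _ _).le
        _ = C ^ 2 * ((1 + ‖q.2‖ ^ 2) ^ (-r) * (weight lam q.2 ^ n) ^ 2) := by ring
        _ ≤ _ := mul_le_mul_of_nonneg_left (weight_pow_sq_mul_le hn q.2) (sq_nonneg C)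
    calc _ ≤ (∫⁻ q : Torus d × Vel d,
          ENNReal.ofReal (C ^ 2) * ENNReal.ofReal ((1 + ‖q.2‖ ^ 2) ^ (-σ))) ^ (1 / 2 : ℝ) :=
          ENNReal.rpow_le_rpow (lintegral_mono h2) (by norm_num)
      _ = (ENNReal.ofReal (C ^ 2) * tailMass d σ) ^ (1 / 2 : ℝ) := by
          congr 1
          have hm2 : Measurable fun q : Torus d × Vel d =>
              ENNReal.ofReal ((1 + ‖q.2‖ ^ 2) ^ (-σ)) :=
            (measurable_bracket_rpow _).comp measurable_snd
          rw [lintegral_const_mul _ hm2, Measure.volume_eq_prod, lintegral_prod _ hm2.aemeasurable]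
          simp [tailMass]
      _ = _ := by
          rw [ENNReal.mul_rpow_of_nonneg _ _ (by norm_num),
            ENNReal.ofReal_rpow_of_nonneg (sq_nonneg C) (by norm_num), ← Real.sqrt_eq_rpow,
            Real.sqrt_sq hC0]
  · calc _ ≤ (N ^ 2) ^ (1 / 2 : ℝ) :=
          ENNReal.rpow_le_rpow (hF.bound [] [] (by simp)) (by norm_num)
      _ = N := by
          rw [← ENNReal.rpow_natCast, ← ENNReal.rpow_mul]
          norm_num

theorem Growth.integrable_mul (hσ : (d : ℝ) / 2 < σ)
    (hn : (n : ℝ) * (1 + lam) ≤ r - σ) (hc : Growth lam p n c) (hN : N ≠ ⊤)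
    (hF : WeightedBound r k N F) :
    Integrable (fun q : Torus d × Vel d => c q.2 * F q.1 q.2) := by
  obtain ⟨h1, C, hC⟩ := hc.base
  refine ⟨?_, ?_⟩
  · exact ((h1.continuous.comp continuous_snd).mul hF.phaseDiff.continuous).aestronglyMeasurable
  · refine (lintegral_coef_mul_le hn h1.continuous.measurable hC hF).trans_lt ?_
    exact ENNReal.mul_lt_top (ENNReal.mul_lt_top ENNReal.ofReal_lt_top
      (ENNReal.rpow_lt_top_of_nonneg (by norm_num) (tailMass_lt_top hσ).ne)) hN.lt_top

end Weighted

/-! ### Decay of the Fourier transform along the advection field -/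

section Decay

variable {d : ℕ} {a : Vel d → Vel d} {lam σ r : ℝ}

/-- The oscillating factor `exp (2πi ξ · a(v))`. -/
def phase (a : Vel d → Vel d) (ξ : Fin d → ℝ) (v : Vel d) : ℂ :=
  Complex.exp (2 * Real.pi * Complex.I * ((∑ j, ξ j * a v j : ℝ) : ℂ))

theorem norm_phase (a : Vel d → Vel d) (ξ : Fin d → ℝ) (v : Vel d) : ‖phase a ξ v‖ = 1 := by
  have := Complex.norm_exp_ofReal_mul_I ((∑ j, ξ j * a v j) * (2 * Real.pi))
  rw [← this, phase]
  congr 2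
  push_cast
  ring

theorem continuous_phase_fun (ha : Continuous a) (ξ : Fin d → ℝ) : Continuous (phase a ξ) := by
  unfold phase
  fun_prop

theorem hasFDerivAt_phase (ha : IsAdvectionField a lam) (ξ : Fin d → ℝ) (v : Vel d) :
    ∃ L : Vel d →L[ℝ] ℂ, HasFDerivAt (phase a ξ) L v ∧
      ∀ u, L u = 2 * Real.pi * Complex.I * ((∑ p, ξ p * fderiv ℝ a v u p : ℝ) : ℂ)
        * phase a ξ v := by
  have h0 : HasFDerivAt a (fderiv ℝ a v) v :=
    (ha.smooth.differentiable (by simp) v).hasFDerivAt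
  have h1 : HasFDerivAt (fun v => ∑ j, ξ j * a v j)
      (∑ j, ξ j • (EuclideanSpace.proj j : Vel d →L[ℝ] ℝ).comp (fderiv ℝ a v)) v :=
    HasFDerivAt.fun_sum fun j _ =>
      ((EuclideanSpace.proj j : Vel d →L[ℝ] ℝ).hasFDerivAt.comp v h0).const_mul (ξ j)
  have h2 : HasFDerivAt (fun v => ((∑ j, ξ j * a v j : ℝ) : ℂ)) _ v :=
    Complex.ofRealCLM.hasFDerivAt.comp v h1
  have h3 := (h2.const_mul (2 * Real.pi * Complex.I)).cexp
  refine ⟨_, h3, fun u => ?_⟩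
  simp [phase]
  ring

theorem fderiv_phase_apply (ha : IsAdvectionField a lam) (ξ : Fin d → ℝ) (v u : Vel d) :
    fderiv ℝ (phase a ξ) v u
      = 2 * Real.pi * Complex.I * ((∑ p, ξ p * fderiv ℝ a v u p : ℝ) : ℂ) * phase a ξ v := by
  obtain ⟨L, h1, h2⟩ := hasFDerivAt_phase ha ξ v
  rw [h1.fderiv, h2]

theorem differentiable_phase (ha : IsAdvectionField a lam) (ξ : Fin d → ℝ) :
    Differentiable ℝ (phase a ξ) := fun v => by
  obtain ⟨L, h1, -⟩ := hasFDerivAt_phase ha ξ v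
  exact h1.differentiableAt

/-- The vector field `(Da)⁻¹ e_m` is mapped by `Da` to the constant `e_m`, so along it `ξ · a(v)`
has the constant derivative `ξ_m`. This identity drives all integrations by parts in velocity. -/
theorem sum_invEntry_mul_fderiv_phase (ha : IsAdvectionField a lam) (ξ : Fin d → ℝ) (m : Fin d)
    (v : Vel d) :
    ∑ j, (invEntry a j m v : ℂ) * fderiv ℝ (phase a ξ) v (EuclideanSpace.single j 1)
      = 2 * Real.pi * Complex.I * ξ m * phase a ξ v := by
  have expand : invDiff a v (EuclideanSpace.single m 1)
      = ∑ j, invEntry a j m v • EuclideanSpace.single j (1 : ℝ) := by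
    ext p
    simp [Finset.sum_apply, Pi.single_apply, invEntry]
  have h1 := fderiv_phase_apply ha ξ v (invDiff a v (EuclideanSpace.single m 1))
  rw [ha.fderiv_invDiff_apply] at h1
  rw [expand, map_sum] at h1
  simp only [map_smul, Complex.real_smul] at h1
  rw [h1]
  congr 3
  simp

theorem bounded_fderiv_phase (ha : IsAdvectionField a lam) (ξ : Fin d → ℝ) (u : Vel d) :
    ∃ C, ∀ v, ‖fderiv ℝ (phase a ξ) v u‖ ≤ C := by
  obtain ⟨C, hC⟩ := ha.boundedDerivs_fderiv.2 0
  simp only [norm_iteratedFDeriv_zero] at hC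
  refine ⟨2 * Real.pi * ∑ p, |ξ p| * (C * ‖u‖), fun v => ?_⟩
  rw [fderiv_phase_apply ha, norm_mul, norm_phase, mul_one, norm_mul, Complex.norm_real]
  have : ‖(2 * Real.pi * Complex.I : ℂ)‖ = 2 * Real.pi := by
    simp [abs_of_pos Real.pi_pos]
  rw [this]
  refine mul_le_mul_of_nonneg_left ?_ (by positivity)
  refine (norm_sum_le _ _).trans (Finset.sum_le_sum fun p _ => ?_)
  rw [norm_mul, Real.norm_eq_abs]
  refine mul_le_mul_of_nonneg_left ?_ (abs_nonneg _)
  exact (PiLp.norm_apply_le _ p).trans (((fderiv ℝ a v).le_opNorm u).trans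
    (mul_le_mul_of_nonneg_right (hC v) (norm_nonneg _)))

/-- `∫∫ e^{-2πi l · x} e^{2πi ξ · a(v)} c(v) F(x, v) dv dx`. -/
def osc (a : Vel d → Vel d) (c : Vel d → ℝ) (F : Torus d → Vel d → ℝ) (l : Fin d → ℤ)
    (ξ : Fin d → ℝ) : ℂ :=
  ∫ q : Torus d × Vel d, UnitAddTorus.mFourier (-l) q.1
    * (phase a ξ q.2 * ((c q.2 * F q.1 q.2 : ℝ) : ℂ))

variable {k p n : ℕ} {N : ℝ≥0∞} {F : Torus d → Vel d → ℝ} {c : Vel d → ℝ}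

theorem integrable_osc {f : Torus d × Vel d → ℝ} (ha : Continuous a) (hf : Integrable f)
    (l : Fin d → ℤ) (ξ : Fin d → ℝ) :
    Integrable (fun q : Torus d × Vel d => UnitAddTorus.mFourier (-l) q.1
      * (phase a ξ q.2 * ((f q : ℝ) : ℂ))) := by
  have h1 := continuous_phase_fun ha ξ
  have h2 : Continuous (UnitAddTorus.mFourier (-l)) := ContinuousMap.continuous _
  refine Integrable.bdd_mul (c := 1) (Integrable.bdd_mul (c := 1) hf.ofReal ?_ ?_) ?_ ?_
  · exact (h1.comp continuous_snd).aestronglyMeasurable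
  · exact Filter.Eventually.of_forall fun q => (norm_phase a ξ q.2).le
  · exact (h2.comp continuous_fst).aestronglyMeasurable
  · exact Filter.Eventually.of_forall fun q => (norm_mFourier_apply _ q.1).le

theorem enorm_osc_le (l : Fin d → ℤ) (ξ : Fin d → ℝ) :
    ‖osc a c F l ξ‖ₑ ≤ ∫⁻ q : Torus d × Vel d, ‖c q.2 * F q.1 q.2‖ₑ := by
  refine (enorm_integral_le_lintegral_enorm _).trans (le_of_eq (lintegral_congr fun q => ?_))
  rw [enorm_mul, enorm_mul, ← ofReal_norm (UnitAddTorus.mFourier (-l) q.1),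
    ← ofReal_norm (phase a ξ q.2), norm_mFourier_apply, norm_phase]
  simp [← ofReal_norm]

theorem integral_mFourier_mul_dx_iterate (l : Fin d → ℤ) (j : Fin d) (v : Vel d) (p : ℕ)
    (hF : PhaseDiff p F) :
    ∫ x, UnitAddTorus.mFourier (-l) x * ((List.replicate p j).foldr dx F x v : ℂ)
      = (2 * Real.pi * Complex.I * l j) ^ p
        * ∫ x, UnitAddTorus.mFourier (-l) x * (F x v : ℂ) := by
  induction p with
  | zero => simp
  | succ p ih =>
    have h1 : PhaseDiff 1 ((List.replicate p j).foldr dx F) :=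
      PhaseDiff.foldr_dx _ (hF.mono (by simp [add_comm]))
    have h2 := integral_mFourier_mul_torusDeriv (-l) j
      (f := fun y => (List.replicate p j).foldr dx F y v) (by exact_mod_cast h1.slice_left v)
    rw [List.replicate_succ, List.foldr_cons]
    change ∫ x, UnitAddTorus.mFourier (-l) x
      * (torusDeriv j (fun y => (List.replicate p j).foldr dx F y v) x : ℂ) = _
    rw [h2, ih (hF.mono (by omega))]
    simp only [Pi.neg_apply, Int.cast_neg]
    ring

/-- Integration by parts in position. -/
theorem osc_dx_iterate (ha : IsAdvectionField a lam) (hσ : (d : ℝ) / 2 < σ)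
    (hn : (n : ℝ) * (1 + lam) ≤ r - σ) {q : ℕ} (hc : Growth lam q n c) (hN : N ≠ ⊤)
    (hF : WeightedBound r p N F) (l : Fin d → ℤ) (ξ : Fin d → ℝ) (j : Fin d) :
    osc a c ((List.replicate p j).foldr dx F) l ξ
      = (2 * Real.pi * Complex.I * l j) ^ p * osc a c F l ξ := by
  have hF' := hF.foldr_dx (List.replicate p j) (by simp)
  have i1 := integrable_osc ha.smooth.continuous (hc.integrable_mul hσ hn hN hF) l ξ
  have i2 := integrable_osc ha.smooth.continuous (hc.integrable_mul hσ hn hN hF') l ξ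
  unfold osc
  rw [Measure.volume_eq_prod] at i1 i2 ⊢
  rw [integral_prod_symm _ i1, integral_prod_symm _ i2, ← integral_const_mul]
  refine integral_congr_ae (Filter.Eventually.of_forall fun v => ?_)
  have h := integral_mFourier_mul_dx_iterate l j v p hF.phaseDiff
  have e : ∀ G : Torus d → Vel d → ℝ, ∫ x, UnitAddTorus.mFourier (-l) x
      * (phase a ξ v * ((c v * G x v : ℝ) : ℂ))
      = phase a ξ v * c v * ∫ x, UnitAddTorus.mFourier (-l) x * (G x v : ℂ) := by
    intro G
    rw [← integral_const_mul]
    refine integral_congr_ae (Filter.Eventually.of_forall fun x => ?_)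
    push_cast
    ring
  simp only [e, h]
  ring

/-- One integration by parts in velocity, on a fibre. -/
theorem integral_phase_mul (ha : IsAdvectionField a lam) (ξ : Fin d → ℝ) (m : Fin d)
    {f : Vel d → ℝ} (hf : Differentiable ℝ f) (hc : Differentiable ℝ c)
    (hb : ∀ j, Differentiable ℝ (invEntry a j m))
    (h1 : ∀ j, Integrable (fun v => invEntry a j m v * c v * f v))
    (h2 : ∀ j, Integrable (fun v => invEntry a j m v * c v
      * fderiv ℝ f v (EuclideanSpace.single j 1)))
    (h3 : ∀ j, Integrable (fun v => fderiv ℝ (fun v => invEntry a j m v * c v) v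
      (EuclideanSpace.single j 1) * f v)) :
    2 * Real.pi * Complex.I * ξ m * ∫ v, phase a ξ v * ((c v * f v : ℝ) : ℂ)
      = -∑ j, ((∫ v, phase a ξ v * ((invEntry a j m v * c v
            * fderiv ℝ f v (EuclideanSpace.single j 1) : ℝ) : ℂ))
          + ∫ v, phase a ξ v * ((fderiv ℝ (fun v => invEntry a j m v * c v) v
            (EuclideanSpace.single j 1) * f v : ℝ) : ℂ)) := by
  have cph := continuous_phase_fun ha.smooth.continuous ξ
  have hph : ∀ {g : Vel d → ℝ}, Integrable g → Integrable (fun v => phase a ξ v * (g v : ℂ)) :=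
    fun hg => Integrable.bdd_mul (c := 1) hg.ofReal cph.aestronglyMeasurable
      (Filter.Eventually.of_forall fun v => (norm_phase a ξ v).le)
  have hdph : ∀ (j : Fin d) {g : Vel d → ℝ}, Integrable g →
      Integrable (fun v => fderiv ℝ (phase a ξ) v (EuclideanSpace.single j 1) * (g v : ℂ)) := by
    intro j g hg
    obtain ⟨C, hC⟩ := bounded_fderiv_phase ha ξ (EuclideanSpace.single j 1)
    refine Integrable.bdd_mul (c := C) hg.ofReal ?_ (Filter.Eventually.of_forall hC)
    exact (measurable_fderiv_apply_const ℝ (phase a ξ) _).aestronglyMeasurable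
  have ibp : ∀ j : Fin d,
      ∫ v, fderiv ℝ (phase a ξ) v (EuclideanSpace.single j 1)
          * ((invEntry a j m v * c v * f v : ℝ) : ℂ)
        = -((∫ v, phase a ξ v * ((invEntry a j m v * c v
            * fderiv ℝ f v (EuclideanSpace.single j 1) : ℝ) : ℂ))
          + ∫ v, phase a ξ v * ((fderiv ℝ (fun v => invEntry a j m v * c v) v
            (EuclideanSpace.single j 1) * f v : ℝ) : ℂ)) := by
    intro j
    have hbc : Differentiable ℝ (fun v => invEntry a j m v * c v) := (hb j).mul hc
    have hder : ∀ v, HasLineDerivAt ℝ (fun v => invEntry a j m v * c v * f v)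
        (invEntry a j m v * c v * fderiv ℝ f v (EuclideanSpace.single j 1)
          + fderiv ℝ (fun v => invEntry a j m v * c v) v (EuclideanSpace.single j 1) * f v)
        v (EuclideanSpace.single j 1) := by
      intro v
      have h := ((hbc v).hasFDerivAt.mul (hf v).hasFDerivAt).hasLineDerivAt
        (EuclideanSpace.single j 1)
      convert! h using 1
      simp [mul_comm]
    -- There is no boundary term: integrability of the function and of both products with a
    -- derivative takes the place of compact support.
    have h := integral_bilinear_hasLineDerivAt_right_eq_neg_left_of_integrable
      (μ := (volume : Measure (Vel d))) (B := ContinuousLinearMap.lsmul ℝ ℝ)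
      (f := fun v => invEntry a j m v * c v * f v)
      (f' := fun v => invEntry a j m v * c v * fderiv ℝ f v (EuclideanSpace.single j 1)
          + fderiv ℝ (fun v => invEntry a j m v * c v) v (EuclideanSpace.single j 1) * f v)
      (g := phase a ξ) (g' := fun v => fderiv ℝ (phase a ξ) v (EuclideanSpace.single j 1))
      (v := EuclideanSpace.single j 1)
      (by simpa [mul_comm, mul_add] using hph ((h2 j).add (h3 j)))
      (by simpa [mul_comm] using hdph j (h1 j))
      (by simpa [mul_comm] using hph (h1 j))
      (fun v _ => hder v)
      (fun v _ => (differentiable_phase ha ξ v).hasFDerivAt.hasLineDerivAt _)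
    simp only [ContinuousLinearMap.lsmul_apply, Complex.real_smul] at h
    rw [← integral_add (hph (h2 j)) (hph (h3 j))]
    calc _ = ∫ v, ((invEntry a j m v * c v * f v : ℝ) : ℂ)
          * fderiv ℝ (phase a ξ) v (EuclideanSpace.single j 1) := by simp only [mul_comm]
      _ = _ := h
      _ = _ := by
        congr 1
        refine integral_congr_ae (Filter.Eventually.of_forall fun v => ?_)
        push_cast
        ring
  rw [← Finset.sum_neg_distrib, ← integral_const_mul]
  rw [← Finset.sum_congr rfl fun j _ => ibp j, ← integral_finsetSum _ fun j _ => hdph j (h1 j)]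
  refine integral_congr_ae (Filter.Eventually.of_forall fun v => ?_)
  have h := sum_invEntry_mul_fderiv_phase ha ξ m v
  simp only
  calc _ = (2 * Real.pi * Complex.I * ξ m * phase a ξ v) * ((c v * f v : ℝ) : ℂ) := by ring
    _ = _ := by
      rw [← h, Finset.sum_mul]
      refine Finset.sum_congr rfl fun j _ => ?_
      push_cast
      ring

/-- One integration by parts in velocity. -/
theorem osc_dv (ha : IsAdvectionField a lam) (hlam : 0 ≤ lam) (hσ : (d : ℝ) / 2 < σ) {q : ℕ}
    (hn : ((n + 2 : ℕ) : ℝ) * (1 + lam) ≤ r - σ) (hc : Growth lam (q + 1) n c) (hN : N ≠ ⊤)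
    (hF : WeightedBound r (k + 1) N F) (l : Fin d → ℤ) (ξ : Fin d → ℝ) (m : Fin d) :
    2 * Real.pi * Complex.I * ξ m * osc a c F l ξ
      = -∑ j, (osc a (fun v => invEntry a j m v * c v) (dv j F) l ξ
          + osc a (fun v => fderiv ℝ (fun v => invEntry a j m v * c v) v
            (EuclideanSpace.single j 1)) F l ξ) := by
  have hb : ∀ j, Growth lam (q + 1) 1 (invEntry a j m) :=
    fun j => ha.growth_invEntry hlam (q + 1) j m
  have hbc : ∀ j, Growth lam (q + 1) (n + 1) (fun v => invEntry a j m v * c v) := by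
    intro j
    have := (hb j).mul hc
    rwa [add_comm 1 n] at this
  -- The coefficient has degree `n` at the start, `n + 1` after multiplication by an entry of
  -- `(Da)⁻¹`, and `n + 2` once that product is differentiated.
  have hn0 : (n : ℝ) * (1 + lam) ≤ r - σ := by push_cast at hn; nlinarith
  have hn1 : ((n + 1 : ℕ) : ℝ) * (1 + lam) ≤ r - σ := by push_cast at hn ⊢; nlinarith
  have J0 := hc.integrable_mul hσ hn0 hN hF
  have J1 := fun j => (hbc j).integrable_mul hσ hn1 hN hF
  have J2 := fun j => (hbc j).integrable_mul hσ hn1 hN (hF.dv j)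
  have J3 := fun j => ((hbc j).2 j).integrable_mul hσ hn hN hF
  have i0 := integrable_osc ha.smooth.continuous J0 l ξ
  have i2 := fun j => integrable_osc ha.smooth.continuous (J2 j) l ξ
  have i3 := fun j => integrable_osc ha.smooth.continuous (J3 j) l ξ
  unfold osc
  rw [Measure.volume_eq_prod] at *
  rw [integral_prod _ i0]
  simp only [integral_prod _ (i2 _), integral_prod _ (i3 _)]
  rw [← integral_const_mul]
  have e1 : ∀ j, Integrable (fun x : Torus d => ∫ v, UnitAddTorus.mFourier (-l) x
      * (phase a ξ v * ((invEntry a j m v * c v * dv j F x v : ℝ) : ℂ))) :=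
    fun j => (i2 j).integral_prod_left
  have e2 : ∀ j, Integrable (fun x : Torus d => ∫ v, UnitAddTorus.mFourier (-l) x
      * (phase a ξ v * ((fderiv ℝ (fun v => invEntry a j m v * c v) v
            (EuclideanSpace.single j 1) * F x v : ℝ) : ℂ))) :=
    fun j => (i3 j).integral_prod_left
  rw [Finset.sum_congr rfl fun j _ => (integral_add (e1 j) (e2 j)).symm]
  refine Eq.trans ?_ (congrArg Neg.neg (integral_finsetSum _ fun j _ => (e1 j).add (e2 j)))
  rw [← integral_neg]
  refine integral_congr_ae ?_
  -- The fibrewise formula needs integrability in `v` at fixed `x`, which Fubini provides for almost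
  -- every `x`.
  have a1 := ae_all_iff.2 fun j => (J1 j).prod_right_ae
  have a2 := ae_all_iff.2 fun j => (J2 j).prod_right_ae
  have a3 := ae_all_iff.2 fun j => (J3 j).prod_right_ae
  filter_upwards [a1, a2, a3] with x h1 h2 h3
  have hdv : ∀ j v, dv j F x v = fderiv ℝ (F x) v (EuclideanSpace.single j 1) :=
    fun j v => dv_apply hF.phaseDiff j x v
  simp only [hdv] at h2 ⊢
  have key := integral_phase_mul ha ξ m (f := F x)
    ((hF.phaseDiff.slice_right x).differentiable (by norm_cast)) hc.differentiable
    (fun j => (hb j).differentiable) h1 h2 h3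
  simp only [integral_const_mul]
  rw [mul_left_comm, key, ← Finset.sum_congr rfl fun j _ => mul_add _ _ _, ← Finset.mul_sum]
  ring

/-- Decay of oscillating integrals in position and velocity frequencies. -/
theorem exists_osc_bound (ha : IsAdvectionField a lam) (hlam : 0 ≤ lam) (hσ : (d : ℝ) / 2 < σ)
    (m : Fin d) (q : ℕ) : ∀ (n : ℕ) (c : Vel d → ℝ), Growth lam q n c →
    ((n + 2 * q : ℕ) : ℝ) * (1 + lam) ≤ r - σ →
    ∃ K : ℝ≥0, ∀ (p : ℕ) (N : ℝ≥0∞) (F : Torus d → Vel d → ℝ) (l : Fin d → ℤ) (ξ : Fin d → ℝ)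
      (j : Fin d), N ≠ ⊤ → WeightedBound r (p + q) N F →
      ‖(2 * Real.pi * Complex.I * l j) ^ p * ((2 * Real.pi * Complex.I * ξ m) ^ q
        * osc a c F l ξ)‖ₑ ≤ K * N := by
  -- The coefficient is general in the induction, because each step replaces it by one of degree `n
  -- + 1` or `n + 2`; hence the budget `n + 2 q`. The constant is fixed before `p`, `N` and `F`, so
  -- it does not see `U`.
  induction q with
  | zero =>
    intro n c hc hn
    obtain ⟨h1, C, hC⟩ := hc.base
    have hfin : ENNReal.ofReal C * tailMass d σ ^ (1 / 2 : ℝ) ≠ ⊤ :=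
      ENNReal.mul_ne_top ENNReal.ofReal_ne_top
        (ENNReal.rpow_lt_top_of_nonneg (one_div_nonneg.2 zero_le_two) (tailMass_lt_top hσ).ne).ne
    refine ⟨(ENNReal.ofReal C * tailMass d σ ^ (1 / 2 : ℝ)).toNNReal, ?_⟩
    intro p N F l ξ j hN hF
    rw [add_zero] at hF
    rw [ENNReal.coe_toNNReal hfin, pow_zero, one_mul,
      ← osc_dx_iterate ha hσ hn hc hN hF l ξ j]
    exact (enorm_osc_le l ξ).trans (lintegral_coef_mul_le hn h1.continuous.measurable hC
      (hF.foldr_dx (List.replicate p j) (by simp)))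
  | succ q ih =>
    intro n c hc hn
    have hbc : ∀ j, Growth lam (q + 1) (n + 1) (fun v => invEntry a j m v * c v) := by
      intro j
      have := (ha.growth_invEntry hlam (q + 1) j m).mul hc
      rwa [add_comm 1 n] at this
    have hn1 : ((n + 1 + 2 * q : ℕ) : ℝ) * (1 + lam) ≤ r - σ := by
      push_cast at hn ⊢; nlinarith
    have hn2 : ((n + 1 + 1 + 2 * q : ℕ) : ℝ) * (1 + lam) ≤ r - σ := by
      push_cast at hn ⊢; nlinarith
    choose K1 hK1 using fun j => ih _ _ (hbc j).pred hn1
    choose K2 hK2 using fun j => ih _ _ ((hbc j).2 j) hn2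
    refine ⟨∑ j, (K1 j + K2 j), ?_⟩
    intro p N F l ξ j hN hF
    have hF1 : WeightedBound r (p + q + 1) N F := hF
    have hn3 : ((n + 2 : ℕ) : ℝ) * (1 + lam) ≤ r - σ := by
      push_cast at hn ⊢; nlinarith [mul_nonneg (Nat.cast_nonneg (α := ℝ) q) hlam]
    have step := osc_dv ha hlam hσ hn3 hc hN hF1 l ξ m
    have e : (2 * Real.pi * Complex.I * l j) ^ p * ((2 * Real.pi * Complex.I * ξ m) ^ (q + 1)
        * osc a c F l ξ)
        = -∑ i, ((2 * Real.pi * Complex.I * l j) ^ p * ((2 * Real.pi * Complex.I * ξ m) ^ q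
            * osc a (fun v => invEntry a i m v * c v) (dv i F) l ξ)
          + (2 * Real.pi * Complex.I * l j) ^ p * ((2 * Real.pi * Complex.I * ξ m) ^ q
            * osc a (fun v => fderiv ℝ (fun v => invEntry a i m v * c v) v
              (EuclideanSpace.single i 1)) F l ξ)) := by
      rw [pow_succ (2 * Real.pi * Complex.I * ξ m : ℂ), mul_assoc (_ ^ q), step]
      simp only [← mul_add, ← Finset.mul_sum]
      ring
    rw [e, enorm_neg]
    refine (enorm_sum_le _ _).trans ?_
    push_cast
    rw [Finset.sum_mul]
    refine Finset.sum_le_sum fun i _ => (enorm_add_le _ _).trans ?_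
    rw [add_mul]
    exact add_le_add (hK1 i p N _ l ξ j hN (hF1.dv i))
      (hK2 i p N _ l ξ j hN (hF.mono (by omega)))

end Decay

/-! ### Decay in both frequencies and the Schur kernel -/

section Kernel

variable {d : ℕ} {a : Vel d → Vel d} {lam σ r : ℝ}

/-- Geometric mean of the two bounds. With `n + 2` powers in all, neither bound has both more than
`n` powers of `A` and more than one of `B`; their mean has both. -/
theorem mul_le_of_interpolation {A B X M : ℝ} (hA : 1 ≤ A) (hB : 1 ≤ B) (hX : 0 ≤ X)
    (hM : 0 ≤ M) (n : ℕ) (h1 : A ^ n * B ^ 2 * X ≤ M) (h2 : A ^ (n + 1) * B ^ 1 * X ≤ M) :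
    X ≤ M * (A ^ (-((n : ℝ) + 1 / 2)) * B ^ (-(3 / 2) : ℝ)) := by
  have hA0 : 0 < A := by linarith
  have hB0 : 0 < B := by linarith
  have e : (A ^ ((n : ℝ) + 1 / 2) * B ^ (3 / 2 : ℝ) * X) ^ 2
      = (A ^ n * B ^ 2 * X) * (A ^ (n + 1) * B ^ 1 * X) := by
    have eA : (A ^ ((n : ℝ) + 1 / 2)) ^ 2 = A ^ n * A ^ (n + 1) := by
      rw [← Real.rpow_natCast, ← Real.rpow_mul hA0.le, ← pow_add, ← Real.rpow_natCast]
      congr 1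
      push_cast
      ring
    have eB : (B ^ (3 / 2 : ℝ)) ^ 2 = B ^ 3 := by
      rw [← Real.rpow_natCast, ← Real.rpow_mul hB0.le, ← Real.rpow_natCast]
      norm_num
    rw [mul_pow, mul_pow, eA, eB]
    ring
  have h3 : (A ^ ((n : ℝ) + 1 / 2) * B ^ (3 / 2 : ℝ) * X) ^ 2 ≤ M ^ 2 := by
    rw [e, sq M]
    exact mul_le_mul h1 h2 (by positivity) hM
  have h4 : A ^ ((n : ℝ) + 1 / 2) * B ^ (3 / 2 : ℝ) * X ≤ M :=
    (pow_le_pow_iff_left₀ (by positivity) hM two_ne_zero).1 h3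
  rw [Real.rpow_neg hA0.le, Real.rpow_neg hB0.le, ← mul_inv, ← div_eq_mul_inv,
    le_div_iff₀ (by positivity)]
  linarith

theorem max_pow_mul_le {A B X M : ℝ} {p q : ℕ} (h : A ^ p * B ^ q * X ≤ M)
    (hA : A ^ p * X ≤ M) (hB : B ^ q * X ≤ M) (h0 : X ≤ M) :
    max 1 A ^ p * max 1 B ^ q * X ≤ M := by
  rcases max_choice 1 A with h1 | h1 <;> rcases max_choice 1 B with h2 | h2 <;>
    simpa [h1, h2] using by assumption

theorem exists_norm_apply_eq [Nonempty (Fin d)] {E : Type*} [SeminormedAddCommGroup E]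
    (f : Fin d → E) : ∃ j, ‖f j‖ = ‖f‖ := by
  obtain ⟨j, -, hj⟩ := Finset.exists_mem_eq_sup' Finset.univ_nonempty fun j => ‖f j‖₊
  refine ⟨j, ?_⟩
  rw [Pi.norm_def, ← Finset.sup'_eq_sup Finset.univ_nonempty, hj]
  rfl

/-- Integration by parts `d` times in `x` and twice in `v`, or `d + 1` times in `x` and once in `v`,
followed by interpolation. The exponent `d + 1/2` exceeds `d`, as summation over `ℤ^d` requires, and
`3/2` exceeds `1`, as integration in time requires. -/
theorem exists_osc_decay [Nonempty (Fin d)] {k : ℕ} (hk : d + 1 < k)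
    (ha : IsAdvectionField a lam) (hlam : 0 ≤ lam) (hσ : (d : ℝ) / 2 < σ) :
    ∃ K : ℝ≥0, ∀ (N : ℝ≥0∞) (F : Torus d → Vel d → ℝ) (l : Fin d → ℤ) (ξ : Fin d → ℝ), N ≠ ⊤ →
      WeightedBound (σ + (1 + lam) * ((d : ℝ) + k)) k N F →
      ‖osc a (fun _ => 1) F l ξ‖ ≤ K * N.toReal
        * ((max 1 ‖l‖) ^ (-((d : ℝ) + 1 / 2)) * (max 1 ‖ξ‖) ^ (-(3 / 2) : ℝ)) := by
  set r := σ + (1 + lam) * ((d : ℝ) + k) with hr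
  have hd : 1 ≤ d := by
    obtain ⟨i⟩ := ‹Nonempty (Fin d)›
    have := i.2
    omega
  have hd' : (1 : ℝ) ≤ d := by exact_mod_cast hd
  have hk' : (d : ℝ) + 2 ≤ k := by exact_mod_cast hk
  -- Two integrations in velocity use four powers of `weight`, and `d + k ≥ 4` because `d ≥ 1` and
  -- `k ≥ d + 2`.
  have hw : ∀ q ≤ 2, ((0 + 2 * q : ℕ) : ℝ) * (1 + lam) ≤ r - σ := by
    intro q hq
    have hq' : (q : ℝ) ≤ 2 := by exact_mod_cast hq
    rw [hr]
    push_cast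
    nlinarith
  have hex : ∀ (m : Fin d) (q : Fin 3), ∃ K : ℝ≥0, ∀ (p : ℕ) (N : ℝ≥0∞)
      (F : Torus d → Vel d → ℝ) (l : Fin d → ℤ) (ξ : Fin d → ℝ) (j : Fin d), N ≠ ⊤ →
      WeightedBound r (p + q) N F →
      ‖(2 * Real.pi * Complex.I * l j) ^ p * ((2 * Real.pi * Complex.I * ξ m) ^ (q : ℕ)
        * osc a (fun _ => 1) F l ξ)‖ₑ ≤ K * N := fun m q =>
    exists_osc_bound ha hlam hσ m q 0 (fun _ => 1) (growth_const hlam 1) (hw q (by omega))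
  choose K hK using hex
  refine ⟨∑ m, ∑ q, K m q, fun N F l ξ hN hF => ?_⟩
  -- The norms are sup norms; the integrations by parts are done in the coordinates where they are
  -- attained.
  obtain ⟨j, hj⟩ := exists_norm_apply_eq l
  obtain ⟨m, hm⟩ := exists_norm_apply_eq ξ
  set X := ‖osc a (fun _ => 1) F l ξ‖
  set M : ℝ := ((∑ m, ∑ q, K m q : ℝ≥0) : ℝ) * N.toReal
  have hM : 0 ≤ M := by positivity
  have hpi : 1 ≤ 2 * Real.pi := by linarith [Real.pi_gt_three]
  have key : ∀ p q : ℕ, p + q ≤ k → q ≤ 2 → ‖l‖ ^ p * ‖ξ‖ ^ q * X ≤ M := by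
    intro p q hpq hq
    have h1 := hK m ⟨q, by omega⟩ p N F l ξ j hN (hF.mono hpq)
    have h2 : ‖(2 * Real.pi * Complex.I * l j) ^ p * ((2 * Real.pi * Complex.I * ξ m) ^ q
        * osc a (fun _ => 1) F l ξ)‖ ≤ K m ⟨q, by omega⟩ * N.toReal := by
      have h3 := ENNReal.toReal_mono (ENNReal.mul_ne_top ENNReal.coe_ne_top hN) h1
      simpa using h3
    have hle : K m ⟨q, by omega⟩ ≤ ∑ m, ∑ q, K m q :=
      (Finset.single_le_sum (f := fun q => K m q) (fun _ _ => zero_le) (Finset.mem_univ _)).trans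
        (Finset.single_le_sum (f := fun m => ∑ q, K m q) (fun _ _ => zero_le)
          (Finset.mem_univ m))
    have h4 : (K m ⟨q, by omega⟩ : ℝ) * N.toReal ≤ M :=
      mul_le_mul_of_nonneg_right (by exact_mod_cast hle) ENNReal.toReal_nonneg
    refine le_trans ?_ (h2.trans h4)
    have e1 : ‖(2 * Real.pi * Complex.I * l j : ℂ)‖ = 2 * Real.pi * ‖l‖ := by
      rw [← hj]
      simp [abs_of_pos Real.pi_pos, Int.norm_eq_abs]
    have e2 : ‖(2 * Real.pi * Complex.I * ξ m : ℂ)‖ = 2 * Real.pi * ‖ξ‖ := by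
      rw [← hm]
      simp [abs_of_pos Real.pi_pos]
    rw [norm_mul, norm_mul, norm_pow, norm_pow, e1, e2, ← mul_assoc]
    have hle : ∀ y : ℝ, 0 ≤ y → y ≤ 2 * Real.pi * y := fun y hy =>
      le_mul_of_one_le_left hy hpi
    gcongr
    · exact hle _ (norm_nonneg l)
    · exact hle _ (norm_nonneg ξ)
  -- Small frequencies are covered by the same estimate with `p` or `q` replaced by zero.
  have key2 : ∀ p q : ℕ, p + q ≤ k → q ≤ 2 → max 1 ‖l‖ ^ p * max 1 ‖ξ‖ ^ q * X ≤ M := by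
    intro p q hpq hq
    refine max_pow_mul_le (key p q hpq hq) ?_ ?_ ?_
    · simpa using key p 0 (by omega) (by omega)
    · simpa using key 0 q (by omega) hq
    · simpa using key 0 0 (by omega) (by omega)
  exact mul_le_of_interpolation (le_max_left _ _) (le_max_left _ _) (norm_nonneg _) hM d
    (key2 d 2 (by omega) le_rfl) (key2 (d + 1) 1 (by omega) (by omega))

/-- Convergence of `∑ ‖n‖^{-s}` over a lattice of rank `d < s`, applied to the integer points of
`ℝ^d`. The frequency zero, where `max 1 ‖n‖` and `‖n‖` differ, is added by hand. -/
theorem summable_norm_rpow_int {s : ℝ} (hs : (d : ℝ) < s) :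
    Summable fun n : Fin d → ℤ => (max 1 ‖n‖) ^ (-s) := by
  have hd0 : (0 : ℝ) ≤ d := Nat.cast_nonneg d
  set L := Submodule.span ℤ (Set.range (Pi.basisFun ℝ (Fin d)))
  have hrank : Module.finrank ℤ L = d := by
    rw [ZLattice.rank ℝ L]; simp
  have h1 := ZLattice.summable_norm_rpow L (-s) (by rw [hrank]; linarith)
  have hmem : ∀ n : Fin d → ℤ, (fun i => (n i : ℝ)) ∈ L := by
    intro n
    have : (fun i => (n i : ℝ)) = ∑ i, n i • Pi.basisFun ℝ (Fin d) i := by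
      funext j
      simp [Finset.sum_apply, Pi.single_apply]
    rw [this]
    exact Submodule.sum_mem _ fun i _ =>
      Submodule.smul_mem _ _ (Submodule.subset_span ⟨i, rfl⟩)
  have hinj : Function.Injective fun n : Fin d → ℤ => (⟨fun i => (n i : ℝ), hmem n⟩ : L) := by
    intro n m hnm
    funext i
    have h : (n i : ℝ) = m i := congrFun (Subtype.ext_iff.1 hnm) i
    exact_mod_cast h
  have h2 := h1.comp_injective hinj
  have hnorm : ∀ n : Fin d → ℤ, ‖(⟨fun i => (n i : ℝ), hmem n⟩ : L)‖ = ‖n‖ := by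
    intro n
    rw [Submodule.coe_norm, Pi.norm_def, Pi.norm_def]
    congr 2
  have h3 : Summable fun n : Fin d → ℤ => ‖n‖ ^ (-s) := by
    refine h2.congr fun n => ?_
    simp only [Function.comp_apply, hnorm]
  have h4 : Summable fun n : Fin d → ℤ => (if n = 0 then (1 : ℝ) else 0) :=
    summable_of_ne_finset_zero (s := {0}) (by simp)
  refine Summable.of_nonneg_of_le (fun n => by positivity) (fun n => ?_) (h3.add h4)
  by_cases hn : n = 0
  · subst hn
    have : 0 ≤ ‖(0 : Fin d → ℤ)‖ ^ (-s) := Real.rpow_nonneg (norm_nonneg _) _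
    simp at this ⊢
    exact this
  · obtain ⟨i, hi⟩ := Function.ne_iff.1 hn
    have h5 : 1 ≤ ‖n‖ := by
      refine le_trans ?_ (norm_le_pi_norm n i)
      rw [Int.norm_eq_abs]
      exact_mod_cast Int.one_le_abs hi
    simp [hn, max_eq_right h5]

/-- The sum of `max 1 |l|^{-(d + 1/2)}` over all frequencies. -/
def freqMass (d : ℕ) : ℝ≥0∞ :=
  ∑' l : Fin d → ℤ, ENNReal.ofReal ((max 1 ‖l‖) ^ (-((d : ℝ) + 1 / 2)))

theorem freqMass_lt_top (d : ℕ) : freqMass d < ⊤ := by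
  unfold freqMass
  have h := summable_norm_rpow_int (d := d) (s := (d : ℝ) + 1 / 2) (by linarith)
  rw [← ENNReal.ofReal_tsum_of_nonneg (fun l => by positivity) h]
  exact ENNReal.ofReal_lt_top

/-- `L max(1, τ L)^{-3/2}`, as an extended nonnegative number. -/
def timeKernel (L τ : ℝ) : ℝ≥0∞ := ENNReal.ofReal (L * (max 1 (τ * L)) ^ (-(3 / 2) : ℝ))

theorem measurable_timeKernel (L : ℝ) : Measurable (timeKernel L) := by
  unfold timeKernel
  fun_prop

/-- The substitution `u = τ L` absorbs the factor `L` and leaves `∫ max(1, u)^{-3/2} du`. Uniformity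
in `L` is the gain of one derivative by averaging. -/
theorem lintegral_timeKernel_le {L : ℝ} (hL : 0 ≤ L) :
    ∫⁻ τ in Set.Ioi (0 : ℝ), timeKernel L τ ≤ 8 := by
  rcases hL.eq_or_lt with rfl | hL
  · simp [timeKernel]
  have hder : ∀ x ∈ Set.Ioi (0 : ℝ), HasDerivAt (fun τ => -2 * (1 + τ * L) ^ (-(1 / 2) : ℝ))
      (L * (1 + x * L) ^ (-(3 / 2) : ℝ)) x := by
    intro x hx
    have hx0 : (0 : ℝ) < x := hx
    have h1 : HasDerivAt (fun τ => 1 + τ * L) (1 * L) x :=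
      ((hasDerivAt_id x).mul_const L).const_add 1
    have h2 := (h1.rpow_const (p := -(1 / 2)) (Or.inl (by positivity))).const_mul (-2 : ℝ)
    refine h2.congr_deriv ?_
    norm_num
    ring
  have hcont : ContinuousWithinAt (fun τ => -2 * (1 + τ * L) ^ (-(1 / 2) : ℝ))
      (Set.Ici 0) 0 := by
    refine ContinuousAt.continuousWithinAt ?_
    refine continuousAt_const.mul (ContinuousAt.rpow_const (by fun_prop) (Or.inl (by simp)))
  have hlim : Filter.Tendsto (fun τ => -2 * (1 + τ * L) ^ (-(1 / 2) : ℝ)) Filter.atTop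
      (nhds (-2 * 0)) := by
    refine Filter.Tendsto.const_mul _ ((tendsto_rpow_neg_atTop (by norm_num)).comp ?_)
    exact Filter.tendsto_atTop_add_const_left _ _ (Filter.tendsto_id.atTop_mul_const hL)
  have hnn : ∀ x ∈ Set.Ioi (0 : ℝ), 0 ≤ L * (1 + x * L) ^ (-(3 / 2) : ℝ) := by
    intro x hx
    have hx0 : (0 : ℝ) < x := hx
    positivity
  have hint := integral_Ioi_of_hasDerivAt_of_nonneg hcont hder hnn hlim
  have hintg := integrableOn_Ioi_deriv_of_nonneg hcont hder hnn hlim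
  -- From `max(1, u) ≥ (1 + u)/2` and `2^{3/2} ≤ 4`. The majorant `L (1 + τ L)^{-3/2}` has an
  -- explicit primitive and integral `2`, whence `8 = 4 · 2`.
  have hle : ∀ x ∈ Set.Ioi (0 : ℝ), timeKernel L x
      ≤ 4 * ENNReal.ofReal (L * (1 + x * L) ^ (-(3 / 2) : ℝ)) := by
    intro x hx
    have hx0 : (0 : ℝ) < x := hx
    have h4 : (4 : ℝ≥0∞) = ENNReal.ofReal 4 := by norm_num
    rw [timeKernel, h4, ← ENNReal.ofReal_mul (by norm_num)]
    refine ENNReal.ofReal_le_ofReal ?_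
    have h5 : (max 1 (x * L)) ^ (-(3 / 2) : ℝ) ≤ ((1 + x * L) / 2) ^ (-(3 / 2) : ℝ) := by
      refine Real.rpow_le_rpow_of_nonpos (by positivity) ?_ (by norm_num)
      have := le_max_left 1 (x * L)
      have := le_max_right 1 (x * L)
      linarith
    rw [Real.div_rpow (by positivity) (by norm_num)] at h5
    have h6 : (1 / 4 : ℝ) ≤ (2 : ℝ) ^ (-(3 / 2) : ℝ) := by
      have : (2 : ℝ) ^ (-2 : ℝ) ≤ (2 : ℝ) ^ (-(3 / 2) : ℝ) :=
        Real.rpow_le_rpow_of_exponent_le (by norm_num) (by norm_num)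
      refine le_trans (le_of_eq ?_) this
      rw [Real.rpow_neg (by norm_num)]
      norm_num
    have h7 : (1 + x * L) ^ (-(3 / 2) : ℝ) / 2 ^ (-(3 / 2) : ℝ)
        ≤ 4 * (1 + x * L) ^ (-(3 / 2) : ℝ) := by
      rw [div_le_iff₀ (by positivity)]
      have : 0 ≤ (1 + x * L) ^ (-(3 / 2) : ℝ) := by positivity
      nlinarith
    calc L * (max 1 (x * L)) ^ (-(3 / 2) : ℝ) ≤ L * (4 * (1 + x * L) ^ (-(3 / 2) : ℝ)) :=
          mul_le_mul_of_nonneg_left (h5.trans h7) hL.le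
      _ = _ := by ring
  calc _ ≤ ∫⁻ x in Set.Ioi (0 : ℝ), 4 * ENNReal.ofReal (L * (1 + x * L) ^ (-(3 / 2) : ℝ)) :=
        setLIntegral_mono' measurableSet_Ioi hle
    _ = 4 * ENNReal.ofReal (∫ x in Set.Ioi (0 : ℝ), L * (1 + x * L) ^ (-(3 / 2) : ℝ)) := by
        rw [lintegral_const_mul' _ _ (by simp), ofReal_integral_eq_lintegral_ofReal hintg
          ((ae_restrict_iff' measurableSet_Ioi).2 (Filter.Eventually.of_forall hnn))]
    _ = 8 := by
        rw [hint]
        simp only [zero_mul, add_zero, Real.one_rpow, mul_zero, mul_one, zero_sub, neg_neg]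
        rw [show (4 : ℝ≥0∞) = ENNReal.ofReal 4 by norm_num, ← ENNReal.ofReal_mul (by norm_num)]
        norm_num

end Kernel

/-! ### Fourier series on the torus -/

section Fourier

variable {d : ℕ}

/-- Fourier coefficients with respect to the `volume` of the torus. -/
def fourierCoef (f : Torus d → ℂ) (l : Fin d → ℤ) : ℂ :=
  ∫ x, UnitAddTorus.mFourier (-l) x * f x

theorem hasSum_conj_fourierCoef_mul {f g : Torus d → ℂ} (hf : MemLp f 2 volume)
    (hg : MemLp g 2 volume) :
    HasSum (fun l => (starRingEnd ℂ) (fourierCoef f l) * fourierCoef g l)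
      (∫ x, (starRingEnd ℂ) (f x) * g x) := by
  unfold fourierCoef
  rw [volume_torus] at *
  have h := UnitAddTorus.hasSum_prod_mFourierCoeff (d := Fin d) (hf.toLp f) (hg.toLp g)
  have e1 : ∀ {f : Torus d → ℂ} (hf : MemLp f 2 (Measure.pi fun _ => AddCircle.haarAddCircle))
      (l : Fin d → ℤ), UnitAddTorus.mFourierCoeff (hf.toLp f) l
        = ∫ x, UnitAddTorus.mFourier (-l) x * f x
          ∂(Measure.pi fun _ => AddCircle.haarAddCircle) := by
    intro f hf l
    refine integral_congr_ae ?_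
    filter_upwards [hf.coeFn_toLp] with x hx
    rw [hx, smul_eq_mul]
  simp only [e1] at h
  convert! h using 1
  refine integral_congr_ae ?_
  filter_upwards [hf.coeFn_toLp, hg.coeFn_toLp] with x h1 h2
  rw [h1, h2]

/-- Parseval applied to the conjugate of `f`, whose coefficient at `l` is the conjugate of that of
`f` at `-l`. -/
theorem enorm_integral_mul_le {f g : Torus d → ℂ} (hf : MemLp f 2 volume)
    (hg : MemLp g 2 volume) :
    ‖∫ x, f x * g x‖ₑ ≤ ∑' l, ‖fourierCoef f l‖ₑ * ‖fourierCoef g (-l)‖ₑ := by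
  have hf' : MemLp (fun x => (starRingEnd ℂ) (f x)) 2 volume := hf.star
  have h := hasSum_conj_fourierCoef_mul hf' hg
  simp only [RingHomCompTriple.comp_apply, RingHom.id_apply] at h
  have e : ∀ l, (starRingEnd ℂ) (fourierCoef (fun x => (starRingEnd ℂ) (f x)) l)
      = fourierCoef f (-l) := by
    intro l
    rw [fourierCoef, ← integral_conj]
    simp only [map_mul, UnitAddTorus.mFourier_neg, RingHomCompTriple.comp_apply,
      RingHom.id_apply, fourierCoef, neg_neg]
  simp only [e] at h
  have h2 : ∑' l, ‖fourierCoef f (-l) * fourierCoef g l‖ₑ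
      = ∑' l, ‖fourierCoef f l‖ₑ * ‖fourierCoef g (-l)‖ₑ := by
    rw [← (Equiv.neg (Fin d → ℤ)).tsum_eq]
    simp [enorm_mul]
  rw [← h2, ← h.tsum_eq]
  exact enorm_tsum_le_tsum_enorm

theorem tsum_enorm_fourierCoef_sq {f : Torus d → ℂ} (hf : MemLp f 2 volume) :
    ∑' l, ‖fourierCoef f l‖ₑ ^ 2 = ∫⁻ x, ‖f x‖ₑ ^ 2 := by
  have h := hasSum_conj_fourierCoef_mul hf hf
  have e : ∀ z : ℂ, (starRingEnd ℂ) z * z = ((‖z‖ ^ 2 : ℝ) : ℂ) := by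
    intro z
    rw [mul_comm, Complex.mul_conj, Complex.normSq_eq_norm_sq]
  simp only [e] at h
  rw [integral_complex_ofReal] at h
  have h1 : HasSum (fun l => ‖fourierCoef f l‖ ^ 2) (∫ x, ‖f x‖ ^ 2) := by
    exact_mod_cast h
  have h2 : ∀ z : ℂ, ‖z‖ₑ ^ 2 = ENNReal.ofReal (‖z‖ ^ 2) := by
    intro z
    rw [← ofReal_norm, ENNReal.ofReal_pow (norm_nonneg _)]
  simp only [h2]
  rw [← ENNReal.ofReal_tsum_of_nonneg (fun l => by positivity) h1.summable, h1.tsum_eq,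
    ofReal_integral_eq_lintegral_ofReal hf.norm.integrable_sq
      (Filter.Eventually.of_forall fun x => by positivity)]

end Fourier

/-! ### Averages in velocity along shears -/

section Shear

variable {d : ℕ} {c : Vel d → Torus d} {r : ℝ}

/-- The shear `(y, v) ↦ (y + c v, v)`. -/
def shear (c : Vel d → Torus d) (hc : Measurable c) : Torus d × Vel d ≃ᵐ Torus d × Vel d where
  toFun q := (q.1 + c q.2, q.2)
  invFun q := (q.1 - c q.2, q.2)
  left_inv q := by simp
  right_inv q := by simp
  measurable_toFun := by
    change Measurable fun q : Torus d × Vel d => (q.1 + c q.2, q.2)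
    fun_prop
  measurable_invFun := by
    change Measurable fun q : Torus d × Vel d => (q.1 - c q.2, q.2)
    fun_prop

/-- On each fibre of fixed `v` the shear is a translation of the torus. -/
theorem measurePreserving_shear (hc : Measurable c) :
    MeasurePreserving (shear c hc) volume volume := by
  have h1 : MeasurePreserving (fun p : Vel d × Torus d => (id p.1, p.2 + c p.1))
      ((volume : Measure (Vel d)).prod volume) ((volume : Measure (Vel d)).prod volume) :=
    (MeasurePreserving.id (volume : Measure (Vel d))).skew_product
      (g := fun v (x : Torus d) => x + c v)
      (by simp only [Function.uncurry_def]; fun_prop)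
      (Filter.Eventually.of_forall fun v => map_add_right_eq_self volume (c v))
  exact (Measure.measurePreserving_swap.comp h1).comp Measure.measurePreserving_swap

theorem memLp_two_of_lintegral {α E : Type*} [MeasurableSpace α] {μ : Measure α}
    [NormedAddCommGroup E] {f : α → E} (hf : AEStronglyMeasurable f μ)
    (h : ∫⁻ x, ‖f x‖ₑ ^ 2 ∂μ < ⊤) : MemLp f 2 μ := by
  refine ⟨hf, ?_⟩
  rw [eLpNorm_eq_lintegral_rpow_enorm_toReal two_ne_zero (by simp)]
  refine ENNReal.rpow_lt_top_of_nonneg (by simp) ?_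
  simpa using h.ne

/-- The velocity average of a function of finite weighted norm is square integrable. -/
theorem memLp_velocity_average (hr : (d : ℝ) / 2 < r) {F : Torus d → Vel d → ℂ}
    (hF : StronglyMeasurable fun q : Torus d × Vel d => F q.1 q.2)
    (h : ∫⁻ q : Torus d × Vel d, ENNReal.ofReal ((1 + ‖q.2‖ ^ 2) ^ r) * ‖F q.1 q.2‖ₑ ^ 2 < ⊤) :
    MemLp (fun y => ∫ v, F y v) 2 volume := by
  refine memLp_two_of_lintegral hF.integral_prod_right.aestronglyMeasurable ?_
  have hm := hF.measurable
  have h1 : ∀ y, ‖∫ v, F y v‖ₑ ^ 2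
      ≤ tailMass d r * ∫⁻ v, ENNReal.ofReal ((1 + ‖v‖ ^ 2) ^ r) * ‖F y v‖ₑ ^ 2 := by
    intro y
    have hy : Measurable (F y) := hm.comp measurable_prodMk_left
    -- Cauchy–Schwarz in `v` against the constant one, which has finite norm for the dual weight
    -- since `r > d/2`.
    have h2 := lintegral_mul_le_weighted (μ := (volume : Measure (Vel d))) r id measurable_id
      (f := fun _ => 1) (g := fun v => ‖F y v‖ₑ) aemeasurable_const hy.enorm.aemeasurable
    simp only [one_mul, one_pow, mul_one, id] at h2
    have h3 := pow_le_pow_left' ((enorm_integral_le_lintegral_enorm (F y)).trans h2) 2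
    refine h3.trans (le_of_eq ?_)
    rw [mul_pow, ← ENNReal.rpow_natCast, ← ENNReal.rpow_natCast, ← ENNReal.rpow_mul,
      ← ENNReal.rpow_mul]
    norm_num [tailMass]
  calc _ ≤ ∫⁻ y, tailMass d r * ∫⁻ v, ENNReal.ofReal ((1 + ‖v‖ ^ 2) ^ r) * ‖F y v‖ₑ ^ 2 :=
        lintegral_mono h1
    _ = tailMass d r * ∫⁻ q : Torus d × Vel d,
          ENNReal.ofReal ((1 + ‖q.2‖ ^ 2) ^ r) * ‖F q.1 q.2‖ₑ ^ 2 := by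
        rw [lintegral_const_mul' _ _ (tailMass_lt_top hr).ne, Measure.volume_eq_prod,
          lintegral_prod _ (by fun_prop)]
    _ < ⊤ := ENNReal.mul_lt_top (tailMass_lt_top hr) h

/-- The product of a transported square integrable function with a function of finite weighted
norm. -/
theorem lintegral_transport_mul_le (hc : Measurable c) {E : Type*} [NormedAddCommGroup E]
    {h : Torus d → E} (hh : StronglyMeasurable h) {F : Torus d → Vel d → ℝ}
    (hF : Measurable fun q : Torus d × Vel d => F q.1 q.2) :
    ∫⁻ q : Torus d × Vel d, ‖h (q.1 - c q.2)‖ₑ * ‖F q.1 q.2‖ₑ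
      ≤ (tailMass d r * ∫⁻ x, ‖h x‖ₑ ^ 2) ^ (1 / 2 : ℝ) * weightedSq r F ^ (1 / 2 : ℝ) := by
  have hsm : StronglyMeasurable fun q : Torus d × Vel d => h (q.1 - c q.2) :=
    hh.comp_measurable (by fun_prop)
  have h1 := lintegral_mul_le_weighted (μ := (volume : Measure (Torus d × Vel d))) r
    (fun q => q.2) measurable_snd
    (f := fun q => ‖h (q.1 - c q.2)‖ₑ) (g := fun q => ‖F q.1 q.2‖ₑ) hsm.enorm.aemeasurable
    (by fun_prop)
  rw [← weightedSq_eq hF] at h1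
  refine h1.trans (mul_le_mul' (ENNReal.rpow_le_rpow (le_of_eq ?_) (by norm_num)) le_rfl)
  have hm : Measurable fun q : Torus d × Vel d =>
      ENNReal.ofReal ((1 + ‖q.2‖ ^ 2) ^ (-r)) * ‖h (q.1 - c q.2)‖ₑ ^ 2 :=
    ((measurable_bracket_rpow _).comp measurable_snd).mul (hsm.enorm.pow_const 2)
  rw [Measure.volume_eq_prod, lintegral_prod_symm _ hm.aemeasurable]
  -- For fixed `v` transport is a translation, so the norm of `h` separates from the weight.
  have h2 : ∀ v, ∫⁻ x, ENNReal.ofReal ((1 + ‖v‖ ^ 2) ^ (-r)) * ‖h (x - c v)‖ₑ ^ 2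
      = ENNReal.ofReal ((1 + ‖v‖ ^ 2) ^ (-r)) * ∫⁻ x, ‖h x‖ₑ ^ 2 := by
    intro v
    rw [lintegral_const_mul' _ _ ENNReal.ofReal_ne_top,
      lintegral_sub_right_eq_self (fun x => ‖h x‖ₑ ^ 2) (c v)]
  simp only [h2]
  rw [lintegral_mul_const _ (measurable_bracket_rpow _)]
  rfl

variable {h : Torus d → ℂ} {F : Torus d → Vel d → ℝ}

theorem integrable_transport_mul (hr : (d : ℝ) / 2 < r) (hc : Measurable c) {E : Type*}
    [NormedAddCommGroup E] [NormedSpace ℝ E]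
    {h : Torus d → E} (hh : StronglyMeasurable h) (h2 : ∫⁻ x, ‖h x‖ₑ ^ 2 < ⊤)
    (hF : Measurable fun q : Torus d × Vel d => F q.1 q.2) (hFr : weightedSq r F < ⊤) :
    Integrable (fun q : Torus d × Vel d => F q.1 q.2 • h (q.1 - c q.2)) := by
  have hsm : StronglyMeasurable fun q : Torus d × Vel d => h (q.1 - c q.2) :=
    hh.comp_measurable (by fun_prop)
  refine ⟨(hF.stronglyMeasurable.smul hsm).aestronglyMeasurable, ?_⟩
  unfold HasFiniteIntegral
  simp only [enorm_smul]
  simp only [mul_comm ‖F _ _‖ₑ]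
  refine (lintegral_transport_mul_le (r := r) hc hh hF).trans_lt (ENNReal.mul_lt_top ?_ ?_)
  · exact ENNReal.rpow_lt_top_of_nonneg (by norm_num)
      (ENNReal.mul_lt_top (tailMass_lt_top hr) h2).ne
  · exact ENNReal.rpow_lt_top_of_nonneg (by norm_num) hFr.ne

/-- The adjoint of transport: the velocity average of `F` along the shear. -/
theorem integral_transport_mul (hr : (d : ℝ) / 2 < r) (hc : Measurable c)
    (hh : StronglyMeasurable h) (h2 : ∫⁻ x, ‖h x‖ₑ ^ 2 < ⊤)
    (hF : Measurable fun q : Torus d × Vel d => F q.1 q.2) (hFr : weightedSq r F < ⊤) :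
    ∫ q : Torus d × Vel d, F q.1 q.2 • h (q.1 - c q.2)
      = ∫ y, h y * ∫ v, ((F (y + c v) v : ℝ) : ℂ) := by
  have hi := integrable_transport_mul hr hc hh h2 hF hFr
  have hmp := measurePreserving_shear hc
  have hi' : Integrable (fun q : Torus d × Vel d => F (q.1 + c q.2) q.2 • h q.1) := by
    have := (hmp.integrable_comp hi.aestronglyMeasurable).2 hi
    simpa [Function.comp_def, shear] using this
  rw [← hmp.integral_comp']
  simp only [shear, MeasurableEquiv.coe_mk, Equiv.coe_fn_mk, add_sub_cancel_right]
  rw [Measure.volume_eq_prod] at hi' ⊢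
  rw [integral_prod _ hi']
  refine integral_congr_ae (Filter.Eventually.of_forall fun y => ?_)
  simp only
  rw [← integral_const_mul]
  refine integral_congr_ae (Filter.Eventually.of_forall fun v => ?_)
  simp [mul_comm]

theorem memLp_shear_average (hr : (d : ℝ) / 2 < r) (hc : Measurable c)
    (hF : Measurable fun q : Torus d × Vel d => F q.1 q.2) (hFr : weightedSq r F < ⊤) :
    MemLp (fun y => ∫ v, ((F (y + c v) v : ℝ) : ℂ)) 2 volume := by
  have hm : Measurable fun q : Torus d × Vel d => F (q.1 + c q.2) q.2 :=
    hF.comp (f := fun q : Torus d × Vel d => (q.1 + c q.2, q.2)) (by fun_prop)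
  refine memLp_velocity_average hr (F := fun y v => ((F (y + c v) v : ℝ) : ℂ))
    (Complex.measurable_ofReal.comp hm).stronglyMeasurable ?_
  have hmp := measurePreserving_shear hc
  have h := hmp.lintegral_comp (f := fun q : Torus d × Vel d =>
    ENNReal.ofReal ((1 + ‖q.2‖ ^ 2) ^ r) * ‖F q.1 q.2‖ₑ ^ 2) (by fun_prop)
  rw [← weightedSq_eq hF] at h
  refine lt_of_eq_of_lt ?_ (lt_of_eq_of_lt h hFr)
  refine lintegral_congr fun q => ?_
  simp [shear, ← ofReal_norm]

end Shear

/-! ### The averaging form at fixed times -/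

section Slice

variable {d : ℕ} {a : Vel d → Vel d} {lam r : ℝ} {k : ℕ} {N : ℝ≥0∞}
  {U : Torus d → Vel d → ℝ} {ψ : Torus d → ℝ}

/-- `∂_{x_i}(U ψ)`. -/
def dxMul (i : Fin d) (U : Torus d → Vel d → ℝ) (ψ : Torus d → ℝ) (x : Torus d) (v : Vel d) : ℝ :=
  torusDeriv i (fun y => U y v * ψ y) x

theorem torusDeriv_mul {f g : Torus d → ℝ} (hf : ContDiff ℝ 1 (fun z => f (toTorus z)))
    (hg : ContDiff ℝ 1 (fun z => g (toTorus z))) (i : Fin d) (x : Torus d) :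
    torusDeriv i (fun y => f y * g y) x = torusDeriv i f x * g x + f x * torusDeriv i g x := by
  have := (hasDerivAt_torusDeriv (hf.differentiable one_ne_zero) i x).fun_mul
    (hasDerivAt_torusDeriv (hg.differentiable one_ne_zero) i x)
  refine this.deriv.trans ?_
  simp

theorem dxMul_eq (i : Fin d) (hU : PhaseDiff 1 U) (hψ : ContDiff ℝ 1 (fun z => ψ (toTorus z)))
    (x : Torus d) (v : Vel d) :
    dxMul i U ψ x v = dx i U x v * ψ x + U x v * torusDeriv i ψ x :=
  torusDeriv_mul (by exact_mod_cast hU.slice_left v) hψ i x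

theorem measurable_dxMul (i : Fin d) (hU : PhaseDiff 1 U)
    (hψ : ContDiff ℝ 1 (fun z => ψ (toTorus z))) :
    Measurable fun q : Torus d × Vel d => dxMul i U ψ q.1 q.2 := by
  simp only [dxMul_eq i hU hψ]
  have c1 : Continuous ψ := continuous_of_toTorus hψ.continuous
  have c2 : Continuous (torusDeriv i ψ) :=
    continuous_of_toTorus (contDiff_torusDeriv (m := 0) (by simp) hψ i).continuous
  have c3 := (PhaseDiff.dx (n := 0) hU i).continuous
  have c4 := hU.continuous
  exact Continuous.measurable (by fun_prop)

/-- Product rule and `(x + y)² ≤ 2 (x² + y²)`. The bound involves derivatives of `ψ` and serves only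
for absolute convergence; it never enters the final constant. -/
theorem weightedSq_dxMul_le (i : Fin d) (hU : WeightedBound r k N U) (hk : 1 ≤ k)
    (hψ : ContDiff ℝ 1 (fun z => ψ (toTorus z))) {B : ℝ} (hB : ∀ x, |ψ x| ≤ B)
    (hB' : ∀ x, |torusDeriv i ψ x| ≤ B) :
    weightedSq r (dxMul i U ψ) ≤ ENNReal.ofReal (2 * B ^ 2) * (N ^ 2 + N ^ 2) := by
  have hU1 : PhaseDiff 1 U := hU.phaseDiff.mono hk
  have h1 : weightedSq r (dx i U) ≤ N ^ 2 := hU.bound [i] [] (by simpa using hk)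
  have h2 : weightedSq r U ≤ N ^ 2 := hU.bound [] [] (by simp)
  have m1 := (PhaseDiff.dx (n := 0) hU1 i).continuous.measurable
  have m2 := hU1.continuous.measurable
  refine le_trans ?_ (mul_le_mul' le_rfl (add_le_add h1 h2))
  rw [weightedSq_eq m1, weightedSq_eq m2, ← lintegral_add_left (by fun_prop),
    ← lintegral_const_mul' _ _ ENNReal.ofReal_ne_top, weightedSq_eq (measurable_dxMul i hU1 hψ)]
  refine lintegral_mono fun q => ?_
  simp only
  rw [dxMul_eq i hU1 hψ, ← mul_add, mul_left_comm]
  refine mul_le_mul' le_rfl ?_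
  simp only [← ofReal_norm, ← ENNReal.ofReal_pow (norm_nonneg _)]
  rw [← ENNReal.ofReal_add (by positivity) (by positivity), ← ENNReal.ofReal_mul (by positivity)]
  refine ENNReal.ofReal_le_ofReal ?_
  simp only [Real.norm_eq_abs, sq_abs]
  have e1 : (dx i U q.1 q.2 * ψ q.1) ^ 2 ≤ dx i U q.1 q.2 ^ 2 * B ^ 2 := by
    rw [mul_pow]
    exact mul_le_mul_of_nonneg_left (sq_le_sq.2 ((hB q.1).trans (le_abs_self B))) (sq_nonneg _)
  have e2 : (U q.1 q.2 * torusDeriv i ψ q.1) ^ 2 ≤ U q.1 q.2 ^ 2 * B ^ 2 := by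
    rw [mul_pow]
    exact mul_le_mul_of_nonneg_left (sq_le_sq.2 ((hB' q.1).trans (le_abs_self B))) (sq_nonneg _)
  nlinarith [sq_nonneg (dx i U q.1 q.2 * ψ q.1 - U q.1 q.2 * torusDeriv i ψ q.1)]

theorem exists_bound_torus (hψ : ContDiff ℝ 1 (fun z => ψ (toTorus z))) (i : Fin d) :
    ∃ B, (∀ x, |ψ x| ≤ B) ∧ ∀ x, |torusDeriv i ψ x| ≤ B := by
  have c1 : Continuous ψ := continuous_of_toTorus hψ.continuous
  have c2 : Continuous (torusDeriv i ψ) :=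
    continuous_of_toTorus (contDiff_torusDeriv (m := 0) (by simp) hψ i).continuous
  obtain ⟨B1, h1⟩ := isCompact_univ.exists_bound_of_continuousOn c1.continuousOn
  obtain ⟨B2, h2⟩ := isCompact_univ.exists_bound_of_continuousOn c2.continuousOn
  exact ⟨max B1 B2, fun x => (h1 x trivial).trans (le_max_left _ _),
    fun x => (h2 x trivial).trans (le_max_right _ _)⟩

/-- A character turns transport into multiplication by the phase of frequency `-τ l`, which is how
`osc` arises. -/
theorem mFourier_transport (l : Fin d → ℤ) (τ : ℝ) (x : Torus d) (v : Vel d) :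
    UnitAddTorus.mFourier l (x - toTorus (τ • a v))
      = phase a (fun j => -(τ * l j)) v * UnitAddTorus.mFourier l x := by
  have h : x - toTorus (τ • a v) = x + toTorus (-(τ • a v)) := by
    rw [sub_eq_add_neg]
    congr 1
  rw [h, mFourier_add_apply, mFourier_toTorus, phase, mul_comm]
  congr 4
  refine Finset.sum_congr rfl fun j _ => ?_
  simp
  ring

theorem memLp_of_continuous {f : Torus d → ℂ} (hf : Continuous f) : MemLp f 2 volume := by
  obtain ⟨B, hB⟩ := isCompact_univ.exists_bound_of_continuousOn hf.continuousOn
  exact MemLp.of_bound hf.aestronglyMeasurable B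
    (Filter.Eventually.of_forall fun x => hB x trivial)

/-- Fourier coefficients of the velocity average of `∂_{x_i}(U ψ)` along transport. -/
theorem enorm_fourierCoef_average_le (hr : (d : ℝ) / 2 < r) (ha : Continuous a) (hN : N ≠ ⊤)
    (hk : 1 ≤ k) (hU : WeightedBound r k N U) (hψ : ContDiff ℝ 1 (fun z => ψ (toTorus z)))
    (i : Fin d) (τ : ℝ) (l : Fin d → ℤ) :
    ‖fourierCoef (fun y => ∫ v, ((dxMul i U ψ (y + toTorus (τ • a v)) v : ℝ) : ℂ)) (-l)‖ₑ
      ≤ ENNReal.ofReal (2 * Real.pi * ‖l‖) * ∑' m, ‖fourierCoef (fun x => (ψ x : ℂ)) m‖ₑ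
        * ‖osc a (fun _ => 1) U (-(m + l)) (fun j => -(τ * l j))‖ₑ := by
  have hU1 : PhaseDiff 1 U := hU.phaseDiff.mono hk
  have hc : Measurable fun v => toTorus (τ • a v) :=
    (continuous_toTorus.comp (ha.const_smul τ)).measurable
  have cψ : Continuous ψ := continuous_of_toTorus hψ.continuous
  have cU : Continuous fun q : Torus d × Vel d => U q.1 q.2 := hU1.continuous
  have cph := continuous_phase_fun ha (fun j => -(τ * l j))
  have cF : ∀ n : Fin d → ℤ, Continuous (UnitAddTorus.mFourier n) :=
    fun n => ContinuousMap.continuous _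
  have hFm := measurable_dxMul i hU1 hψ
  obtain ⟨B, hB, hB'⟩ := exists_bound_torus hψ i
  have hfin : weightedSq r (dxMul i U ψ) < ⊤ :=
    (weightedSq_dxMul_le i hU hk hψ hB hB').trans_lt
      (ENNReal.mul_lt_top ENNReal.ofReal_lt_top (by simp [hN.lt_top]))
  have hefin : ∫⁻ x, ‖UnitAddTorus.mFourier l x‖ₑ ^ 2 < ⊤ := by
    simp [← ofReal_norm, norm_mFourier_apply]
  -- reduce to an integral of `U ψ`
  have h1 := integral_transport_mul hr hc (cF l).stronglyMeasurable hefin hFm hfin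
  have hi1 := integrable_transport_mul hr hc (cF l).stronglyMeasurable hefin hFm hfin
  have hUfin : weightedSq r U < ⊤ := (hU.bound [] [] (by simp)).trans_lt (by simp [hN.lt_top])
  have hUint : Integrable (fun q : Torus d × Vel d => U q.1 q.2) := by
    have h := integrable_transport_mul (c := fun _ => (0 : Torus d)) hr measurable_const
      (h := fun _ => (1 : ℝ)) stronglyMeasurable_const (by simp) cU.measurable hUfin
    simpa using h
  have hbdd : Integrable (fun q : Torus d × Vel d => (ψ q.1 : ℂ) * (UnitAddTorus.mFourier l q.1
      * (phase a (fun j => -(τ * l j)) q.2 * (U q.1 q.2 : ℂ)))) := by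
    refine Integrable.bdd_mul (c := B) ?_
      (Complex.continuous_ofReal.comp (cψ.comp continuous_fst)).aestronglyMeasurable ?_
    · have := integrable_osc ha hUint (-l) (fun j => -(τ * l j))
      simpa using this
    · refine Filter.Eventually.of_forall fun q => ?_
      simpa using hB q.1
  -- Moving `∂_{x_i}` from `U ψ` onto the character of frequency `l` produces the factor `2πi l_i`:
  -- this is the derivative that has to be won back in time.
  have h2 : fourierCoef (fun y => ∫ v, ((dxMul i U ψ (y + toTorus (τ • a v)) v : ℝ) : ℂ)) (-l)
      = -(2 * Real.pi * Complex.I * l i) * ∫ x, (ψ x : ℂ) * (UnitAddTorus.mFourier l x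
        * ∫ v, phase a (fun j => -(τ * l j)) v * (U x v : ℂ)) := by
    rw [fourierCoef, neg_neg, ← h1]
    have e1 : ∫ x, (ψ x : ℂ) * (UnitAddTorus.mFourier l x
        * ∫ v, phase a (fun j => -(τ * l j)) v * (U x v : ℂ))
        = ∫ q : Torus d × Vel d, (ψ q.1 : ℂ) * (UnitAddTorus.mFourier l q.1
      * (phase a (fun j => -(τ * l j)) q.2 * (U q.1 q.2 : ℂ))) := by
      rw [Measure.volume_eq_prod] at hbdd ⊢
      rw [integral_prod _ hbdd]
      simp only [integral_const_mul]
    rw [e1]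
    rw [Measure.volume_eq_prod] at hbdd hi1 ⊢
    rw [integral_prod_symm _ hbdd, integral_prod_symm _ hi1, ← integral_const_mul]
    refine integral_congr_ae (Filter.Eventually.of_forall fun v => ?_)
    simp only [mFourier_transport]
    have hs : ContDiff ℝ 1 (fun z => (fun y => U y v * ψ y) (toTorus z)) := by
      have h := hU1.slice_left v
      norm_cast at h
      exact h.mul hψ
    have h3 := integral_mFourier_mul_torusDeriv l i (f := fun y => U y v * ψ y) hs
    calc _ = ∫ x, phase a (fun j => -(τ * l j)) v
          * (UnitAddTorus.mFourier l x * (torusDeriv i (fun y => U y v * ψ y) x : ℂ)) := by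
          refine integral_congr_ae (Filter.Eventually.of_forall fun x => ?_)
          simp only [Complex.real_smul, dxMul]
          ring
      _ = _ := by
          rw [integral_const_mul, h3, mul_left_comm, ← integral_const_mul]
          congr 1
          refine integral_congr_ae (Filter.Eventually.of_forall fun x => ?_)
          push_cast
          ring
  -- Parseval
  have hG : MemLp (fun x => ∫ v, UnitAddTorus.mFourier l x
      * (phase a (fun j => -(τ * l j)) v * (U x v : ℂ))) 2 volume := by
    refine memLp_velocity_average hr (F := fun x v => UnitAddTorus.mFourier l x
      * (phase a (fun j => -(τ * l j)) v * (U x v : ℂ))) ?_ ?_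
    · refine Continuous.stronglyMeasurable ?_
      have := cF l
      fun_prop
    · rw [weightedSq_eq cU.measurable] at hUfin
      refine lt_of_eq_of_lt (lintegral_congr fun q => ?_) hUfin
      simp [← ofReal_norm, norm_mFourier_apply, norm_phase]
  have hψ2 : MemLp (fun x => (ψ x : ℂ)) 2 volume := memLp_of_continuous (by fun_prop)
  have h4 := enorm_integral_mul_le hψ2 hG
  simp only [integral_const_mul] at h4
  rw [h2, enorm_mul]
  refine mul_le_mul' ?_ (h4.trans (le_of_eq (tsum_congr fun m => ?_)))
  · rw [← ofReal_norm]
    refine ENNReal.ofReal_le_ofReal ?_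
    have := norm_le_pi_norm l i
    simp only [norm_neg, norm_mul, Complex.norm_real, Complex.norm_I, Complex.norm_intCast,
      Complex.norm_ofNat, mul_one, Real.norm_eq_abs, abs_of_pos Real.pi_pos]
    rw [Int.norm_eq_abs] at this
    gcongr
  · congr 2
    -- The characters of frequencies `m` and `l` multiply, so the coefficient at `-m` is an
    -- oscillating integral of `U` at the position frequency `-(m + l)`.
    have hi2 := integrable_osc ha hUint (-(m + l)) (fun j => -(τ * l j))
    simp only [osc, fourierCoef, one_mul, neg_neg] at hi2 ⊢
    rw [Measure.volume_eq_prod] at hi2 ⊢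
    rw [integral_prod _ hi2]
    refine integral_congr_ae (Filter.Eventually.of_forall fun x => ?_)
    simp only [integral_const_mul, UnitAddTorus.mFourier_add]
    ring

/-- The averaging form at fixed times, bounded by Fourier coefficients. -/
theorem enorm_integral_transport_le (hr : (d : ℝ) / 2 < r) (ha : Continuous a) (hN : N ≠ ⊤)
    (hk : 1 ≤ k) (hU : WeightedBound r k N U) (hψ : ContDiff ℝ 1 (fun z => ψ (toTorus z)))
    (i : Fin d) (τ : ℝ) {h : Torus d → ℝ} (hh : StronglyMeasurable h)
    (h2 : ∫⁻ x, ‖h x‖ₑ ^ 2 < ⊤) :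
    ‖∫ q : Torus d × Vel d, h (q.1 - toTorus (τ • a q.2)) * dxMul i U ψ q.1 q.2‖ₑ
      ≤ ∑' l, ∑' m, ‖fourierCoef (fun x => (h x : ℂ)) l‖ₑ
          * ‖fourierCoef (fun x => (ψ x : ℂ)) m‖ₑ * (ENNReal.ofReal (2 * Real.pi * ‖l‖)
          * ‖osc a (fun _ => 1) U (-(m + l)) (fun j => -(τ * l j))‖ₑ) := by
  have hU1 : PhaseDiff 1 U := hU.phaseDiff.mono hk
  have hc : Measurable fun v => toTorus (τ • a v) :=
    (continuous_toTorus.comp (ha.const_smul τ)).measurable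
  have hFm := measurable_dxMul i hU1 hψ
  obtain ⟨B, hB, hB'⟩ := exists_bound_torus hψ i
  have hfin : weightedSq r (dxMul i U ψ) < ⊤ :=
    (weightedSq_dxMul_le i hU hk hψ hB hB').trans_lt
      (ENNReal.mul_lt_top ENNReal.ofReal_lt_top (by simp [hN.lt_top]))
  have hhc : StronglyMeasurable fun x => (h x : ℂ) :=
    Complex.continuous_ofReal.comp_stronglyMeasurable hh
  have h2c : ∫⁻ x, ‖(h x : ℂ)‖ₑ ^ 2 < ⊤ := by
    simpa [← ofReal_norm] using h2
  have h3 := integral_transport_mul hr hc hhc h2c hFm hfin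
  have e1 : ‖∫ q : Torus d × Vel d, h (q.1 - toTorus (τ • a q.2)) * dxMul i U ψ q.1 q.2‖ₑ
      = ‖∫ q : Torus d × Vel d, dxMul i U ψ q.1 q.2 • (h (q.1 - toTorus (τ • a q.2)) : ℂ)‖ₑ := by
    have e2 : ∀ q : Torus d × Vel d, dxMul i U ψ q.1 q.2 • (h (q.1 - toTorus (τ • a q.2)) : ℂ)
        = ((h (q.1 - toTorus (τ • a q.2)) * dxMul i U ψ q.1 q.2 : ℝ) : ℂ) := by
      intro q
      rw [Complex.real_smul]
      push_cast
      ring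
    simp only [e2]
    rw [integral_complex_ofReal, ← ofReal_norm, ← ofReal_norm, Complex.norm_real]
  rw [e1, h3]
  refine (enorm_integral_mul_le (memLp_two_of_lintegral hhc.aestronglyMeasurable h2c)
    (memLp_shear_average hr hc hFm hfin)).trans (ENNReal.tsum_le_tsum fun l => ?_)
  refine (mul_le_mul' le_rfl
    (enorm_fourierCoef_average_le hr ha hN hk hU hψ i τ l)).trans (le_of_eq ?_)
  rw [← ENNReal.tsum_mul_left, ← ENNReal.tsum_mul_left]
  refine tsum_congr fun m => ?_
  ring

end Slice

/-! ### The Schur test -/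

section Schur

variable {d : ℕ}

/-- The pairs of times `(t, s)` with `0 < s < t < T`. -/
def timeTriangle (T : ℝ) : Set (ℝ × ℝ) := {p | 0 < p.2 ∧ p.2 < p.1 ∧ p.1 < T}

theorem measurableSet_timeTriangle (T : ℝ) : MeasurableSet (timeTriangle T) :=
  (measurableSet_lt measurable_const measurable_snd).inter
    ((measurableSet_lt measurable_snd measurable_fst).inter
      (measurableSet_lt measurable_fst measurable_const))

/-- Lebesgue measure on `(0, T)`. -/
abbrev timeMeasure (T : ℝ) : Measure ℝ := volume.restrict (Set.Ioo 0 T)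

theorem restrict_timeTriangle_le (T : ℝ) :
    (volume : Measure (ℝ × ℝ)).restrict (timeTriangle T)
      ≤ (timeMeasure T).prod (timeMeasure T) := by
  rw [Measure.prod_restrict, ← Measure.volume_eq_prod]
  refine Measure.restrict_mono (fun p hp => ?_) le_rfl
  obtain ⟨h1, h2, h3⟩ := hp
  exact ⟨⟨h1.trans h2, h3⟩, ⟨h1, h2.trans h3⟩⟩

/-- For fixed `s` the difference `t - s` stays in `(0, ∞)`, so the `t`-integral is at most the whole
mass of `g`, whatever `T` is. -/
theorem lintegral_timeTriangle_left_le {T : ℝ} {f g : ℝ → ℝ≥0∞} (hf : Measurable f)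
    (hg : Measurable g) :
    ∫⁻ p in timeTriangle T, f p.2 * g (p.1 - p.2)
      ≤ (∫⁻ s, f s ∂timeMeasure T) * ∫⁻ τ in Set.Ioi 0, g τ := by
  have hg' : Measurable ((Set.Ioi (0 : ℝ)).indicator g) := hg.indicator measurableSet_Ioi
  calc _ ≤ ∫⁻ p in timeTriangle T, f p.2 * (Set.Ioi (0 : ℝ)).indicator g (p.1 - p.2) := by
        refine setLIntegral_mono' (measurableSet_timeTriangle T) fun p hp => ?_
        rw [Set.indicator_of_mem (Set.mem_Ioi.2 (sub_pos.2 hp.2.1))]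
    _ ≤ ∫⁻ p, f p.2 * (Set.Ioi (0 : ℝ)).indicator g (p.1 - p.2)
          ∂((timeMeasure T).prod (timeMeasure T)) :=
        lintegral_mono' (restrict_timeTriangle_le T) le_rfl
    _ = ∫⁻ s, f s * ∫⁻ t, (Set.Ioi (0 : ℝ)).indicator g (t - s) ∂timeMeasure T
          ∂timeMeasure T := by
        rw [lintegral_prod_symm _ (by fun_prop)]
        refine lintegral_congr fun s => ?_
        dsimp only
        rw [lintegral_const_mul _ (by fun_prop)]
    _ ≤ ∫⁻ s, f s * (∫⁻ τ in Set.Ioi 0, g τ) ∂timeMeasure T := by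
        refine lintegral_mono fun s => mul_le_mul' le_rfl ?_
        refine (lintegral_mono' Measure.restrict_le_self le_rfl).trans (le_of_eq ?_)
        rw [lintegral_sub_right_eq_self (μ := volume) _ s, lintegral_indicator measurableSet_Ioi]
    _ = _ := lintegral_mul_const _ hf

theorem lintegral_timeTriangle_right_le {T : ℝ} {f g : ℝ → ℝ≥0∞} (hf : Measurable f)
    (hg : Measurable g) :
    ∫⁻ p in timeTriangle T, f p.1 * g (p.1 - p.2)
      ≤ (∫⁻ t, f t ∂timeMeasure T) * ∫⁻ τ in Set.Ioi 0, g τ := by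
  have hg' : Measurable ((Set.Ioi (0 : ℝ)).indicator g) := hg.indicator measurableSet_Ioi
  calc _ ≤ ∫⁻ p in timeTriangle T, f p.1 * (Set.Ioi (0 : ℝ)).indicator g (p.1 - p.2) := by
        refine setLIntegral_mono' (measurableSet_timeTriangle T) fun p hp => ?_
        rw [Set.indicator_of_mem (Set.mem_Ioi.2 (sub_pos.2 hp.2.1))]
    _ ≤ ∫⁻ p, f p.1 * (Set.Ioi (0 : ℝ)).indicator g (p.1 - p.2)
          ∂((timeMeasure T).prod (timeMeasure T)) :=
        lintegral_mono' (restrict_timeTriangle_le T) le_rfl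
    _ = ∫⁻ t, f t * ∫⁻ s, (Set.Ioi (0 : ℝ)).indicator g (t - s) ∂timeMeasure T
          ∂timeMeasure T := by
        rw [lintegral_prod _ (by fun_prop)]
        refine lintegral_congr fun t => ?_
        dsimp only
        rw [lintegral_const_mul _ (by fun_prop)]
    _ ≤ ∫⁻ t, f t * (∫⁻ τ in Set.Ioi 0, g τ) ∂timeMeasure T := by
        refine lintegral_mono fun t => mul_le_mul' le_rfl ?_
        refine (lintegral_mono' Measure.restrict_le_self le_rfl).trans (le_of_eq ?_)
        rw [lintegral_sub_left_eq_self (μ := volume) _ t, lintegral_indicator measurableSet_Ioi]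
    _ = _ := lintegral_mul_const _ hf

/-- The spatial part of the Schur kernel. -/
def freqKernel (n : Fin d → ℤ) : ℝ≥0∞ := ENNReal.ofReal ((max 1 ‖n‖) ^ (-((d : ℝ) + 1 / 2)))

theorem tsum_freqKernel_add_left (l : Fin d → ℤ) :
    ∑' m : Fin d → ℤ, freqKernel (m + l) = freqMass d :=
  (Equiv.addRight l).tsum_eq (freqKernel (d := d))

theorem tsum_freqKernel_add_right (m : Fin d → ℤ) :
    ∑' l : Fin d → ℤ, freqKernel (m + l) = freqMass d :=
  (Equiv.addLeft m).tsum_eq (freqKernel (d := d))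

theorem mul_le_sq_add_sq (x y : ℝ≥0∞) : x * y ≤ x ^ 2 + y ^ 2 := by
  rcases le_total x y with h | h
  · exact (mul_le_mul' h le_rfl).trans (by rw [← sq]; exact le_add_self)
  · exact (mul_le_mul' le_rfl h).trans (by rw [← sq]; exact le_self_add)

/-- Schur test, from `X Y ≤ X² + Y²`. For the `X²` terms the kernel is summed over `m` and
integrated over `t`. For the `Y²` terms the integral over `s` comes first: it is at most `8` for
every `l`, after which the sum over `l` sees only the spatial kernel. -/
theorem lintegral_schur_le (T : ℝ) {X Y : (Fin d → ℤ) → ℝ → ℝ≥0∞} (hX : ∀ l, Measurable (X l))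
    (hY : ∀ m, Measurable (Y m)) :
    ∫⁻ p in timeTriangle T, ∑' l, ∑' m, X l p.2 * Y m p.1
        * (freqKernel (m + l) * timeKernel ‖l‖ (p.1 - p.2))
      ≤ 8 * freqMass d * ((∫⁻ s, ∑' l, X l s ^ 2 ∂timeMeasure T)
        + ∫⁻ t, ∑' m, Y m t ^ 2 ∂timeMeasure T) := by
  have hT := fun L : ℝ => measurable_timeKernel L
  have pt : ∀ p : ℝ × ℝ, (∑' l, ∑' m, X l p.2 * Y m p.1
        * (freqKernel (m + l) * timeKernel ‖l‖ (p.1 - p.2)))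
      ≤ (∑' l, freqMass d * (X l p.2 ^ 2 * timeKernel ‖l‖ (p.1 - p.2)))
        + ∑' m, ∑' l, freqKernel (m + l) * (Y m p.1 ^ 2 * timeKernel ‖l‖ (p.1 - p.2)) := by
    intro p
    calc _ ≤ ∑' l, ∑' m, (freqKernel (m + l) * (X l p.2 ^ 2 * timeKernel ‖l‖ (p.1 - p.2))
          + freqKernel (m + l) * (Y m p.1 ^ 2 * timeKernel ‖l‖ (p.1 - p.2))) := by
          refine ENNReal.tsum_le_tsum fun l => ENNReal.tsum_le_tsum fun m => ?_
          refine (mul_le_mul' (mul_le_sq_add_sq _ _) le_rfl).trans (le_of_eq (by ring))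
      _ = _ := by
          simp only [ENNReal.tsum_add]
          congr 1
          · refine tsum_congr fun l => ?_
            rw [ENNReal.tsum_mul_right, tsum_freqKernel_add_left]
          · exact ENNReal.tsum_comm
  have b1 : ∫⁻ p in timeTriangle T, ∑' l, freqMass d * (X l p.2 ^ 2
        * timeKernel ‖l‖ (p.1 - p.2))
      ≤ 8 * freqMass d * ∫⁻ s, ∑' l, X l s ^ 2 ∂timeMeasure T := by
    rw [lintegral_tsum fun l => by
        have := hX l; have := hT ‖l‖; exact Measurable.aemeasurable (by fun_prop),
      lintegral_tsum fun l => ((hX l).pow_const 2).aemeasurable, ← ENNReal.tsum_mul_left]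
    refine ENNReal.tsum_le_tsum fun l => ?_
    rw [lintegral_const_mul' _ _ (freqMass_lt_top d).ne]
    have h1 := lintegral_timeTriangle_left_le (T := T) ((hX l).pow_const 2) (hT ‖l‖)
    calc _ ≤ freqMass d * ((∫⁻ s, X l s ^ 2 ∂timeMeasure T) * 8) :=
          mul_le_mul' le_rfl (h1.trans
            (mul_le_mul' le_rfl (lintegral_timeKernel_le (norm_nonneg l))))
      _ = _ := by ring
  have b2 : ∫⁻ p in timeTriangle T, ∑' m, ∑' l, freqKernel (m + l) * (Y m p.1 ^ 2
        * timeKernel ‖l‖ (p.1 - p.2))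
      ≤ 8 * freqMass d * ∫⁻ t, ∑' m, Y m t ^ 2 ∂timeMeasure T := by
    have hm : ∀ m l : Fin d → ℤ, Measurable fun p : ℝ × ℝ =>
        freqKernel (m + l) * (Y m p.1 ^ 2 * timeKernel ‖l‖ (p.1 - p.2)) := by
      intro m l
      have := hY m
      have := hT ‖l‖
      fun_prop
    rw [lintegral_tsum fun m => (Measurable.tsum fun l => hm m l).aemeasurable,
      lintegral_tsum fun m => ((hY m).pow_const 2).aemeasurable, ← ENNReal.tsum_mul_left]
    refine ENNReal.tsum_le_tsum fun m => ?_
    rw [lintegral_tsum fun l => (hm m l).aemeasurable, ← tsum_freqKernel_add_right m,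
      mul_assoc, ← ENNReal.tsum_mul_right, ← ENNReal.tsum_mul_left]
    refine ENNReal.tsum_le_tsum fun l => ?_
    rw [lintegral_const_mul' (freqKernel (m + l)) _ ENNReal.ofReal_ne_top]
    have h1 := lintegral_timeTriangle_right_le (T := T) ((hY m).pow_const 2) (hT ‖l‖)
    calc _ ≤ freqKernel (m + l) * ((∫⁻ t, Y m t ^ 2 ∂timeMeasure T) * 8) :=
          mul_le_mul' le_rfl (h1.trans
            (mul_le_mul' le_rfl (lintegral_timeKernel_le (norm_nonneg l))))
      _ = _ := by ring
  refine (lintegral_mono pt).trans ?_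
  rw [lintegral_add_left (Measurable.tsum fun l => by
    have := hX l; have := hT ‖l‖; fun_prop), mul_add]
  exact add_le_add b1 b2

end Schur

/-! ### Boundedness of the averaging form on pairs of square integrable functions -/

section FormBound

variable {d : ℕ} {a : Vel d → Vel d} {lam σ : ℝ}

/-- The square of the norm of `L²(0, T; L²_x)`. -/
def sqL2 (T : ℝ) (H : ℝ → Torus d → ℝ) : ℝ≥0∞ := ∫⁻ s, ∫⁻ x, ‖H s x‖ₑ ^ 2 ∂volume ∂timeMeasure T

theorem measurable_fourierCoef {H : ℝ → Torus d → ℝ} (hH : StronglyMeasurable (Function.uncurry H))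
    (l : Fin d → ℤ) : Measurable fun s => ‖fourierCoef (fun x => (H s x : ℂ)) l‖ₑ := by
  have h1 : StronglyMeasurable fun p : ℝ × Torus d =>
      UnitAddTorus.mFourier (-l) p.2 * ((H p.1 p.2 : ℝ) : ℂ) := by
    have c1 : Continuous (UnitAddTorus.mFourier (-l)) := ContinuousMap.continuous _
    exact (c1.comp continuous_snd).stronglyMeasurable.mul
      (Complex.continuous_ofReal.comp_stronglyMeasurable hH)
  exact (StronglyMeasurable.integral_prod_right h1).measurable.enorm

theorem ae_lintegral_sq_lt_top {T : ℝ} {H : ℝ → Torus d → ℝ}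
    (hH : StronglyMeasurable (Function.uncurry H)) (h : sqL2 T H < ⊤) :
    ∀ᵐ s ∂timeMeasure T, ∫⁻ x, ‖H s x‖ₑ ^ 2 < ⊤ := by
  refine ae_lt_top ?_ h.ne
  exact Measurable.lintegral_prod_right' (f := fun p : ℝ × Torus d => ‖H p.1 p.2‖ₑ ^ 2)
    (hH.measurable.enorm.pow_const 2)

theorem tsum_enorm_fourierCoef_ofReal_sq {h : Torus d → ℝ} (hh : StronglyMeasurable h)
    (h2 : ∫⁻ x, ‖h x‖ₑ ^ 2 < ⊤) :
    ∑' l, ‖fourierCoef (fun x => (h x : ℂ)) l‖ₑ ^ 2 = ∫⁻ x, ‖h x‖ₑ ^ 2 := by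
  have e : ∀ x, ‖(h x : ℂ)‖ₑ = ‖h x‖ₑ := fun x => by simp [← ofReal_norm]
  rw [tsum_enorm_fourierCoef_sq]
  · simp only [e]
  · refine memLp_two_of_lintegral
      (Complex.continuous_ofReal.comp_stronglyMeasurable hh).aestronglyMeasurable ?_
    simpa only [e] using h2

theorem lintegral_tsum_fourierCoef_sq {T : ℝ} {H : ℝ → Torus d → ℝ}
    (hH : StronglyMeasurable (Function.uncurry H)) (h : sqL2 T H < ⊤) :
    ∫⁻ s, ∑' l, ‖fourierCoef (fun x => (H s x : ℂ)) l‖ₑ ^ 2 ∂timeMeasure T = sqL2 T H := by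
  refine lintegral_congr_ae ?_
  filter_upwards [ae_lintegral_sq_lt_top hH h] with s hs
  exact tsum_enorm_fourierCoef_ofReal_sq (hH.comp_measurable measurable_prodMk_left) hs

theorem ae_timeTriangle_snd {T : ℝ} {P : ℝ → Prop} (h : ∀ᵐ s ∂timeMeasure T, P s) :
    ∀ᵐ p ∂(volume : Measure (ℝ × ℝ)).restrict (timeTriangle T), P p.2 :=
  (Measure.absolutelyContinuous_of_le (restrict_timeTriangle_le T)).ae_le
    (Measure.quasiMeasurePreserving_snd.ae h)

/-- The Fourier bound at fixed times, the decay of `osc` at `ξ = -(t - s) l`, and the Schur test.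
The sum of squares is made into a product later, by scaling `φ`. -/
theorem exists_form_bound [Nonempty (Fin d)] {k : ℕ} (hk : d + 1 < k)
    (ha : IsAdvectionField a lam) (hlam : 0 ≤ lam) (hσ : (d : ℝ) / 2 < σ) :
    ∃ C : ℝ≥0, ∀ (T : ℝ) (U : ℝ → ℝ → Torus d → Vel d → ℝ) (N : ℝ≥0∞), N ≠ ⊤ →
      (∀ p ∈ timeTriangle T,
        WeightedBound (σ + (1 + lam) * ((d : ℝ) + k)) k N (U p.1 p.2)) →
      ∀ (i : Fin d) (H φ : ℝ → Torus d → ℝ), StronglyMeasurable (Function.uncurry H) →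
      sqL2 T H < ⊤ → StronglyMeasurable (Function.uncurry φ) → sqL2 T φ < ⊤ →
      (∀ t, ContDiff ℝ 1 fun z => φ t (toTorus z)) →
      ∫⁻ p in timeTriangle T, ‖∫ q : Torus d × Vel d,
          H p.2 (foot a p.1 p.2 q.1 q.2) * dxMul i (U p.1 p.2) (φ p.1) q.1 q.2‖ₑ
        ≤ C * N * (sqL2 T H + sqL2 T φ) := by
  obtain ⟨K, hK⟩ := exists_osc_decay hk ha hlam hσ
  set r := σ + (1 + lam) * ((d : ℝ) + k) with hr
  have hrd : (d : ℝ) / 2 < r := by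
    have : 0 ≤ (1 + lam) * ((d : ℝ) + k) := by positivity
    linarith
  have hfin : ENNReal.ofReal (2 * Real.pi) * K * (8 * freqMass d) ≠ ⊤ :=
    ENNReal.mul_ne_top (ENNReal.mul_ne_top ENNReal.ofReal_ne_top ENNReal.coe_ne_top)
      (ENNReal.mul_ne_top (by simp) (freqMass_lt_top d).ne)
  refine ⟨(ENNReal.ofReal (2 * Real.pi) * K * (8 * freqMass d)).toNNReal, ?_⟩
  intro T U N hN hU i H φ hH hH2 hφ hφ2 hφ1
  rw [ENNReal.coe_toNNReal hfin]
  set X : (Fin d → ℤ) → ℝ → ℝ≥0∞ := fun l s => ‖fourierCoef (fun x => (H s x : ℂ)) l‖ₑ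
  set Y : (Fin d → ℤ) → ℝ → ℝ≥0∞ := fun l s => ‖fourierCoef (fun x => (φ s x : ℂ)) l‖ₑ
  have hX : ∀ l, Measurable (X l) := measurable_fourierCoef hH
  have hY : ∀ l, Measurable (Y l) := measurable_fourierCoef hφ
  have hpt : ∀ᵐ p ∂(volume : Measure (ℝ × ℝ)).restrict (timeTriangle T),
      ‖∫ q : Torus d × Vel d,
          H p.2 (foot a p.1 p.2 q.1 q.2) * dxMul i (U p.1 p.2) (φ p.1) q.1 q.2‖ₑ
        ≤ ENNReal.ofReal (2 * Real.pi) * K * N * ∑' l, ∑' m, X l p.2 * Y m p.1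
        * (freqKernel (m + l) * timeKernel ‖l‖ (p.1 - p.2)) := by
    filter_upwards [ae_timeTriangle_snd (ae_lintegral_sq_lt_top hH hH2),
      ae_restrict_mem (measurableSet_timeTriangle T)] with p hp hpT
    refine (enorm_integral_transport_le hrd ha.smooth.continuous hN (by omega) (hU p hpT)
      (hφ1 p.1) i (p.1 - p.2) (h := H p.2) (hH.comp_measurable measurable_prodMk_left) hp).trans ?_
    rw [← ENNReal.tsum_mul_left]
    refine ENNReal.tsum_le_tsum fun l => ?_
    rw [← ENNReal.tsum_mul_left]
    refine ENNReal.tsum_le_tsum fun m => ?_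
    have hτ : 0 < p.1 - p.2 := sub_pos.2 hpT.2.1
    have h1 := hK N (U p.1 p.2) (-(m + l)) (fun j => -((p.1 - p.2) * l j)) hN (hU p hpT)
    have e1 : ‖fun j => -((p.1 - p.2) * (l j : ℝ))‖ = (p.1 - p.2) * ‖l‖ := by
      have : (fun j => -((p.1 - p.2) * (l j : ℝ))) = -((p.1 - p.2) • fun j => (l j : ℝ)) := by
        funext j; simp
      rw [this, norm_neg, norm_smul, Real.norm_eq_abs, abs_of_pos hτ]
      congr 1
    rw [e1, norm_neg] at h1
    -- The factor `|l|` joins the decay in `ξ` to form the time kernel; the decay in `m + l` is the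
    -- spatial kernel.
    have h2 : ENNReal.ofReal (2 * Real.pi * ‖l‖)
        * ‖osc a (fun _ => 1) (U p.1 p.2) (-(m + l)) (fun j => -((p.1 - p.2) * l j))‖ₑ
        ≤ ENNReal.ofReal (2 * Real.pi) * K * N
          * (freqKernel (m + l) * timeKernel ‖l‖ (p.1 - p.2)) := by
      rw [← ofReal_norm]
      refine (mul_le_mul' le_rfl (ENNReal.ofReal_le_ofReal h1)).trans (le_of_eq ?_)
      have e2 : ∀ A B : ℝ, 0 ≤ A → ENNReal.ofReal (2 * Real.pi * ‖l‖)
          * ENNReal.ofReal (K * N.toReal * (A * B)) = ENNReal.ofReal (2 * Real.pi) * K * N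
            * (ENNReal.ofReal A * ENNReal.ofReal (‖l‖ * B)) := by
        intro A B hA
        rw [ENNReal.ofReal_mul (p := 2 * Real.pi) (by positivity),
          ENNReal.ofReal_mul (p := K * N.toReal) (by positivity),
          ENNReal.ofReal_mul (p := (K : ℝ)) (by positivity), ENNReal.ofReal_mul hA,
          ENNReal.ofReal_mul (norm_nonneg l), ENNReal.ofReal_toReal hN, ENNReal.ofReal_coe_nnreal]
        ring
      exact e2 _ _ (by positivity)
    refine (mul_le_mul' le_rfl h2).trans (le_of_eq ?_)
    simp only [X, Y]
    ring
  have hc : ENNReal.ofReal (2 * Real.pi) * K * N ≠ ⊤ :=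
    ENNReal.mul_ne_top (ENNReal.mul_ne_top ENNReal.ofReal_ne_top ENNReal.coe_ne_top) hN
  refine (lintegral_mono_ae hpt).trans ?_
  rw [lintegral_const_mul' _ _ hc]
  refine (mul_le_mul' le_rfl (lintegral_schur_le T hX hY)).trans (le_of_eq ?_)
  rw [lintegral_tsum_fourierCoef_sq hH hH2, lintegral_tsum_fourierCoef_sq hφ hφ2]
  ring

end FormBound

/-! ### Fubini on the triangle -/

section Rearrange

variable {d : ℕ} {a : Vel d → Vel d}

/-- The rearrangement `((t, s), (x, v)) ↦ ((t, x), (s, v))`. -/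
def rearrange (d : ℕ) : (ℝ × ℝ) × (Torus d × Vel d) ≃ᵐ (ℝ × Torus d) × (ℝ × Vel d) where
  toFun q := ((q.1.1, q.2.1), (q.1.2, q.2.2))
  invFun p := ((p.1.1, p.2.1), (p.1.2, p.2.2))
  left_inv _ := rfl
  right_inv _ := rfl
  measurable_toFun := by
    change Measurable fun q : (ℝ × ℝ) × (Torus d × Vel d) => ((q.1.1, q.2.1), (q.1.2, q.2.2))
    fun_prop
  measurable_invFun := by
    change Measurable fun p : (ℝ × Torus d) × (ℝ × Vel d) => ((p.1.1, p.2.1), (p.1.2, p.2.2))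
    fun_prop

theorem rearrange_apply (q : (ℝ × ℝ) × (Torus d × Vel d)) :
    rearrange d q = ((q.1.1, q.2.1), (q.1.2, q.2.2)) := rfl

/-- The weak form is stated over `((t, x), (s, v))`, while the estimates are made over `(x, v)` at
fixed `(t, s)`. -/
theorem measurePreserving_rearrange (d : ℕ) : MeasurePreserving (rearrange d) volume volume := by
  refine ⟨(rearrange d).measurable, Measure.ext_of_lintegral _ fun f hf => ?_⟩
  rw [lintegral_map hf (rearrange d).measurable]
  have hf' : Measurable fun q : (ℝ × ℝ) × (Torus d × Vel d) => f (rearrange d q) :=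
    hf.comp (rearrange d).measurable
  calc _ = ∫⁻ p : ℝ × ℝ, ∫⁻ q : Torus d × Vel d, f ((p.1, q.1), (p.2, q.2)) := by
        rw [Measure.volume_eq_prod, lintegral_prod _ hf'.aemeasurable]
        rfl
    _ = ∫⁻ t : ℝ, ∫⁻ s : ℝ, ∫⁻ x : Torus d, ∫⁻ v : Vel d, f ((t, x), (s, v)) := by
        rw [Measure.volume_eq_prod ℝ ℝ, lintegral_prod]
        · refine lintegral_congr fun t => lintegral_congr fun s => ?_
          rw [Measure.volume_eq_prod, lintegral_prod]
          exact (hf.comp (f := fun q : Torus d × Vel d => ((t, q.1), (s, q.2)))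
            (by fun_prop)).aemeasurable
        · exact (Measurable.lintegral_prod_right' (f := fun q : (ℝ × ℝ) × (Torus d × Vel d) =>
            f ((q.1.1, q.2.1), (q.1.2, q.2.2))) hf').aemeasurable
    _ = ∫⁻ t : ℝ, ∫⁻ x : Torus d, ∫⁻ s : ℝ, ∫⁻ v : Vel d, f ((t, x), (s, v)) := by
        refine lintegral_congr fun t => ?_
        refine lintegral_lintegral_swap ?_
        have h1 : Measurable fun q : (ℝ × Torus d) × Vel d => f ((t, q.1.2), (q.1.1, q.2)) :=
          hf.comp (by fun_prop)
        exact (Measurable.lintegral_prod_right' h1).aemeasurable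
    _ = ∫⁻ p : ℝ × Torus d, ∫⁻ q : ℝ × Vel d, f (p, q) := by
        rw [Measure.volume_eq_prod ℝ (Torus d), lintegral_prod]
        · refine lintegral_congr fun t => lintegral_congr fun x => ?_
          rw [Measure.volume_eq_prod, lintegral_prod]
          exact (hf.comp measurable_prodMk_left).aemeasurable
        · exact (Measurable.lintegral_prod_right' hf).aemeasurable
    _ = _ := by
        rw [Measure.volume_eq_prod (ℝ × Torus d), lintegral_prod _ hf.aemeasurable]

/-- Lebesgue measure on `((t, s), (x, v))` with `0 < s < t < T`. -/
def sliceMeasure (d : ℕ) (T : ℝ) : Measure ((ℝ × ℝ) × (Torus d × Vel d)) :=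
  ((volume : Measure (ℝ × ℝ)).restrict (timeTriangle T)).prod volume

theorem measurableSet_triangle (d : ℕ) (T : ℝ) : MeasurableSet (triangle d T) :=
  (measurableSet_lt measurable_const measurable_snd.fst).inter
    ((measurableSet_lt measurable_snd.fst measurable_fst.fst).inter
      (measurableSet_lt measurable_fst.fst measurable_const))

theorem measurePreserving_triangle (d : ℕ) (T : ℝ) :
    MeasurePreserving (rearrange d) (sliceMeasure d T) (volume.restrict (triangle d T)) := by
  have h := (measurePreserving_rearrange d).restrict_preimage (measurableSet_triangle d T)
  have e : (rearrange d) ⁻¹' (triangle d T) = timeTriangle T ×ˢ Set.univ := by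
    ext q
    simp [triangle, timeTriangle, rearrange_apply]
  rw [e, Measure.volume_eq_prod, ← Measure.prod_restrict, Measure.restrict_univ] at h
  exact h

theorem ae_sliceMeasure_time {T : ℝ} {P : (ℝ × ℝ) → Prop} (h : ∀ p ∈ timeTriangle T, P p) :
    ∀ᵐ q ∂sliceMeasure d T, P q.1 :=
  Measure.quasiMeasurePreserving_fst.ae
    ((ae_restrict_iff' (measurableSet_timeTriangle T)).2 (Filter.Eventually.of_forall h))

theorem measurable_toTorus_smul (ha : Continuous a) (τ : ℝ) :
    Measurable fun v => toTorus (τ • a v) :=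
  (continuous_toTorus.comp (ha.const_smul τ)).measurable

theorem measurable_foot (ha : Continuous a) :
    Measurable fun q : (ℝ × ℝ) × (Torus d × Vel d) => foot a q.1.1 q.1.2 q.2.1 q.2.2 := by
  unfold foot
  exact Continuous.measurable (by fun_prop)

/-- At fixed times `(x, v) ↦ (foot, v)` is an inverse shear, so null sets pull back to null sets.
Hence `H` may be replaced by a measurable representative. -/
theorem ae_foot (ha : Continuous a) {T : ℝ} {P : ℝ × Torus d → Prop}
    (h : ∀ᵐ p ∂spaceTime d T, P p) :
    ∀ᵐ q ∂sliceMeasure d T, P (q.1.2, foot a q.1.1 q.1.2 q.2.1 q.2.2) := by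
  obtain ⟨G, hG, hGm, hGP⟩ := h.exists_measurable_mem
  have h1 : ∀ᵐ p ∂spaceTime d T, p ∈ G := hG
  have h2 : ∀ᵐ s ∂timeMeasure T, ∀ᵐ x ∂(volume : Measure (Torus d)), (s, x) ∈ G :=
    Measure.ae_ae_of_ae_prod h1
  have h3 : ∀ᵐ q ∂sliceMeasure d T, (q.1.2, foot a q.1.1 q.1.2 q.2.1 q.2.2) ∈ G := by
    have hm : MeasurableSet ((fun q : (ℝ × ℝ) × (Torus d × Vel d) =>
        (q.1.2, foot a q.1.1 q.1.2 q.2.1 q.2.2)) ⁻¹' G) :=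
      (Measurable.prodMk (by fun_prop) (measurable_foot ha)) hGm
    refine (Measure.ae_prod_mem_iff_ae_ae_mem hm).2 ?_
    filter_upwards [ae_timeTriangle_snd h2] with p hp
    have hc := measurable_toTorus_smul ha (p.1 - p.2)
    have h4 : ∀ᵐ q ∂(volume : Measure (Torus d × Vel d)), (p.2, q.1) ∈ G :=
      Measure.quasiMeasurePreserving_fst.ae hp
    exact ((measurePreserving_shear hc).symm _).quasiMeasurePreserving.ae h4
  filter_upwards [h3] with q hq using hGP _ hq

/-- `U` is jointly measurable but smooth only in `(x, v)`. The derivative is measurable in all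
variables as a limit of difference quotients with step `1 / (n + 1)`. -/
theorem aestronglyMeasurable_dxMul {T : ℝ} (i : Fin d) {U : ℝ → ℝ → Torus d → Vel d → ℝ}
    {φ : ℝ → Torus d → ℝ}
    (hUm : Measurable (fun p : ℝ × ℝ × Torus d × Vel d => U p.1 p.2.1 p.2.2.1 p.2.2.2))
    (hU : ∀ p ∈ timeTriangle T, PhaseDiff 1 (U p.1 p.2))
    (hφm : Measurable (Function.uncurry φ)) (hφ : ∀ t, ContDiff ℝ 1 fun z => φ t (toTorus z)) :
    AEStronglyMeasurable (fun q : (ℝ × ℝ) × (Torus d × Vel d) =>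
      dxMul i (U q.1.1 q.1.2) (φ q.1.1) q.2.1 q.2.2) (sliceMeasure d T) := by
  set G : Torus d → (ℝ × ℝ) × (Torus d × Vel d) → ℝ := fun e q =>
    U q.1.1 q.1.2 (q.2.1 + e) q.2.2 * φ q.1.1 (q.2.1 + e) with hG
  have hmeas : ∀ e : Torus d, Measurable (G e) := by
    intro e
    have h1 := hUm.comp (f := fun q : (ℝ × ℝ) × (Torus d × Vel d) =>
      (q.1.1, q.1.2, q.2.1 + e, q.2.2)) (by fun_prop)
    have h2 := hφm.comp (f := fun q : (ℝ × ℝ) × (Torus d × Vel d) => (q.1.1, q.2.1 + e))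
      (by fun_prop)
    exact h1.mul h2
  set e : ℝ → Torus d := fun h => Pi.single i (h : UnitAddCircle) with he
  have hm : ∀ n : ℕ, Measurable fun q =>
      (1 / ((n : ℝ) + 1))⁻¹ * (G (e (0 + 1 / ((n : ℝ) + 1))) q - G (e 0) q) := fun n =>
    ((hmeas (e (0 + 1 / ((n : ℝ) + 1)))).sub (hmeas (e 0))).const_mul _
  refine aestronglyMeasurable_of_tendsto_ae Filter.atTop
    (fun n => (hm n).aestronglyMeasurable) ?_
  filter_upwards [ae_sliceMeasure_time hU] with q hq
  have hs : ContDiff ℝ 1 (fun z => (fun y => U q.1.1 q.1.2 y q.2.2 * φ q.1.1 y) (toTorus z)) := by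
    have h := hq.slice_left q.2.2
    norm_cast at h
    exact h.mul (hφ q.1.1)
  have hd := hasDerivAt_torusDeriv (f := fun y => U q.1.1 q.1.2 y q.2.2 * φ q.1.1 y)
    (hs.differentiable one_ne_zero) i q.2.1
  have ht : Filter.Tendsto (fun n : ℕ => 1 / ((n : ℝ) + 1)) Filter.atTop
      (nhdsWithin 0 {0}ᶜ) := by
    refine tendsto_nhdsWithin_iff.2 ⟨tendsto_one_div_add_atTop_nhds_zero_nat, ?_⟩
    refine Filter.Eventually.of_forall fun n => ?_
    have : (0 : ℝ) < 1 / ((n : ℝ) + 1) := by positivity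
    exact this.ne'
  have h5 := hd.tendsto_slope_zero.comp ht
  simpa only [Function.comp_def, smul_eq_mul, hG, he, dxMul] using h5

variable {r : ℝ}

/-- Absolute convergence of the transported products on the triangle. -/
theorem integrable_slice (hr : (d : ℝ) / 2 < r) (ha : Continuous a) {T : ℝ} {h : ℝ → Torus d → ℝ}
    (hh : StronglyMeasurable (Function.uncurry h)) (h2 : sqL2 T h < ⊤)
    {F : ℝ → ℝ → Torus d → Vel d → ℝ}
    (hF : AEStronglyMeasurable (fun q : (ℝ × ℝ) × (Torus d × Vel d) =>
      F q.1.1 q.1.2 q.2.1 q.2.2) (sliceMeasure d T))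
    (hFm : ∀ p ∈ timeTriangle T, Measurable fun q : Torus d × Vel d => F p.1 p.2 q.1 q.2)
    {M : ℝ≥0∞} (hM : M < ⊤) (hFr : ∀ p ∈ timeTriangle T, weightedSq r (F p.1 p.2) ≤ M) :
    Integrable (fun q : (ℝ × ℝ) × (Torus d × Vel d) =>
      h q.1.2 (foot a q.1.1 q.1.2 q.2.1 q.2.2) * F q.1.1 q.1.2 q.2.1 q.2.2)
      (sliceMeasure d T) := by
  have hhm : StronglyMeasurable fun q : (ℝ × ℝ) × (Torus d × Vel d) =>
      h q.1.2 (foot a q.1.1 q.1.2 q.2.1 q.2.2) :=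
    hh.comp_measurable (Measurable.prodMk (by fun_prop) (measurable_foot ha))
  have hsm : AEStronglyMeasurable (fun q : (ℝ × ℝ) × (Torus d × Vel d) =>
      h q.1.2 (foot a q.1.1 q.1.2 q.2.1 q.2.2) * F q.1.1 q.1.2 q.2.1 q.2.2)
      (sliceMeasure d T) := hhm.aestronglyMeasurable.mul hF
  refine ⟨hsm, ?_⟩
  unfold HasFiniteIntegral
  have hS : Measurable fun s => ∫⁻ x, ‖h s x‖ₑ ^ 2 :=
    Measurable.lintegral_prod_right' (f := fun p : ℝ × Torus d => ‖h p.1 p.2‖ₑ ^ 2)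
      (hh.measurable.enorm.pow_const 2)
  have h1 : ∀ p ∈ timeTriangle T, ∫⁻ q : Torus d × Vel d,
      ‖h p.2 (foot a p.1 p.2 q.1 q.2) * F p.1 p.2 q.1 q.2‖ₑ
        ≤ (1 + tailMass d r * ∫⁻ x, ‖h p.2 x‖ₑ ^ 2) * M ^ (1 / 2 : ℝ) := by
    intro p hp
    have h3 := lintegral_transport_mul_le (r := r) (h := h p.2)
      (measurable_toTorus_smul ha (p.1 - p.2))
      (hh.comp_measurable measurable_prodMk_left) (hFm p hp)
    simp only [enorm_mul]
    refine h3.trans (mul_le_mul' ?_ (ENNReal.rpow_le_rpow (hFr p hp) (by norm_num)))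
    set x := tailMass d r * ∫⁻ x, ‖h p.2 x‖ₑ ^ 2
    -- From `√x ≤ 1 + x`, the square norms of the slices of `h` control the integral over the
    -- bounded triangle.
    rcases le_total x 1 with hx | hx
    · exact (ENNReal.rpow_le_one hx (by norm_num)).trans le_self_add
    · refine le_trans ?_ le_add_self
      exact (ENNReal.rpow_le_rpow_of_exponent_le hx (by norm_num : (1 / 2 : ℝ) ≤ 1)).trans
        (ENNReal.rpow_one x).le
  have htri : ∫⁻ p in timeTriangle T, (1 + tailMass d r * ∫⁻ x, ‖h p.2 x‖ₑ ^ 2) < ⊤ := by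
    refine (lintegral_mono' (restrict_timeTriangle_le T) le_rfl).trans_lt ?_
    have hS2 : Measurable fun p : ℝ × ℝ => ∫⁻ x, ‖h p.2 x‖ₑ ^ 2 := hS.comp measurable_snd
    rw [lintegral_add_left measurable_const, lintegral_const_mul' _ _ (tailMass_lt_top hr).ne,
      lintegral_prod _ hS2.aemeasurable]
    refine ENNReal.add_lt_top.2 ⟨?_, ENNReal.mul_lt_top (tailMass_lt_top hr) ?_⟩
    · rw [lintegral_one]
      exact measure_lt_top _ _
    · dsimp only
      rw [lintegral_const]
      exact ENNReal.mul_lt_top h2 (measure_lt_top _ _)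
  unfold sliceMeasure at hsm ⊢
  rw [lintegral_prod _ hsm.enorm]
  refine (setLIntegral_mono' (measurableSet_timeTriangle T) h1).trans_lt ?_
  have hM' : M ^ (1 / 2 : ℝ) ≠ ⊤ := (ENNReal.rpow_lt_top_of_nonneg (by norm_num) hM.ne).ne
  rw [lintegral_mul_const' _ _ hM']
  exact ENNReal.mul_lt_top htri hM'.lt_top

end Rearrange

/-! ### Test functions and square integrable functions -/

section Test

variable {d : ℕ} {T : ℝ} {φ ψ : ℝ → Torus d → ℝ}

theorem IsTest.continuous (hφ : IsTest T φ) : Continuous (Function.uncurry φ) :=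
  (IsOpenQuotientMap.id.prodMap isOpenQuotientMap_toTorus).isQuotientMap.continuous_iff.2
    hφ.smooth.continuous

theorem IsTest.slice (hφ : IsTest T φ) (t : ℝ) : ContDiff ℝ 1 fun z => φ t (toTorus z) :=
  (ContDiff.comp (g := fun p : ℝ × Vel d => φ p.1 (toTorus p.2)) hφ.smooth
    (contDiff_const.prodMk contDiff_id)).of_le (by simp)

theorem IsTest.exists_bound (hφ : IsTest T φ) (i : Fin d) :
    ∃ B, ∀ t x, |φ t x| ≤ B ∧ |torusDeriv i (φ t) x| ≤ B := by
  have hd : Differentiable ℝ (fun p : ℝ × Vel d => φ p.1 (toTorus p.2)) :=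
    hφ.smooth.differentiable (by simp)
  have e : (fun p : ℝ × Vel d => torusDeriv i (φ p.1) (toTorus p.2))
      = fun p => fderiv ℝ (fun p : ℝ × Vel d => φ p.1 (toTorus p.2)) p
        (0, EuclideanSpace.single i 1) := by
    funext p
    have h1 : HasFDerivAt (fun z => φ p.1 (toTorus z))
        ((fderiv ℝ (fun p : ℝ × Vel d => φ p.1 (toTorus p.2)) p).comp
          (ContinuousLinearMap.inr ℝ ℝ (Vel d))) p.2 :=
      HasFDerivAt.comp (g := fun p : ℝ × Vel d => φ p.1 (toTorus p.2))
        (f := fun z => (p.1, z)) p.2 (hd p).hasFDerivAt (hasFDerivAt_prodMk_right p.1 p.2)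
    exact (hasDerivAt_torus h1 i).deriv
  have c2 : Continuous fun p : ℝ × Torus d => torusDeriv i (φ p.1) p.2 := by
    refine (IsOpenQuotientMap.id.prodMap
      isOpenQuotientMap_toTorus).isQuotientMap.continuous_iff.2 ?_
    change Continuous (fun p : ℝ × Vel d => torusDeriv i (φ p.1) (toTorus p.2))
    rw [e]
    exact ((hφ.smooth.fderiv_right (m := ∞) (by simp)).clm_apply contDiff_const).continuous
  have hK : IsCompact (Set.Icc (0 : ℝ) T ×ˢ (Set.univ : Set (Torus d))) :=
    isCompact_Icc.prod isCompact_univ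
  obtain ⟨B1, h1⟩ := hK.exists_bound_of_continuousOn hφ.continuous.continuousOn
  obtain ⟨B2, h2⟩ := hK.exists_bound_of_continuousOn c2.continuousOn
  refine ⟨max (max B1 B2) 0, fun t x => ?_⟩
  by_cases ht : t ∈ Set.Icc (0 : ℝ) T
  · exact ⟨((h1 (t, x) ⟨ht, trivial⟩).trans (le_max_left _ _)).trans (le_max_left _ _),
      ((h2 (t, x) ⟨ht, trivial⟩).trans (le_max_right _ _)).trans (le_max_left _ _)⟩
  · obtain ⟨ε, hε, h0⟩ := hφ.support
    have hz : ∀ y, φ t y = 0 := by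
      intro y
      refine h0 t y ?_
      by_contra hcon
      push Not at hcon
      exact ht ⟨by linarith [hcon.1], by linarith [hcon.2]⟩
    have : torusDeriv i (φ t) x = 0 := by simp [torusDeriv, hz]
    simp [hz, this]

theorem IsTest.add (hφ : IsTest T φ) (hψ : IsTest T ψ) : IsTest T (fun t x => φ t x + ψ t x) := by
  refine ⟨hφ.smooth.add hψ.smooth, ?_⟩
  obtain ⟨ε, hε, h1⟩ := hφ.support
  obtain ⟨δ, hδ, h2⟩ := hψ.support
  refine ⟨min ε δ, lt_min hε hδ, fun t x ht => ?_⟩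
  rw [h1 t x, h2 t x, add_zero]
  · rcases ht with ht | ht
    · exact Or.inl (ht.trans_le (min_le_right _ _))
    · exact Or.inr (by linarith [min_le_right ε δ])
  · rcases ht with ht | ht
    · exact Or.inl (ht.trans_le (min_le_left _ _))
    · exact Or.inr (by linarith [min_le_left ε δ])

theorem IsTest.const_mul (hφ : IsTest T φ) (c : ℝ) : IsTest T (fun t x => c * φ t x) := by
  obtain ⟨ε, hε, h1⟩ := hφ.support
  exact ⟨contDiff_const.mul hφ.smooth, ε, hε, fun t x ht => by rw [h1 t x ht, mul_zero]⟩

instance (d : ℕ) (T : ℝ) : IsFiniteMeasure (spaceTime d T) := by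
  unfold spaceTime
  infer_instance

theorem IsTest.memL2 (hφ : IsTest T φ) : MemL2 T φ := by
  have hK : IsCompact (Set.Icc (0 : ℝ) T ×ˢ (Set.univ : Set (Torus d))) :=
    isCompact_Icc.prod isCompact_univ
  obtain ⟨B, hB⟩ := hK.exists_bound_of_continuousOn hφ.continuous.continuousOn
  refine MemLp.of_bound hφ.continuous.aestronglyMeasurable B ?_
  have : ∀ᵐ t ∂timeMeasure T, t ∈ Set.Icc (0 : ℝ) T := by
    filter_upwards [ae_restrict_mem measurableSet_Ioo] with t ht using Set.Ioo_subset_Icc_self ht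
  have h2 : ∀ᵐ p ∂spaceTime d T, p.1 ∈ Set.Icc (0 : ℝ) T :=
    Measure.quasiMeasurePreserving_fst.ae this
  filter_upwards [h2] with p hp using hB p ⟨hp, trivial⟩

theorem lintegral_spaceTime {H : ℝ → Torus d → ℝ}
    (hH : StronglyMeasurable (Function.uncurry H)) :
    ∫⁻ p, ‖Function.uncurry H p‖ₑ ^ 2 ∂spaceTime d T = sqL2 T H := by
  unfold spaceTime
  rw [lintegral_prod _ (hH.measurable.enorm.pow_const 2).aemeasurable]
  rfl

theorem normL2_sq {H : ℝ → Torus d → ℝ} (hH : StronglyMeasurable (Function.uncurry H)) :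
    normL2 T H ^ 2 = sqL2 T H := by
  rw [normL2, eLpNorm_eq_lintegral_rpow_enorm_toReal two_ne_zero (by simp),
    ← lintegral_spaceTime hH, ← ENNReal.rpow_natCast, ← ENNReal.rpow_mul]
  simp

end Test

/-! ### Functions are determined by their integrals against test functions -/

section Uniqueness

variable {d : ℕ} {T : ℝ}

/-- `g ↦ ∫ f g` is continuous for the uniform norm and vanishes on trigonometric polynomials, which
are dense. -/
theorem integral_mul_continuous_eq_zero {f : Torus d → ℝ} (hf : Integrable f)
    (h : ∀ l : Fin d → ℤ, ∫ x, (f x : ℂ) * UnitAddTorus.mFourier l x = 0)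
    (g : C(Torus d, ℂ)) : ∫ x, (f x : ℂ) * g x = 0 := by
  have hi : ∀ g : C(Torus d, ℂ), Integrable fun x => (f x : ℂ) * g x := fun g =>
    hf.ofReal.mul_bdd (c := ‖g‖) g.continuous.aestronglyMeasurable
      (Filter.Eventually.of_forall fun x => g.norm_coe_le_norm x)
  let L : C(Torus d, ℂ) →L[ℂ] ℂ := LinearMap.mkContinuous
    { toFun := fun g => ∫ x, (f x : ℂ) * g x
      map_add' := fun g₁ g₂ => by
        rw [← integral_add (hi g₁) (hi g₂)]
        simp [mul_add]
      map_smul' := fun c g => by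
        rw [RingHom.id_apply, smul_eq_mul, ← integral_const_mul]
        simp [mul_left_comm] } (∫ x, ‖f x‖) (fun g => by
        rw [← integral_mul_const]
        refine (norm_integral_le_integral_norm _).trans
          (integral_mono (hi g).norm (hf.norm.mul_const _) fun x => ?_)
        simp only [norm_mul, Complex.norm_real]
        exact mul_le_mul_of_nonneg_left (g.norm_coe_le_norm x) (norm_nonneg _))
  have h1 : Submodule.span ℂ (Set.range (UnitAddTorus.mFourier (d := Fin d))) ≤
      LinearMap.ker (L : C(Torus d, ℂ) →ₗ[ℂ] ℂ) := by
    rw [Submodule.span_le]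
    rintro _ ⟨l, rfl⟩
    exact h l
  have h2 := Submodule.topologicalClosure_minimal _ h1 L.isClosed_ker
  rw [UnitAddTorus.span_mFourier_closure_eq_top] at h2
  exact h2 (Submodule.mem_top (x := g))

/-- As `f` is only integrable, Parseval is not available. Instead the finite measures of densities
`f⁺` and `f⁻` agree on continuous functions, hence coincide, and `f⁺ = f⁻` forces `f = 0`. -/
theorem ae_eq_zero_of_fourier {f : Torus d → ℝ} (hf : Integrable f)
    (h : ∀ l : Fin d → ℤ, ∫ x, (f x : ℂ) * UnitAddTorus.mFourier l x = 0) : f =ᵐ[volume] 0 := by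
  have hfm := hf.aestronglyMeasurable.aemeasurable
  have hfm' : AEMeasurable (fun x => -f x) volume := hfm.neg
  have : IsFiniteMeasure (volume.withDensity fun x => ENNReal.ofReal (f x)) :=
    isFiniteMeasure_withDensity_ofReal hf.2
  have : IsFiniteMeasure (volume.withDensity fun x => ENNReal.ofReal (-f x)) :=
    isFiniteMeasure_withDensity_ofReal hf.neg.2
  have key : (volume.withDensity fun x => ENNReal.ofReal (f x))
      = volume.withDensity fun x => ENNReal.ofReal (-f x) := by
    refine ext_of_forall_integral_eq_of_IsFiniteMeasure fun g => ?_
    have hg : ∀ {u : Torus d → ℝ}, Integrable u → Integrable fun x => u x * g x := fun hu =>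
      hu.mul_bdd (c := ‖g‖) g.continuous.aestronglyMeasurable
        (Filter.Eventually.of_forall fun x => g.norm_coe_le_norm x)
    rw [integral_withDensity_eq_integral_toReal_smul₀ hfm.ennreal_ofReal
        (Filter.Eventually.of_forall fun x => ENNReal.ofReal_lt_top),
      integral_withDensity_eq_integral_toReal_smul₀ hfm'.ennreal_ofReal
        (Filter.Eventually.of_forall fun x => ENNReal.ofReal_lt_top), ← sub_eq_zero]
    simp only [ENNReal.toReal_ofReal', smul_eq_mul]
    rw [← integral_sub (hg hf.pos_part) (hg hf.neg_part)]
    have h0 := integral_mul_continuous_eq_zero hf h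
      ⟨fun x => (g x : ℂ), Complex.continuous_ofReal.comp g.continuous⟩
    have h1 : ∫ x, f x * g x = 0 := by
      have e : ∀ x, (f x : ℂ) * (g x : ℂ) = ((f x * g x : ℝ) : ℂ) := fun x => by push_cast; rfl
      simp only [ContinuousMap.coe_mk, e] at h0
      rw [integral_complex_ofReal] at h0
      exact_mod_cast h0
    refine Eq.trans (integral_congr_ae (Filter.Eventually.of_forall fun x => ?_)) h1
    simp only
    rw [← sub_mul]
    congr 1
    rcases le_total (f x) 0 with hx | hx
    · rw [max_eq_right hx, max_eq_left (by linarith)]; ring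
    · rw [max_eq_left hx, max_eq_right (by linarith)]; ring
  have h2 := (withDensity_eq_iff hfm.ennreal_ofReal hfm'.ennreal_ofReal
    hf.lintegral_lt_top.ne).1 key
  filter_upwards [h2] with x hx
  simp only [Pi.zero_apply]
  rcases le_total (f x) 0 with h3 | h3
  · rw [ENNReal.ofReal_of_nonpos h3, eq_comm, ENNReal.ofReal_eq_zero] at hx
    linarith
  · rw [ENNReal.ofReal_of_nonpos (neg_nonpos.2 h3), ENNReal.ofReal_eq_zero] at hx
    linarith

theorem isTest_mul {χ : ℝ → ℝ} (hχ : ContDiff ℝ ∞ χ) (hc : HasCompactSupport χ)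
    (hs : tsupport χ ⊆ Set.Ioo 0 T) {f : Torus d → ℝ}
    (hf : ContDiff ℝ ∞ fun z => f (toTorus z)) : IsTest T (fun t x => χ t * f x) := by
  refine ⟨(hχ.comp contDiff_fst).mul (hf.comp contDiff_snd), ?_⟩
  -- A closed thickening of the support still lies in `(0, T)`; its width is the margin that a test
  -- function must keep from the ends.
  obtain ⟨δ, hδ, h⟩ := hc.isCompact.exists_cthickening_subset_open isOpen_Ioo hs
  refine ⟨δ, hδ, fun t x ht => ?_⟩
  have : χ t = 0 := by
    by_contra h0
    have hmem : t ∈ tsupport χ := subset_tsupport _ h0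
    rcases ht with ht | ht
    · have h1 : t - δ ∈ Metric.cthickening δ (tsupport χ) :=
        Metric.mem_cthickening_of_dist_le _ t _ _ hmem (by simp [abs_of_pos hδ])
      linarith [(h h1).1]
    · have h1 : t + δ ∈ Metric.cthickening δ (tsupport χ) :=
        Metric.mem_cthickening_of_dist_le _ t _ _ hmem (by simp [abs_of_pos hδ])
      linarith [(h h1).2]
  rw [this, zero_mul]

theorem contDiff_mFourier_toTorus (l : Fin d → ℤ) :
    ContDiff ℝ ∞ fun z : Vel d => UnitAddTorus.mFourier l (toTorus z) := by
  have e : (fun z : Vel d => UnitAddTorus.mFourier l (toTorus z)) = _ :=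
    funext fun z => mFourier_toTorus l z
  rw [e]
  have h : ContDiff ℝ ∞ fun z : Vel d => ∑ j, (l j : ℝ) * z j := ContDiff.sum fun j _ =>
    contDiff_const.mul (EuclideanSpace.proj j : Vel d →L[ℝ] ℝ).contDiff
  exact ContDiff.cexp (contDiff_const.mul (Complex.ofRealCLM.contDiff.comp h))

/-- Testing with `χ(t)` times the real and imaginary parts of a character shows that each Fourier
coefficient of `u(t, ·)` vanishes for almost every `t`. There are countably many frequencies, so one
null set of times serves all, and Fourier uniqueness applies on each slice. -/
theorem ae_eq_zero_of_isTest {u : ℝ × Torus d → ℝ} (hu : Integrable u (spaceTime d T))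
    (h : ∀ φ, IsTest T φ → ∫ p, u p * φ p.1 p.2 ∂spaceTime d T = 0) :
    u =ᵐ[spaceTime d T] 0 := by
  have hul : ∀ l : Fin d → ℤ, Integrable (fun p : ℝ × Torus d =>
      (u p : ℂ) * UnitAddTorus.mFourier l p.2) (spaceTime d T) := by
    intro l
    have c1 : Continuous (UnitAddTorus.mFourier l) := ContinuousMap.continuous _
    exact hu.ofReal.mul_bdd (c := 1) (c1.comp continuous_snd).aestronglyMeasurable
      (Filter.Eventually.of_forall fun p => (norm_mFourier_apply l p.2).le)
  have hcoef : ∀ l : Fin d → ℤ, ∀ᵐ t ∂timeMeasure T,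
      ∫ x, (u (t, x) : ℂ) * UnitAddTorus.mFourier l x = 0 := by
    intro l
    have hint : Integrable (fun t => ∫ x, (u (t, x) : ℂ) * UnitAddTorus.mFourier l x)
        (timeMeasure T) := (hul l).integral_prod_left
    have h1 := isOpen_Ioo.ae_eq_zero_of_integral_contDiff_smul_eq_zero
      (U := Set.Ioo 0 T) (μ := volume)
      (f := fun t => ∫ x, (u (t, x) : ℂ) * UnitAddTorus.mFourier l x)
      (IntegrableOn.locallyIntegrableOn hint) ?_
    · exact (ae_restrict_iff' measurableSet_Ioo).2 h1
    · intro χ hχ hc hs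
      obtain ⟨B, hB⟩ := hc.exists_bound_of_continuous hχ.continuous
      have hre := h _ (isTest_mul (d := d) hχ hc hs
        (f := fun x => (UnitAddTorus.mFourier l x).re)
        (Complex.reCLM.contDiff.comp (contDiff_mFourier_toTorus l)))
      have him := h _ (isTest_mul (d := d) hχ hc hs
        (f := fun x => (UnitAddTorus.mFourier l x).im)
        (Complex.imCLM.contDiff.comp (contDiff_mFourier_toTorus l)))
      have hfull : Integrable (fun p : ℝ × Torus d =>
          (χ p.1 : ℂ) * ((u p : ℂ) * UnitAddTorus.mFourier l p.2)) (spaceTime d T) := by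
        refine (hul l).bdd_mul (c := B) (Complex.continuous_ofReal.comp
          (hχ.continuous.comp continuous_fst)).aestronglyMeasurable
          (Filter.Eventually.of_forall fun p => ?_)
        simpa using hB p.1
      have hzero : ∫ p : ℝ × Torus d, (χ p.1 : ℂ) * ((u p : ℂ) * UnitAddTorus.mFourier l p.2)
          ∂spaceTime d T = 0 := by
        apply Complex.ext
        · rw [← Complex.reCLM_apply, ← ContinuousLinearMap.integral_comp_comm _ hfull,
            Complex.zero_re, ← hre]
          refine integral_congr_ae (Filter.Eventually.of_forall fun p => ?_)
          simp
          ring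
        · rw [← Complex.imCLM_apply, ← ContinuousLinearMap.integral_comp_comm _ hfull,
            Complex.zero_im, ← him]
          refine integral_congr_ae (Filter.Eventually.of_forall fun p => ?_)
          simp
          ring
      unfold spaceTime at hzero hfull
      rw [integral_prod _ hfull] at hzero
      simp only [integral_const_mul] at hzero
      rw [← hzero, eq_comm]
      refine Eq.trans (setIntegral_eq_integral_of_forall_compl_eq_zero fun t ht => ?_)
        (integral_congr_ae (Filter.Eventually.of_forall fun t => ?_))
      · have : χ t = 0 := by
          by_contra h0
          exact ht (hs (subset_tsupport _ h0))
        simp [this]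
      · simp
  have hzero : ∀ᵐ t ∂timeMeasure T, ∫⁻ x, ‖u (t, x)‖ₑ = 0 := by
    unfold spaceTime at hu
    filter_upwards [ae_all_iff.2 hcoef, hu.prod_right_ae] with t ht hti
    have h2 := ae_eq_zero_of_fourier hti ht
    rw [lintegral_congr_ae (g := fun _ => 0)]
    · simp
    · filter_upwards [h2] with x hx
      simp only [Pi.zero_apply] at hx
      simp [hx]
  have h3 : ∫⁻ p, ‖u p‖ₑ ∂spaceTime d T = 0 := by
    have hm := hu.aestronglyMeasurable.enorm
    unfold spaceTime at hm ⊢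
    rw [lintegral_prod _ hm, lintegral_congr_ae hzero]
    simp
  have h4 := (lintegral_eq_zero_iff' hu.aestronglyMeasurable.enorm).1 h3
  filter_upwards [h4] with p hp
  simpa using hp

end Uniqueness

/-! ### Representation of bounded functionals -/

section Riesz

/-- A functional bounded by the pullback of a Hilbert norm is represented by a vector. -/
theorem exists_inner_representation {V E : Type*} [AddCommGroup V] [Module ℝ V]
    [NormedAddCommGroup E] [InnerProductSpace ℝ E] [CompleteSpace E] (ι : V →ₗ[ℝ] E)
    (B : V →ₗ[ℝ] ℝ) {C : ℝ} (hC : 0 ≤ C) (h : ∀ v, |B v| ≤ C * ‖ι v‖) :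
    ∃ g : E, ‖g‖ ≤ C ∧ ∀ v, inner ℝ g (ι v) = B v := by
  -- The bound makes `B` descend to a bounded functional on the range of `ι`. The range need not be
  -- closed: Hahn–Banach extends the functional to `E` without increasing its norm, and Riesz
  -- represents it.
  have hker : LinearMap.ker ι ≤ LinearMap.ker B := by
    intro v hv
    have := h v
    rw [LinearMap.mem_ker.1 hv, norm_zero, mul_zero] at this
    exact abs_nonpos_iff.1 this
  let f₀ : LinearMap.range ι →ₗ[ℝ] ℝ :=
    ((LinearMap.ker ι).liftQ B hker).comp ι.quotKerEquivRange.symm.toLinearMap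
  have hf₀ : ∀ v, f₀ ⟨ι v, v, rfl⟩ = B v := by
    intro v
    have : ι.quotKerEquivRange.symm ⟨ι v, v, rfl⟩ = (LinearMap.ker ι).mkQ v := by
      rw [LinearEquiv.symm_apply_eq]
      rfl
    simp only [f₀, LinearMap.comp_apply, LinearEquiv.coe_coe, this]
    rfl
  let f : StrongDual ℝ (LinearMap.range ι) := f₀.mkContinuous C (by
    rintro ⟨_, v, rfl⟩
    rw [hf₀]
    exact h v)
  obtain ⟨F, hF, hFn⟩ := exists_extension_norm_eq (LinearMap.range ι) f
  refine ⟨(InnerProductSpace.toDual ℝ E).symm F, ?_, fun v => ?_⟩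
  · rw [LinearIsometryEquiv.norm_map, hFn]
    exact LinearMap.mkContinuous_norm_le _ hC _
  · rw [InnerProductSpace.toDual_symm_apply, ← hf₀ v]
    exact hF ⟨ι v, v, rfl⟩

/-- The quadratic polynomial `C b² c² + x c + C A²` is nonnegative for all `c`, so its discriminant
is not positive. No division occurs, so `A = 0` and `b = 0` are included. -/
theorem abs_le_of_quadratic_bound {A b x : ℝ} (hA : 0 ≤ A) (hb : 0 ≤ b) {C : ℝ} (hC : 0 ≤ C)
    (h : ∀ c : ℝ, |c * x| ≤ C * (A ^ 2 + (c * b) ^ 2)) : |x| ≤ 2 * C * A * b := by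
  have h1 : discrim (C * b ^ 2) x (C * A ^ 2) ≤ 0 := by
    refine discrim_le_zero fun c => ?_
    have := h c
    have := neg_abs_le (c * x)
    nlinarith
  rw [discrim] at h1
  refine abs_le_of_sq_le_sq ?_ (by positivity)
  nlinarith

end Riesz

/-! ### The weak form -/

section WeakForm

variable {d : ℕ} {a : Vel d → Vel d} {r T : ℝ} {k : ℕ} {N : ℝ≥0∞}
  {U : ℝ → ℝ → Torus d → Vel d → ℝ} {H φ ψ : ℝ → Torus d → ℝ}

theorem weightedSq_le_weightedSobolevNorm {f : Torus d → Vel d → ℝ} (α β : List (Fin d))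
    (h : α.length + β.length ≤ k) :
    weightedSq r (α.foldr dx (β.foldr dv f)) ≤ weightedSobolevNorm k r f ^ 2 := by
  have e : weightedSq r (α.foldr dx (β.foldr dv f)) = ∫⁻ x : Torus d, ∫⁻ v : Vel d,
      ENNReal.ofReal ((1 + ‖v‖ ^ 2) ^ r * |mixedDeriv α.get β.get f x v| ^ 2) := by
    unfold mixedDeriv weightedSq
    rw [List.ofFn_get, List.ofFn_get]
  rw [e, weightedSobolevNorm, ← ENNReal.rpow_natCast, ← ENNReal.rpow_mul]
  norm_num only [one_div, Nat.cast_ofNat, ENNReal.rpow_one]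
  have h1 := Finset.single_le_sum (fun _ _ => zero_le) (Finset.mem_univ β.get)
    (f := fun β' : Fin β.length → Fin d => ∫⁻ x : Torus d, ∫⁻ v : Vel d,
      ENNReal.ofReal ((1 + ‖v‖ ^ 2) ^ r * |mixedDeriv α.get β' f x v| ^ 2))
  have h2 := Finset.single_le_sum (fun _ _ => zero_le) (Finset.mem_univ α.get)
    (f := fun α' : Fin α.length → Fin d => ∑ β' : Fin β.length → Fin d,
      ∫⁻ x : Torus d, ∫⁻ v : Vel d,
        ENNReal.ofReal ((1 + ‖v‖ ^ 2) ^ r * |mixedDeriv α' β' f x v| ^ 2))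
  refine (h1.trans h2).trans ?_
  exact Finset.single_le_sum (fun _ _ => zero_le)
    (s := (Finset.range (k + 1) ×ˢ Finset.range (k + 1)).filter (fun p => p.1 + p.2 ≤ k))
    (a := (α.length, β.length)) (by simp; omega)
    (f := fun p : ℕ × ℕ => ∑ α' : Fin p.1 → Fin d, ∑ β' : Fin p.2 → Fin d,
      ∫⁻ x : Torus d, ∫⁻ v : Vel d,
        ENNReal.ofReal ((1 + ‖v‖ ^ 2) ^ r * |mixedDeriv α' β' f x v| ^ 2))

theorem weightedBound_supSobolevNorm
    (hU : ∀ t ∈ Set.Icc (0 : ℝ) T, ∀ s ∈ Set.Icc (0 : ℝ) T,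
      ContDiff ℝ k (fun p : Vel d × Vel d => U t s (toTorus p.1) p.2)) :
    ∀ p ∈ timeTriangle T, WeightedBound r k (supSobolevNorm k r T U) (U p.1 p.2) := by
  rintro p ⟨h1, h2, h3⟩
  have ht : p.1 ∈ Set.Icc (0 : ℝ) T := ⟨(h1.trans h2).le, h3.le⟩
  have hs : p.2 ∈ Set.Icc (0 : ℝ) T := ⟨h1.le, (h2.trans h3).le⟩
  refine ⟨hU p.1 ht p.2 hs, fun α β hab => (weightedSq_le_weightedSobolevNorm α β hab).trans ?_⟩
  refine pow_le_pow_left' ?_ 2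
  refine (le_iSup₂ (f := fun t (_ : t ∈ Set.Icc 0 T) => weightedSobolevNorm k r (U t p.2))
    p.1 ht).trans ?_
  exact le_iSup₂ (f := fun s (_ : s ∈ Set.Icc 0 T) =>
    ⨆ t ∈ Set.Icc (0 : ℝ) T, weightedSobolevNorm k r (U t s)) p.2 hs

theorem MemL2.exists_stronglyMeasurable (hH : MemL2 T H) :
    ∃ G : ℝ → Torus d → ℝ, StronglyMeasurable (Function.uncurry G) ∧
      Function.uncurry H =ᵐ[spaceTime d T] Function.uncurry G ∧
      sqL2 T G = normL2 T H ^ 2 ∧ sqL2 T G < ⊤ := by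
  have hm : StronglyMeasurable
      (Function.uncurry fun s x => hH.1.mk (Function.uncurry H) (s, x)) :=
    hH.1.stronglyMeasurable_mk
  have he : sqL2 T (fun s x => hH.1.mk (Function.uncurry H) (s, x)) = normL2 T H ^ 2 := by
    rw [← normL2_sq hm]
    exact congrArg (· ^ 2) (eLpNorm_congr_ae hH.1.ae_eq_mk.symm)
  exact ⟨_, hm, hH.1.ae_eq_mk, he, he ▸ ENNReal.pow_lt_top hH.2⟩

/-- Integration over the triangle, slice by slice. -/
theorem integrableOn_triangle_iff {f : (ℝ × Torus d) × (ℝ × Vel d) → ℝ} :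
    IntegrableOn f (triangle d T) ↔
      Integrable (fun q => f (rearrange d q)) (sliceMeasure d T) :=
  ((measurePreserving_triangle d T).integrable_comp_emb
    (rearrange d).measurableEmbedding).symm

theorem setIntegral_triangle (f : (ℝ × Torus d) × (ℝ × Vel d) → ℝ) :
    ∫ p in triangle d T, f p = ∫ q, f (rearrange d q) ∂sliceMeasure d T :=
  ((measurePreserving_triangle d T).integral_comp (rearrange d).measurableEmbedding f).symm

theorem weakIntegrand_rearrange (i : Fin d) (q : (ℝ × ℝ) × (Torus d × Vel d)) :
    weakIntegrand a U i H φ (rearrange d q)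
      = H q.1.2 (foot a q.1.1 q.1.2 q.2.1 q.2.2) * dxMul i (U q.1.1 q.1.2) (φ q.1.1) q.2.1 q.2.2 :=
  rfl

theorem integrable_weakIntegrand (hr : (d : ℝ) / 2 < r) (ha : Continuous a) (hN : N < ⊤)
    (hk : 1 ≤ k)
    (hUm : Measurable (fun p : ℝ × ℝ × Torus d × Vel d => U p.1 p.2.1 p.2.2.1 p.2.2.2))
    (hU : ∀ p ∈ timeTriangle T, WeightedBound r k N (U p.1 p.2)) (i : Fin d)
    (hH : MemL2 T H) (hφ : IsTest T φ) :
    Integrable (fun q => weakIntegrand a U i H φ (rearrange d q)) (sliceMeasure d T) := by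
  obtain ⟨G, hG, hHG, -, hG2⟩ := hH.exists_stronglyMeasurable
  obtain ⟨B, hB⟩ := hφ.exists_bound i
  have h1 := integrable_slice hr ha hG hG2
    (F := fun t s => dxMul i (U t s) (φ t))
    (aestronglyMeasurable_dxMul i hUm (fun p hp => (hU p hp).phaseDiff.mono hk)
      hφ.continuous.measurable hφ.slice)
    (fun p hp => measurable_dxMul i ((hU p hp).phaseDiff.mono hk) (hφ.slice p.1))
    (M := ENNReal.ofReal (2 * B ^ 2) * (N ^ 2 + N ^ 2))
    (ENNReal.mul_lt_top ENNReal.ofReal_lt_top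
      (ENNReal.add_lt_top.2 ⟨ENNReal.pow_lt_top hN, ENNReal.pow_lt_top hN⟩))
    (fun p hp => weightedSq_dxMul_le i (hU p hp) hk (hφ.slice p.1) (fun x => (hB p.1 x).1)
      (fun x => (hB p.1 x).2))
  refine h1.congr ?_
  filter_upwards [ae_foot ha hHG] with q hq
  rw [weakIntegrand_rearrange]
  exact congrArg (· * _) hq.symm

/-- The weak form of the averaging operator. -/
def weakForm (T : ℝ) (a : Vel d → Vel d) (U : ℝ → ℝ → Torus d → Vel d → ℝ) (i : Fin d)
    (H φ : ℝ → Torus d → ℝ) : ℝ := ∫ q, weakIntegrand a U i H φ (rearrange d q) ∂sliceMeasure d T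

/-- Only almost everywhere on the slices, since additivity of the derivative uses differentiability
of `U(t, s)`, assumed on the triangle alone. Homogeneity needs no such restriction. -/
theorem weakIntegrand_add (i : Fin d)
    (hU : ∀ p ∈ timeTriangle T, PhaseDiff 1 (U p.1 p.2)) (hφ : IsTest T φ) (hψ : IsTest T ψ) :
    ∀ᵐ q ∂sliceMeasure d T, weakIntegrand a U i H (fun t x => φ t x + ψ t x) (rearrange d q)
      = weakIntegrand a U i H φ (rearrange d q) + weakIntegrand a U i H ψ (rearrange d q) := by
  filter_upwards [ae_sliceMeasure_time hU] with q hq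
  simp only [weakIntegrand_rearrange]
  rw [dxMul_eq i hq (hφ.slice _), dxMul_eq i hq (hψ.slice _),
    dxMul_eq i hq ((hφ.add hψ).slice _)]
  have h : torusDeriv i (fun x => φ q.1.1 x + ψ q.1.1 x) q.2.1
      = torusDeriv i (φ q.1.1) q.2.1 + torusDeriv i (ψ q.1.1) q.2.1 :=
    ((hasDerivAt_torusDeriv ((hφ.slice q.1.1).differentiable one_ne_zero) i q.2.1).add
      (hasDerivAt_torusDeriv ((hψ.slice q.1.1).differentiable one_ne_zero) i q.2.1)).deriv
  rw [h]
  ring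

theorem weakIntegrand_const_mul (i : Fin d) (c : ℝ) (p : (ℝ × Torus d) × (ℝ × Vel d)) :
    weakIntegrand a U i H (fun t x => c * φ t x) p = c * weakIntegrand a U i H φ p := by
  unfold weakIntegrand torusDeriv
  rw [mul_left_comm c, ← deriv_const_mul_field c]
  simp only [mul_left_comm _ c]

end WeakForm

/-! ### Existence and uniqueness of the averaging operator -/

section Existence

variable {d : ℕ} {a : Vel d → Vel d} {r T : ℝ} {k : ℕ} {N : ℝ≥0∞} {C : ℝ≥0}
  {U : ℝ → ℝ → Torus d → Vel d → ℝ} {H φ ψ : ℝ → Torus d → ℝ} {i : Fin d}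

theorem weakForm_congr (ha : Continuous a) {G : ℝ → Torus d → ℝ}
    (h : Function.uncurry H =ᵐ[spaceTime d T] Function.uncurry G) :
    weakForm T a U i H φ = weakForm T a U i G φ := by
  refine integral_congr_ae ?_
  filter_upwards [ae_foot ha h] with q hq using congrArg (· * _) hq

/-- Boundedness of the averaging form on square integrable pairs. -/
def FormBound (T : ℝ) (a : Vel d → Vel d) (U : ℝ → ℝ → Torus d → Vel d → ℝ) (i : Fin d)
    (M : ℝ≥0∞) : Prop :=
  ∀ H φ : ℝ → Torus d → ℝ, StronglyMeasurable (Function.uncurry H) → sqL2 T H < ⊤ →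
    StronglyMeasurable (Function.uncurry φ) → sqL2 T φ < ⊤ →
    (∀ t, ContDiff ℝ 1 fun z => φ t (toTorus z)) →
    ∫⁻ p in timeTriangle T, ‖∫ q : Torus d × Vel d,
      H p.2 (foot a p.1 p.2 q.1 q.2) * dxMul i (U p.1 p.2) (φ p.1) q.1 q.2‖ₑ
        ≤ M * (sqL2 T H + sqL2 T φ)

theorem abs_weakForm_le {M : ℝ≥0∞} (hM : M ≠ ⊤) (hB : FormBound T a U i M) (ha : Continuous a)
    (hH : MemL2 T H) (hφ : IsTest T φ)
    (hint : ∀ G, MemL2 T G →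
      Integrable (fun q => weakIntegrand a U i G φ (rearrange d q)) (sliceMeasure d T)) :
    |weakForm T a U i H φ|
      ≤ M.toReal * ((normL2 T H).toReal ^ 2 + (normL2 T φ).toReal ^ 2) := by
  obtain ⟨G, hG, hHG, hGn, hG2⟩ := hH.exists_stronglyMeasurable
  have hφm : StronglyMeasurable (Function.uncurry φ) := hφ.continuous.stronglyMeasurable
  have hφ2 : sqL2 T φ < ⊤ := normL2_sq (T := T) hφm ▸ ENNReal.pow_lt_top hφ.memL2.2
  have h1 : ‖weakForm T a U i H φ‖ₑ ≤ M * (normL2 T H ^ 2 + normL2 T φ ^ 2) := by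
    rw [← hGn, normL2_sq hφm, weakForm_congr ha hHG]
    refine le_trans ?_ (hB G φ hG hG2 hφm hφ2 hφ.slice)
    have hi := hint G (hH.ae_eq hHG)
    unfold weakForm sliceMeasure at *
    rw [integral_prod _ hi]
    exact enorm_integral_le_lintegral_enorm _
  have h2 := ENNReal.toReal_mono (ENNReal.mul_ne_top hM (ENNReal.add_ne_top.2
    ⟨(ENNReal.pow_lt_top hH.2).ne, (ENNReal.pow_lt_top hφ.memL2.2).ne⟩)) h1
  rw [toReal_enorm, Real.norm_eq_abs, ENNReal.toReal_mul, ENNReal.toReal_add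
    (ENNReal.pow_lt_top hH.2).ne (ENNReal.pow_lt_top hφ.memL2.2).ne, ENNReal.toReal_pow,
    ENNReal.toReal_pow] at h2
  exact h2

/-- The space of test functions. -/
def testSpace (d : ℕ) (T : ℝ) : Submodule ℝ (ℝ → Torus d → ℝ) where
  carrier := {φ | IsTest T φ}
  add_mem' h₁ h₂ := h₁.add h₂
  zero_mem' := ⟨contDiff_const, 1, one_pos, fun _ _ _ => rfl⟩
  smul_mem' c _ h := h.const_mul c

/-- The inclusion of the test functions in `L²`. -/
def testToLp (d : ℕ) (T : ℝ) : testSpace d T →ₗ[ℝ] Lp ℝ 2 (spaceTime d T) where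
  toFun φ := (IsTest.memL2 φ.2).toLp (Function.uncurry (φ : ℝ → Torus d → ℝ))
  map_add' _ _ := rfl
  map_smul' _ _ := rfl

/-- For fixed `H` the weak form is linear in the test function and, by the form bound, continuous
for the `L²` norm; the Riesz vector is `g`. -/
theorem exists_isAveraging {M : ℝ≥0∞} (hM : M ≠ ⊤) (hB : FormBound T a U i M)
    (ha : Continuous a) (hU : ∀ p ∈ timeTriangle T, PhaseDiff 1 (U p.1 p.2))
    (hint : ∀ G φ, MemL2 T G → IsTest T φ →
      Integrable (fun q => weakIntegrand a U i G φ (rearrange d q)) (sliceMeasure d T))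
    (hH : MemL2 T H) :
    ∃ g, IsAveraging T a U i H g ∧ normL2 T g ≤ 2 * M * normL2 T H := by
  let B : testSpace d T →ₗ[ℝ] ℝ :=
    { toFun := fun φ => -weakForm T a U i H φ
      map_add' := fun φ ψ => by
        rw [← neg_add]
        refine congrArg Neg.neg ?_
        unfold weakForm
        rw [← integral_add (hint H φ hH φ.2) (hint H ψ hH ψ.2)]
        exact integral_congr_ae (weakIntegrand_add i hU φ.2 ψ.2)
      map_smul' := fun c φ => by
        rw [RingHom.id_apply, smul_eq_mul, mul_neg]
        refine congrArg Neg.neg ?_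
        unfold weakForm
        rw [← integral_const_mul]
        exact integral_congr_ae (Filter.Eventually.of_forall fun q =>
          weakIntegrand_const_mul i c _) }
  have hnorm : ∀ φ : testSpace d T, ‖testToLp d T φ‖ = (normL2 T (φ : ℝ → Torus d → ℝ)).toReal :=
    fun φ => Lp.norm_toLp _ (IsTest.memL2 φ.2)
  -- The form bound is applied to all multiples `c φ`, which replaces the sum of squares by twice a
  -- product.
  have hbound : ∀ φ, |B φ| ≤ (2 * M.toReal * (normL2 T H).toReal) * ‖testToLp d T φ‖ := by
    intro φ
    refine abs_le_of_quadratic_bound ENNReal.toReal_nonneg (norm_nonneg _)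
      ENNReal.toReal_nonneg fun c => ?_
    have h := abs_weakForm_le hM hB ha hH (c • φ).2 (fun G hG => hint G _ hG (c • φ).2)
    rw [← hnorm, map_smul, norm_smul, mul_pow, Real.norm_eq_abs, sq_abs, ← mul_pow,
      ← abs_neg] at h
    have h2 : -weakForm T a U i H ((c • φ : testSpace d T) : ℝ → Torus d → ℝ) = c * B φ :=
      B.map_smul c φ
    rwa [h2] at h
  obtain ⟨g, hg, hgB⟩ := exists_inner_representation (testToLp d T) B (by positivity) hbound
  refine ⟨fun t x => g (t, x), ⟨Lp.memLp g, fun φ hφ =>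
    integrableOn_triangle_iff.2 (hint H φ hH hφ), fun φ hφ => ?_⟩, ?_⟩
  · rw [setIntegral_triangle]
    have h := hgB ⟨φ, hφ⟩
    rw [L2.inner_def] at h
    refine Eq.trans (integral_congr_ae ?_) h
    filter_upwards [hφ.memL2.coeFn_toLp] with p hp
    have : testToLp d T ⟨φ, hφ⟩ p = φ p.1 p.2 := hp
    rw [this]
    simp [mul_comm]
  · have h1 : normL2 T (fun t x => g (t, x)) = ‖g‖ₑ := (Lp.enorm_def g).symm
    rw [h1, ← ofReal_norm]
    refine (ENNReal.ofReal_le_ofReal hg).trans (le_of_eq ?_)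
    rw [ENNReal.ofReal_mul (by positivity), ENNReal.ofReal_mul zero_le_two,
      ENNReal.ofReal_toReal hM, ENNReal.ofReal_toReal (show normL2 T H ≠ ⊤ from hH.2.ne)]
    norm_num

theorem MemL2.integrable (hH : MemL2 T H) :
    Integrable (Function.uncurry H) (spaceTime d T) :=
  MemLp.integrable one_le_two hH

theorem MemL2.integrable_mul_test (hH : MemL2 T H) (hφ : IsTest T φ) :
    Integrable (fun p => H p.1 p.2 * φ p.1 p.2) (spaceTime d T) :=
  MemLp.integrable_mul hH hφ.memL2

theorem IsAveraging.ae_eq {g g' : ℝ → Torus d → ℝ} (h : IsAveraging T a U i H g)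
    (h' : IsAveraging T a U i H g') :
    Function.uncurry g' =ᵐ[spaceTime d T] Function.uncurry g := by
  refine (sub_ae_eq_zero _ _).1 (ae_eq_zero_of_isTest (h'.memL2.integrable.sub h.memL2.integrable)
    fun φ hφ => ?_)
  have e : ∀ p : ℝ × Torus d, (Function.uncurry g' - Function.uncurry g) p * φ p.1 p.2
      = g' p.1 p.2 * φ p.1 p.2 - g p.1 p.2 * φ p.1 p.2 := fun p => sub_mul _ _ _
  simp only [e]
  rw [integral_sub (h'.memL2.integrable_mul_test hφ) (h.memL2.integrable_mul_test hφ),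
    h'.weak_eq φ hφ, h.weak_eq φ hφ, sub_self]

end Existence

/-! ### The averaging operator of differentiable functions -/

section Classical

variable {d : ℕ} {a : Vel d → Vel d} {r T : ℝ} {k : ℕ} {N : ℝ≥0∞}
  {U : ℝ → ℝ → Torus d → Vel d → ℝ} {H φ : ℝ → Torus d → ℝ} {i : Fin d}

/-- The averaging integrand as a function of all variables. -/
def fullIntegrand (a : Vel d → Vel d) (U : ℝ → ℝ → Torus d → Vel d → ℝ) (i : Fin d)
    (H : ℝ → Torus d → ℝ) (p : (ℝ × Torus d) × (ℝ × Vel d)) : ℝ :=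
  averagingIntegrand a U i H p.1.1 p.1.2 p.2.1 p.2.2

theorem integrable_fullIntegrand (hr : (d : ℝ) / 2 < r) (ha : Continuous a) (hN : N < ⊤)
    (hUm : Measurable (fun p : ℝ × ℝ × Torus d × Vel d => U p.1 p.2.1 p.2.2.1 p.2.2.2))
    (hU : ∀ p ∈ timeTriangle T, WeightedBound r k N (U p.1 p.2))
    (hd : MemL2 T (fun s => torusDeriv i (H s))) :
    Integrable (fun q => fullIntegrand a U i H (rearrange d q)) (sliceMeasure d T) := by
  obtain ⟨G, hG, hHG, -, hG2⟩ := hd.exists_stronglyMeasurable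
  have hUm' : Measurable fun q : (ℝ × ℝ) × (Torus d × Vel d) => U q.1.1 q.1.2 q.2.1 q.2.2 :=
    hUm.comp (f := fun q : (ℝ × ℝ) × (Torus d × Vel d) => (q.1.1, q.1.2, q.2.1, q.2.2))
      (by fun_prop)
  have h1 := integrable_slice hr ha hG hG2 (F := U) hUm'.aestronglyMeasurable
    (fun p hp => (hU p hp).phaseDiff.continuous.measurable) (M := N ^ 2) (ENNReal.pow_lt_top hN)
    (fun p hp => (hU p hp).bound [] [] (by simp))
  refine h1.congr ?_
  filter_upwards [ae_foot ha hHG] with q hq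
  exact congrArg (· * _) hq.symm

/-- For fixed `v` the foot is a translate of `x`, and translation commutes with `∂_{x_i}`; then
integrate by parts on the torus. The two integrability hypotheses allow `x` to be integrated first.
-/
theorem integral_torusDeriv_foot_mul {f : Torus d → ℝ} {F : Torus d → Vel d → ℝ}
    {ψ : Torus d → ℝ} (hf : ContDiff ℝ 1 fun z => f (toTorus z)) (hF : PhaseDiff 1 F)
    (hψ : ContDiff ℝ 1 fun z => ψ (toTorus z)) (i : Fin d) (t s : ℝ)
    (h₁ : Integrable fun q : Torus d × Vel d =>
      torusDeriv i f (foot a t s q.1 q.2) * F q.1 q.2 * ψ q.1)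
    (h₂ : Integrable fun q : Torus d × Vel d => f (foot a t s q.1 q.2) * dxMul i F ψ q.1 q.2) :
    ∫ q : Torus d × Vel d, torusDeriv i f (foot a t s q.1 q.2) * F q.1 q.2 * ψ q.1
      = -∫ q : Torus d × Vel d, f (foot a t s q.1 q.2) * dxMul i F ψ q.1 q.2 := by
  rw [Measure.volume_eq_prod] at h₁ h₂ ⊢
  rw [integral_prod_symm _ h₁, integral_prod_symm _ h₂, ← integral_neg]
  refine integral_congr_ae (Filter.Eventually.of_forall fun v => ?_)
  simp only
  set c : Vel d := (t - s) • a v with hc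
  have hfc : ContDiff ℝ 1 fun z => (fun x => f (x - toTorus c)) (toTorus z) := by
    have e : (fun z => f (toTorus z - toTorus c)) = fun z => f (toTorus (z - c)) := by
      funext z
      rw [show toTorus z = toTorus (z - c) + toTorus c by rw [← toTorus_add, sub_add_cancel],
        add_sub_cancel_right]
    simp only [e]
    exact hf.comp (contDiff_id.sub contDiff_const)
  have hg : ContDiff ℝ 1 fun z => (fun x => F x v * ψ x) (toTorus z) := by
    have h := hF.slice_left v
    norm_cast at h
    exact h.mul hψ
  have h := integral_torusDeriv_mul (f := fun x => f (x - toTorus c))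
    (g := fun x => F x v * ψ x) i hfc hg
  have e : ∀ x, torusDeriv i (fun x => f (x - toTorus c)) x
      = torusDeriv i f (x - toTorus c) := by
    intro x
    unfold torusDeriv
    simp only [add_sub_right_comm]
  simp only [e, ← mul_assoc] at h
  exact h

theorem integral_fullIntegrand_mul_test (hr : (d : ℝ) / 2 < r) (ha : Continuous a) (hN : N < ⊤)
    (hk : 1 ≤ k)
    (hUm : Measurable (fun p : ℝ × ℝ × Torus d × Vel d => U p.1 p.2.1 p.2.2.1 p.2.2.2))
    (hU : ∀ p ∈ timeTriangle T, WeightedBound r k N (U p.1 p.2))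
    (hH : MemL2 T H) (hs : ∀ s ∈ Set.Ioo (0 : ℝ) T, ContDiff ℝ 1 fun x => H s (toTorus x))
    (hd : MemL2 T (fun s => torusDeriv i (H s))) (hφ : IsTest T φ) :
    ∫ p in triangle d T, fullIntegrand a U i H p * φ p.1.1 p.1.2
      = -∫ p in triangle d T, weakIntegrand a U i H φ p := by
  obtain ⟨B, hB⟩ := hφ.exists_bound i
  have h1 := integrable_fullIntegrand hr ha hN hUm hU hd
  have h2 := integrable_weakIntegrand hr ha hN hk hUm hU i hH hφ
  have hm : Continuous fun q : (ℝ × ℝ) × (Torus d × Vel d) => φ q.1.1 q.2.1 :=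
    hφ.continuous.comp (f := fun q : (ℝ × ℝ) × (Torus d × Vel d) => (q.1.1, q.2.1)) (by fun_prop)
  have h3 : Integrable (fun q => fullIntegrand a U i H (rearrange d q) * φ q.1.1 q.2.1)
      (sliceMeasure d T) :=
    h1.mul_bdd (c := B) hm.aestronglyMeasurable
      (Filter.Eventually.of_forall fun q => (hB q.1.1 q.2.1).1)
  rw [setIntegral_triangle, setIntegral_triangle]
  change ∫ q, fullIntegrand a U i H (rearrange d q) * φ q.1.1 q.2.1 ∂_ = _
  unfold sliceMeasure at *
  rw [integral_prod _ h3, integral_prod _ h2, ← integral_neg]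
  refine integral_congr_ae ?_
  filter_upwards [h3.prod_right_ae, h2.prod_right_ae,
    ae_restrict_mem (measurableSet_timeTriangle T)] with p hp3 hp2 hpT
  exact integral_torusDeriv_foot_mul (hs p.2 ⟨hpT.1, hpT.2.1.trans hpT.2.2⟩)
    ((hU p hpT).phaseDiff.mono hk) (hφ.slice p.1) i p.1 p.2 hp3 hp2

theorem spaceTime_eq_restrict (d : ℕ) (T : ℝ) :
    spaceTime d T = volume.restrict (Set.Ioo 0 T ×ˢ Set.univ) := by
  rw [Measure.volume_eq_prod, ← Measure.prod_restrict, Measure.restrict_univ]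
  rfl

theorem indicator_triangle {f : (ℝ × Torus d) × (ℝ × Vel d) → ℝ} {p : ℝ × Torus d}
    (hp : p.1 ∈ Set.Ioo 0 T) :
    (fun q => (triangle d T).indicator f (p, q))
      = (Set.Ioo 0 p.1 ×ˢ Set.univ).indicator fun q => f (p, q) := by
  funext q
  by_cases h : q.1 ∈ Set.Ioo 0 p.1
  · rw [Set.indicator_of_mem (show (p, q) ∈ triangle d T from ⟨h.1, h.2, hp.2⟩),
      Set.indicator_of_mem (show q ∈ Set.Ioo 0 p.1 ×ˢ Set.univ from ⟨h, trivial⟩)]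
  · rw [Set.indicator_of_notMem fun h' => h ⟨h'.1, h'.2.1⟩,
      Set.indicator_of_notMem fun h' => h h'.1]

/-- The integral of the explicit integrand over `(s, v)` is known only to be integrable in `(t, x)`,
not square integrable. It satisfies the weak equation of `g`, and uniqueness among integrable
functions suffices. -/
theorem IsAveraging.ae_eq_averagingOp {g : ℝ → Torus d → ℝ} (hg : IsAveraging T a U i H g)
    (hr : (d : ℝ) / 2 < r) (ha : Continuous a) (hN : N < ⊤) (hk : 1 ≤ k)
    (hUm : Measurable (fun p : ℝ × ℝ × Torus d × Vel d => U p.1 p.2.1 p.2.2.1 p.2.2.2))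
    (hU : ∀ p ∈ timeTriangle T, WeightedBound r k N (U p.1 p.2))
    (hH : MemL2 T H) (hs : ∀ s ∈ Set.Ioo (0 : ℝ) T, ContDiff ℝ 1 fun x => H s (toTorus x))
    (hd : MemL2 T (fun s => torusDeriv i (H s))) :
    ∀ᵐ p ∂spaceTime d T,
      IntegrableOn (fun q : ℝ × Vel d => averagingIntegrand a U i H p.1 p.2 q.1 q.2)
        (Set.Ioo 0 p.1 ×ˢ Set.univ) ∧ g p.1 p.2 = averagingOp a U i H p.1 p.2 := by
  -- Extension by zero outside the triangle, so that Fubini is used on a full product; for `t` in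
  -- `(0, T)` the section is then supported in `0 < s < t`.
  set f : (ℝ × Torus d) × (ℝ × Vel d) → ℝ := (triangle d T).indicator (fullIntegrand a U i H)
  have hf : Integrable f volume := (integrable_indicator_iff (measurableSet_triangle d T)).2
    (integrableOn_triangle_iff.2 (integrable_fullIntegrand hr ha hN hUm hU hd))
  rw [Measure.volume_eq_prod] at hf
  set A : ℝ × Torus d → ℝ := fun p => ∫ q, f (p, q) with hAdef
  have hA : Integrable A volume := hf.integral_prod_left
  have hA' : Integrable A (spaceTime d T) := spaceTime_eq_restrict d T ▸ hA.restrict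
  have hgA : Function.uncurry g =ᵐ[spaceTime d T] A := by
    refine (sub_ae_eq_zero _ _).1 (ae_eq_zero_of_isTest (hg.memL2.integrable.sub hA')
      fun φ hφ => ?_)
    obtain ⟨B, hB⟩ := hφ.exists_bound i
    have e : ∀ p : ℝ × Torus d, (Function.uncurry g - A) p * φ p.1 p.2
        = g p.1 p.2 * φ p.1 p.2 - A p * φ p.1 p.2 := fun p => sub_mul _ _ _
    have hAφ : Integrable (fun p => A p * φ p.1 p.2) (spaceTime d T) :=
      hA'.mul_bdd (c := B) hφ.continuous.aestronglyMeasurable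
        (Filter.Eventually.of_forall fun p => (hB p.1 p.2).1)
    have hfφ : Integrable (fun z : (ℝ × Torus d) × (ℝ × Vel d) => f z * φ z.1.1 z.1.2)
        ((volume : Measure (ℝ × Torus d)).prod volume) :=
      hf.mul_bdd (c := B) (hφ.continuous.comp continuous_fst).aestronglyMeasurable
        (Filter.Eventually.of_forall fun z => (hB z.1.1 z.1.2).1)
    have h1 : ∫ p, A p * φ p.1 p.2 ∂spaceTime d T
        = ∫ p in triangle d T, fullIntegrand a U i H p * φ p.1.1 p.1.2 := by
      rw [spaceTime_eq_restrict, setIntegral_eq_integral_of_forall_compl_eq_zero,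
        ← integral_indicator (measurableSet_triangle d T)]
      · have e2 : ∀ p : ℝ × Torus d, A p * φ p.1 p.2 = ∫ q, f (p, q) * φ p.1 p.2 := fun p =>
          (integral_mul_const _ _).symm
        simp only [e2]
        rw [Measure.volume_eq_prod (ℝ × Torus d), ← integral_prod _ hfφ]
        refine integral_congr_ae (Filter.Eventually.of_forall fun z => ?_)
        exact (Set.indicator_mul_left (triangle d T) _ fun z => φ z.1.1 z.1.2).symm
      · intro p hp
        have h0 : ∀ q, f (p, q) = 0 := fun q => Set.indicator_of_notMem (fun h => hp
          ⟨⟨h.1.trans h.2.1, h.2.2⟩, trivial⟩) _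
        simp [hAdef, h0]
    simp only [e]
    rw [integral_sub (hg.memL2.integrable_mul_test hφ) hAφ, h1, hg.weak_eq φ hφ,
      integral_fullIntegrand_mul_test hr ha hN hk hUm hU hH hs hd hφ, sub_self]
  have hsec : ∀ᵐ p ∂spaceTime d T, Integrable fun q => f (p, q) := by
    rw [spaceTime_eq_restrict]
    exact ae_restrict_of_ae hf.prod_right_ae
  have hmem : ∀ᵐ p ∂spaceTime d T, p.1 ∈ Set.Ioo 0 T := by
    rw [spaceTime_eq_restrict]
    filter_upwards [ae_restrict_mem (measurableSet_Ioo.prod MeasurableSet.univ)] with p hp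
    exact hp.1
  filter_upwards [hgA, hsec, hmem] with p h1 h2 hp
  have hm : MeasurableSet (Set.Ioo 0 p.1 ×ˢ (Set.univ : Set (Vel d))) :=
    measurableSet_Ioo.prod MeasurableSet.univ
  rw [indicator_triangle hp] at h2
  have h3 := (integrable_indicator_iff hm).1 h2
  refine ⟨h3, h1.trans ?_⟩
  rw [hAdef]
  simp only [f]
  rw [indicator_triangle hp, integral_indicator hm, Measure.volume_eq_prod, setIntegral_prod _ h3,
    averagingOp, intervalIntegral.integral_of_le hp.1.le, integral_Ioc_eq_integral_Ioo,
    Measure.restrict_univ]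
  rfl

end Classical

end VlasovAveraging

end

/-! ### The main theorem -/

theorem mainTheorem5 (d k : ℕ) (hk : d + 1 < k) (σ : ℝ) (hσ : (d : ℝ) / 2 < σ)
    (lam : ℝ) (hlam : 0 ≤ lam)
    (a : VlasovAveraging.Vel d → VlasovAveraging.Vel d)
    (ha : VlasovAveraging.IsAdvectionField a lam) :
    ∃ C : NNReal, ∀ T : ℝ, 0 < T →
      ∀ U : ℝ → ℝ → VlasovAveraging.Torus d → VlasovAveraging.Vel d → ℝ,
      Measurable (fun p : ℝ × ℝ × VlasovAveraging.Torus d × VlasovAveraging.Vel d =>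
        U p.1 p.2.1 p.2.2.1 p.2.2.2) →
      (∀ t ∈ Set.Icc (0 : ℝ) T, ∀ s ∈ Set.Icc (0 : ℝ) T,
        ContDiff ℝ k (fun p : VlasovAveraging.Vel d × VlasovAveraging.Vel d =>
          U t s (VlasovAveraging.toTorus p.1) p.2)) →
      VlasovAveraging.supSobolevNorm k (σ + (1 + lam) * ((d : ℝ) + k)) T U < ⊤ →
      ∀ i : Fin d, ∀ H : ℝ → VlasovAveraging.Torus d → ℝ, VlasovAveraging.MemL2 T H →
        ∃ g : ℝ → VlasovAveraging.Torus d → ℝ,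
          VlasovAveraging.IsAveraging T a U i H g ∧
          (∀ g' : ℝ → VlasovAveraging.Torus d → ℝ, VlasovAveraging.IsAveraging T a U i H g' →
            Function.uncurry g' =ᵐ[VlasovAveraging.spaceTime d T] Function.uncurry g) ∧
          ((∀ s ∈ Set.Ioo (0 : ℝ) T, ContDiff ℝ 1
              (fun x : VlasovAveraging.Vel d => H s (VlasovAveraging.toTorus x))) →
            VlasovAveraging.MemL2 T (fun s => VlasovAveraging.torusDeriv i (H s)) →
            ∀ᵐ p ∂(VlasovAveraging.spaceTime d T),
              MeasureTheory.IntegrableOn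
                (fun q : ℝ × VlasovAveraging.Vel d =>
                  VlasovAveraging.averagingIntegrand a U i H p.1 p.2 q.1 q.2)
                (Set.Ioo 0 p.1 ×ˢ Set.univ) ∧
              g p.1 p.2 = VlasovAveraging.averagingOp a U i H p.1 p.2) ∧
          VlasovAveraging.normL2 T g
            ≤ C * VlasovAveraging.supSobolevNorm k (σ + (1 + lam) * ((d : ℝ) + k)) T U
                * VlasovAveraging.normL2 T H := by
  have hr : (d : ℝ) / 2 < σ + (1 + lam) * ((d : ℝ) + k) :=
    hσ.trans_le (le_add_of_nonneg_right (by positivity))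
  -- In dimension zero there is no index `i`, so any constant will do.
  rcases isEmpty_or_nonempty (Fin d) with hd | hd
  · exact ⟨0, fun _ _ _ _ _ _ i => isEmptyElim i⟩
  obtain ⟨C, hC⟩ := VlasovAveraging.exists_form_bound hk ha hlam hσ
  -- The factor `2` comes from passing from a sum of squares to a product.
  refine ⟨2 * C, fun T _ U hUm hUd hN i H hH => ?_⟩
  have hc := ha.smooth.continuous
  have hk1 : 1 ≤ k := by omega
  have hU := VlasovAveraging.weightedBound_supSobolevNorm
    (r := σ + (1 + lam) * ((d : ℝ) + k)) hUd
  obtain ⟨g, hg, hgn⟩ := VlasovAveraging.exists_isAveraging (i := i)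
    (ENNReal.mul_ne_top ENNReal.coe_ne_top hN.ne) (hC T U _ hN.ne hU i) hc
    (fun p hp => (hU p hp).phaseDiff.mono hk1)
    (fun G φ hG hφ => VlasovAveraging.integrable_weakIntegrand hr hc hN hk1 hUm hU i hG hφ) hH
  refine ⟨g, hg, fun g' hg' => hg.ae_eq hg',
    fun hs hd => hg.ae_eq_averagingOp hr hc hN hk1 hUm hU hH hs hd, hgn.trans (le_of_eq ?_)⟩
  push_cast
  ring
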